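/- Let $p$ be a prime number. A scheme is called \emph{geometric} if it is quasi-compact and has affine diagonal. For an $\mathbb{F}_p$-scheme $X$ let $F\colon X\to X$ be the absolute Frobenius (the identity on the underlying space and $s\mapsto s^p$ on functions), and for $X$ geometric let $\operatorname{Frob}(\mathrm{QCoh}(X),F_*)$ be the abelian category of Frobenius modules on $X$: its objects are pairs $(M,\tau)$ of a quasi-coherent $\mathcal{O}_X$-module $M$ and an $\mathcal{O}_X$-linear map $\tau\colon M\to F_*M$, and its morphisms $(M,\tau)\to(N,\sigma)$ are the $\mathcal{O}_X$-linear maps $u\colon M\to N$ with $\sigma\circ u=F_*(u)\circ\tau$. Let $D^+(-)$ denote the bounded below (in cohomological grading) derived category of an abelian category. For a morphism $f\colon X\to Y$ of geometric $\mathbb{F}_p$-schemes (such $f$ is automatically quasi-compact and quasi-separated), the direct image of quasi-coherent modules together with the canonical isomorphism $f_*F_*\cong F_*f_*$ induces a left exact functor $$f_*\colon \operatorname{Frob}(\mathrm{QCoh}(X),F_*)\to\operatorname{Frob}(\mathrm{QCoh}(Y),F_*),$$ with right derived functor $Rf_*\colon D^+(\operatorname{Frob}(\mathrm{QCoh}(X),F_*))\to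 D^+(\operatorname{Frob}(\mathrm{QCoh}(Y),F_*))$. The inverse image of quasi-coherent modules induces a functor $f^*\colon \operatorname{Frob}(\mathrm{QCoh}(Y),F_*)\to\operatorname{Frob}(\mathrm{QCoh}(X),F_*)$ which is left adjoint to $f_*$. If $f$ is flat, then $f^*$ is exact; it therefore induces a functor $f^*$ on $D^+$, which is left adjoint to $Rf_*$. Let $$\begin{array}{ccc} X' & \xrightarrow{\;g'\;} & X\\ {\scriptstyle f'}\downarrow & & \downarrow{\scriptstyle f}\\ S' & \xrightarrow{\;g\;} & S\end{array}$$ be a cartesian square of geometric $\mathbb{F}_p$-schemes in which $g$ is flat (so that $g'$ is flat as well). Then for every $M\in D^+(\operatorname{Frob}(\mathrm{QCoh}(X),F_*))$ the base change map $$g^*Rf_*M\longrightarrow Rf'_*g'^*M ,$$ that is, the map which is adjoint to the composition $Rf_*M\to Rf_*Rg'_*g'^*M\to Rg_*Rf'_*g'^*M$ of the map induced by the unit of the adjunction $g'^*\dashv Rg'_*$ with the canonical map $Rf_*Rg'_*\cong R(f_*g'_*)\cong R(g_*f'_*)\to Rg_*Rf'_*$, is an isomorphism in $D^+(\operatorname{Frob}(\mathrm{QCoh}(S'),F_*))$.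 -/

import Mathlib

open CategoryTheory Limits AlgebraicGeometry TopologicalSpace

universe u

namespace FrobeniusModules

section
variable {X Y : Scheme.{u}}

/-- Quasi-coherence, as a property of objects of `X.Modules`. -/
def qcoh (X : Scheme.{u}) : ObjectProperty X.Modules := SheafOfModules.isQuasicoherent X.ringCatSheaf

instance : (qcoh X).IsClosedUnderIsomorphisms :=
  inferInstanceAs (SheafOfModules.isQuasicoherent X.ringCatSheaf).IsClosedUnderIsomorphisms

instance restrict_preservesLimits (f : X ⟶ Y) [IsOpenImmersion f] :
    PreservesLimits (Scheme.Modules.restrictFunctor f) := by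
  have : PreservesLimits (Scheme.Modules.restrictFunctor f ⋙ Scheme.Modules.toPresheaf X) :=
    have : PreservesLimits ((Functor.whiskeringLeft _ _ Ab.{u}).obj f.opensFunctor.op) := ⟨inferInstance⟩
    comp_preservesLimits (Scheme.Modules.toPresheaf Y)
      ((Functor.whiskeringLeft _ _ Ab.{u}).obj f.opensFunctor.op)
  have : ReflectsLimits (Scheme.Modules.toPresheaf X) := reflectsLimits_of_reflectsIsomorphisms
  exact preservesLimits_of_reflects_of_preserves _ (Scheme.Modules.toPresheaf X)

instance restrict_additive (f : X ⟶ Y) [IsOpenImmersion f] :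
    (Scheme.Modules.restrictFunctor f).Additive where
  map_add := rfl

theorem qcoh_restrict (f : X ⟶ Y) [IsOpenImmersion f] {M : Y.Modules} (hM : qcoh Y M) :
    qcoh X ((Scheme.Modules.restrictFunctor f).obj M) := by
  have : SheafOfModules.IsQuasicoherent (R := Y.ringCatSheaf) M := hM
  exact Scheme.Modules.isQuasicoherent_restrictFunctor f M

/-- Presentations of sheaves of modules are transported along isomorphisms. -/
noncomputable def presentationOfIso {M N : X.Modules} (e : M ≅ N)
    (P : SheafOfModules.Presentation (R := X.ringCatSheaf) M) :
    SheafOfModules.Presentation (R := X.ringCatSheaf) N :=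
  @SheafOfModules.Presentation.ofIsIso _ _ _ X.ringCatSheaf _ _ M N e.hom ⟨e.inv, e.hom_inv_id, e.inv_hom_id⟩ P

/-- A global presentation of a quasi-coherent module on an affine scheme. -/
noncomputable def presentationOfQcoh {R : CommRingCat.{u}} {M : (Spec R).Modules}
    (hM : qcoh (Spec R) M) : SheafOfModules.Presentation (R := (Spec R).ringCatSheaf) M :=
  have : IsIso M.fromTildeΓ := @Scheme.Modules.isIso_fromTildeΓ_of_isQuasicoherent R M hM
  presentationOfIso (asIso M.fromTildeΓ)
    (presentationTilde.{u} _ .univ (by simp) _ (Submodule.span_eq _))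

/-- A presentation of a module over an affine open subscheme on which it is quasi-coherent. -/
noncomputable def presentationOver {R : CommRingCat.{u}} (f : Spec R ⟶ X) [IsOpenImmersion f]
    {M : X.Modules} (hM : qcoh (Spec R) ((Scheme.Modules.restrictFunctor f).obj M)) :
    (SheafOfModules.over (R := X.ringCatSheaf) M f.opensRange).Presentation := by
  let e : f.opensRange.toScheme ≅ Spec R := (f.isoOpensRange).symm
  let P := Scheme.Modules.presentationRestrict e.hom (presentationOfQcoh hM)
  let i : Scheme.Modules.restrictFunctor f ⋙ Scheme.Modules.restrictFunctor e.hom ≅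
      Scheme.Modules.restrictFunctor f.opensRange.ι :=
    (Scheme.Modules.restrictFunctorComp _ _).symm ≪≫
      Scheme.Modules.restrictFunctorCongr (by simp [e])
  let P' : SheafOfModules.Presentation (R := f.opensRange.toScheme.ringCatSheaf)
    ((Scheme.Modules.restrictFunctor f.opensRange.ι).obj M) := presentationOfIso (i.app M) P
  let E := Scheme.Modules.overEquiv f.opensRange
  let η : SheafOfModules.unit (X.ringCatSheaf.over f.opensRange) ≅
    E.inverse.obj (SheafOfModules.unit _) := E.unitIso.app _
  have hE : PreservesColimits E.inverse := inferInstance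
  let P'' := @SheafOfModules.Presentation.map _ _ _ f.opensRange.toScheme.ringCatSheaf _ _ _ _ _
    (X.ringCatSheaf.over f.opensRange) _ _ _ P' E.inverse hE η
  exact P''.ofIsIso ((E.inverse.mapIso ((Scheme.Modules.overFunctorEquiv f.opensRange).app M).symm ≪≫
    E.unitIso.symm.app _).hom)

theorem qcoh_of_openCover (𝒰 : Scheme.AffineOpenCover.{u} X) {M : X.Modules}
    (h : ∀ i, qcoh _ ((Scheme.Modules.restrictFunctor (𝒰.f i)).obj M)) : qcoh X M := by
  have : Opens.grothendieckTopology X |>.CoversTop (fun i => (𝒰.f i).opensRange) := by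
    rw [Opens.coversTop_iff]
    exact 𝒰.openCover.isOpenCover_opensRange
  let q : SheafOfModules.QuasicoherentData (R := X.ringCatSheaf) M :=
    { I := 𝒰.I₀
      X := fun i => (𝒰.f i).opensRange
      coversTop := this
      presentation := fun i => presentationOver (𝒰.f i) (h i) }
  exact q.isQuasicoherent

end

section
variable {X Y : Scheme.{u}}

theorem qcoh_Spec_iff {R : CommRingCat.{u}} (M : (Spec R).Modules) :
    qcoh (Spec R) M ↔ IsLocalizing (modulesSpecToSheaf.obj M) := by
  rw [← isIso_fromTildeΓ_iff_isLocalizing]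
  exact isQuasicoherent_iff_isIso_fromTildeΓ M

theorem qcoh_Spec_iff_essImage {R : CommRingCat.{u}} (M : (Spec R).Modules) :
    qcoh (Spec R) M ↔ (tilde.functor R).essImage M :=
  iff_of_eq (congrFun (essImage_tilde (R := R)).symm M)

theorem kernel_sections {M N : X.Modules} (φ : M ⟶ N) (U : X.Opens) :
    Function.Injective ((kernel.ι φ).app U) ∧
      ∀ x, φ.app U x = 0 → ∃ y, (kernel.ι φ).app U y = x := by
  let T : X.Modules ⥤ Ab.{u} := Scheme.Modules.toPresheaf X ⋙ (evaluation _ _).obj (.op U)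
  have : T.PreservesZeroMorphisms := ⟨fun _ _ => rfl⟩
  have : PreservesFiniteLimits (Scheme.Modules.toPresheaf X) :=
    PreservesLimits.preservesFiniteLimits _
  have : PreservesFiniteLimits ((evaluation (Opens X)ᵒᵖ Ab.{u}).obj (.op U)) :=
    PreservesLimits.preservesFiniteLimits _
  have hT : PreservesFiniteLimits T := comp_preservesFiniteLimits _ _
  let S : ShortComplex X.Modules := ShortComplex.mk (kernel.ι φ) φ (kernel.condition φ)
  have hS : S.Exact := S.exact_of_f_is_kernel (kernelIsKernel φ)
  have h := hS.map_of_mono_of_preservesKernel T inferInstance inferInstance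
  refine ⟨(AddCommGrpCat.mono_iff_injective (T.map (kernel.ι φ))).1 inferInstance, ?_⟩
  exact (ShortComplex.ab_exact_iff _).1 h

theorem qcoh_Spec_kernel {R : CommRingCat.{u}} {M N : (Spec R).Modules} (φ : M ⟶ N)
    (hM : qcoh _ M) (hN : qcoh _ N) : qcoh _ (kernel φ) := by
  rw [qcoh_Spec_iff] at hM hN ⊢
  intro f
  have hf (U) := kernel_sections φ U
  have lin (U) (r : R) (x : Γ(kernel φ, U)) :
    (kernel.ι φ).app U (r • x) = r • (kernel.ι φ).app U x := (kernel.ι φ).app_smul _ _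
  have lin' (U) (r : R) (x : Γ(M, U)) :
    φ.app U (r • x) = r • φ.app U x := φ.app_smul _ _
  let V : (Spec R).Opens := PrimeSpectrum.basicOpen f
  have nat (x : Γ(kernel φ, ⊤)) : (kernel.ι φ).app V ((kernel φ).presheaf.map (homOfLE le_top).op x)
      = M.presheaf.map (homOfLE le_top).op ((kernel.ι φ).app ⊤ x) :=
    ConcreteCategory.congr_hom ((kernel.ι φ).mapPresheaf.naturality (homOfLE (le_top : V ≤ ⊤)).op) x
  have nat' (x : Γ(M, ⊤)) : φ.app V (M.presheaf.map (homOfLE le_top).op x)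
      = N.presheaf.map (homOfLE le_top).op (φ.app ⊤ x) :=
    ConcreteCategory.congr_hom (φ.mapPresheaf.naturality (homOfLE (le_top : V ≤ ⊤)).op) x
  have hMs (x : Γ(M, V)) : ∃ (n : ℕ) (y : Γ(M, ⊤)), f ^ n • x = M.presheaf.map (homOfLE le_top).op y := by
    obtain ⟨⟨y, ⟨_, n, rfl⟩⟩, h⟩ := (hM f).surj x
    exact ⟨n, y, h⟩
  have hM0 (x : Γ(M, ⊤)) (hx : M.presheaf.map (homOfLE (le_top : V ≤ ⊤)).op x = 0) :
      ∃ n : ℕ, f ^ n • x = 0 := by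
    obtain ⟨⟨_, n, rfl⟩, hn⟩ := ((hM f).eq_zero_iff _ _).1 hx
    exact ⟨n, hn⟩
  have hN0 (x : Γ(N, ⊤)) (hx : N.presheaf.map (homOfLE (le_top : V ≤ ⊤)).op x = 0) :
      ∃ n : ℕ, f ^ n • x = 0 := by
    obtain ⟨⟨_, n, rfl⟩, hn⟩ := ((hN f).eq_zero_iff _ _).1 hx
    exact ⟨n, hn⟩
  refine IsLocalizedModule.Away.mk_of_addCommGroup
    (Scheme.Modules.isUnit_algebraMap_end_of_le_basicOpen f le_rfl) ?_ ?_
  · intro x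
    change Γ(kernel φ, V) at x
    obtain ⟨n, y, hy⟩ := hMs ((kernel.ι φ).app V x)
    have h0 : φ.app V ((kernel.ι φ).app V x) = 0 := by
      rw [← ConcreteCategory.comp_apply, ← Scheme.Modules.Hom.comp_app, kernel.condition]
      rfl
    obtain ⟨m, hm⟩ := hN0 (φ.app ⊤ y) (by rw [← nat', ← hy, lin', h0, smul_zero])
    obtain ⟨z, hz⟩ := (hf ⊤).2 (f ^ m • y) (by rw [lin', hm])
    refine ⟨m + n, z, (hf V).1 ?_⟩
    refine (lin _ _ _).trans (Eq.trans ?_ (nat z).symm)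
    rw [hz, Scheme.Modules.map_smul_Spec, ← hy, pow_add, mul_smul]
  · intro x hx
    change Γ(kernel φ, ⊤) at x
    obtain ⟨n, hn⟩ := hM0 ((kernel.ι φ).app ⊤ x) (by
      rw [← nat x]
      refine (congrArg _ hx).trans (map_zero _))
    exact ⟨n, (hf ⊤).1 ((lin _ _ _).trans (hn.trans (map_zero _).symm))⟩

theorem qcoh_Spec_cokernel {R : CommRingCat.{u}} {M N : (Spec R).Modules} (φ : M ⟶ N)
    (hM : qcoh _ M) (hN : qcoh _ N) : qcoh _ (cokernel φ) := by
  obtain ⟨M', ⟨eM⟩⟩ := (qcoh_Spec_iff_essImage M).1 hM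
  obtain ⟨N', ⟨eN⟩⟩ := (qcoh_Spec_iff_essImage N).1 hN
  rw [qcoh_Spec_iff_essImage]
  let g := (tilde.functor R).preimage (eM.hom ≫ φ ≫ eN.inv)
  refine ⟨cokernel g, ⟨PreservesCokernel.iso (tilde.functor R) g ≪≫ cokernel.mapIso _ _ eM eN ?_⟩⟩
  rw [(tilde.functor R).map_preimage]
  simp

theorem qcoh_Spec_of_isLimit {R : CommRingCat.{u}} {J : Type} [Finite J]
    (F : Discrete J ⥤ (Spec R).Modules) (hF : ∀ j, qcoh _ (F.obj j))
    (c : Cone F) (hc : IsLimit c) : qcoh _ c.pt := by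
  rw [qcoh_Spec_iff_essImage]
  choose G hG using fun j => (qcoh_Spec_iff_essImage (F.obj ⟨j⟩)).1 (hF ⟨j⟩)
  let e : Discrete.functor G ⋙ tilde.functor R ≅ F :=
    Discrete.natIso (fun j => (hG j.as).some)
  refine ⟨limit (Discrete.functor G), ⟨?_⟩⟩
  exact IsLimit.conePointsIsoOfNatIso
    (isLimitOfPreserves (tilde.functor R) (limit.isLimit (Discrete.functor G))) hc e

theorem qcoh_of_isLimit {J : Type} [Finite J]
    (F : Discrete J ⥤ X.Modules) (hF : ∀ j, qcoh _ (F.obj j))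
    (c : Cone F) (hc : IsLimit c) : qcoh _ c.pt :=
  qcoh_of_openCover X.affineOpenCover fun i =>
    qcoh_Spec_of_isLimit (F ⋙ Scheme.Modules.restrictFunctor _) (fun j => qcoh_restrict _ (hF j))
      _ (isLimitOfPreserves (Scheme.Modules.restrictFunctor (X.affineOpenCover.f i)) hc)

theorem qcoh_kernel {M N : X.Modules} (φ : M ⟶ N) (hM : qcoh _ M) (hN : qcoh _ N) :
    qcoh _ (kernel φ) :=
  qcoh_of_openCover X.affineOpenCover fun _ =>
    (qcoh _).prop_of_iso (PreservesKernel.iso (Scheme.Modules.restrictFunctor _) φ).symm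
      (qcoh_Spec_kernel _ (qcoh_restrict _ hM) (qcoh_restrict _ hN))

theorem qcoh_cokernel {M N : X.Modules} (φ : M ⟶ N) (hM : qcoh _ M) (hN : qcoh _ N) :
    qcoh _ (cokernel φ) :=
  qcoh_of_openCover X.affineOpenCover fun _ =>
    (qcoh _).prop_of_iso (PreservesCokernel.iso (Scheme.Modules.restrictFunctor _) φ).symm
      (qcoh_Spec_cokernel _ (qcoh_restrict _ hM) (qcoh_restrict _ hN))

instance : (qcoh X).IsClosedUnderKernels where
  kernels_le := by
    rintro _ ⟨f, k, hk, hf⟩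
    exact (qcoh X).prop_of_iso (IsLimit.conePointUniqueUpToIso (kernelIsKernel f) hk)
      (qcoh_kernel f hf.1 hf.2)

instance : (qcoh X).IsClosedUnderCokernels where
  cokernels_le := by
    rintro _ ⟨f, k, hk, hf⟩
    exact (qcoh X).prop_of_iso (IsColimit.coconePointUniqueUpToIso (cokernelIsCokernel f) hk)
      (qcoh_cokernel f hf.1 hf.2)

instance (J : Type) [Finite J] : (qcoh X).IsClosedUnderLimitsOfShape (Discrete J) where
  limitsOfShape_le := by
    rintro M ⟨h⟩
    exact qcoh_of_isLimit _ h.prop_diag_obj _ h.isLimit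

instance : (qcoh X).IsClosedUnderFiniteProducts where
  isClosedUnderLimitsOfShape J _ := inferInstance

instance : (qcoh X).ContainsZero where
  exists_zero := ⟨⊤_ _, (isZero_zero X.Modules).of_iso (terminalIsoIsTerminal HasZeroObject.zeroIsTerminal), (qcoh X).prop_terminal⟩

/-- The category of quasi-coherent modules on a scheme. -/
abbrev QCoh (X : Scheme.{u}) : Type (u + 1) := (qcoh X).FullSubcategory

end

section
variable {X Y : Scheme.{u}}

/-- Restriction of sections of a module. -/
noncomputable def res (M : X.Modules) {U V : X.Opens} (h : V ≤ U) : Γ(M, U) →+ Γ(M, V) :=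
  (M.presheaf.map (homOfLE h).op).hom

/-- Restriction of functions. -/
noncomputable def ores {U V : X.Opens} (h : V ≤ U) : Γ(X, U) →+* Γ(X, V) :=
  (X.presheaf.map (homOfLE h).op).hom

theorem res_res (M : X.Modules) {U V W : X.Opens} (h : V ≤ U) (h' : W ≤ V) (x : Γ(M, U)) :
    res M h' (res M h x) = res M (h'.trans h) x :=
  (ConcreteCategory.congr_hom (M.presheaf.map_comp (homOfLE h).op (homOfLE h').op) x).symm

theorem res_smul (M : X.Modules) {U V : X.Opens} (h : V ≤ U) (r : Γ(X, U)) (x : Γ(M, U)) :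
    res M h (r • x) = ores h r • res M h x :=
  M.val.map_smul (homOfLE h).op r x

theorem basicOpen_ores {U V D : X.Opens} (h : V ≤ U) {r : Γ(X, U)} (hD : D = X.basicOpen r) :
    V ⊓ D = X.basicOpen (ores h r) :=
  hD ▸ (X.basicOpen_res r (homOfLE h).op).symm

theorem res_ext (M : X.Modules) {W U V : X.Opens} (hU : U ≤ W) (hV : V ≤ W) (h : W ≤ U ⊔ V)
    {x y : Γ(M, W)} (h₁ : res M hU x = res M hU y) (h₂ : res M hV x = res M hV y) : x = y :=
  TopCat.Sheaf.eq_of_locally_eq₂ ⟨M.presheaf, M.isSheaf⟩ (homOfLE hU) (homOfLE hV) h x y h₁ h₂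

theorem res_glue (M : X.Modules) {W U V : X.Opens} (hU : U ≤ W) (hV : V ≤ W) (h : W ≤ U ⊔ V)
    (x : Γ(M, U)) (y : Γ(M, V)) (hxy : res M (inf_le_left : U ⊓ V ≤ U) x = res M inf_le_right y) :
    ∃ z : Γ(M, W), res M hU z = x ∧ res M hV z = y := by
  let F : Bool → X.Opens := fun b => bif b then U else V
  let sf : ∀ b, Γ(M, F b) := fun b => match b with
    | true => x
    | false => y
  have hW (b) : F b ≤ W := match b with
    | true => hU
    | false => hV
  obtain ⟨z, hz, -⟩ := TopCat.Sheaf.existsUnique_gluing' ⟨M.presheaf, M.isSheaf⟩ F W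
    (fun b => homOfLE (hW b)) (h.trans (sup_le (le_iSup F true) (le_iSup F false))) sf (by
      rintro (_ | _) (_ | _)
      · rfl
      · change res M (inf_le_left : V ⊓ U ≤ V) y = res M inf_le_right x
        have := congrArg (res M (inf_comm V U).le) hxy
        rw [res_res, res_res] at this
        exact this.symm
      · exact hxy
      · rfl)
  exact ⟨z, hz true, hz false⟩

theorem res_bot (M : X.Modules) (x y : Γ(M, (⊥ : X.Opens))) : x = y :=
  TopCat.Sheaf.eq_of_locally_eq' ⟨M.presheaf, M.isSheaf⟩ (fun i : Empty => i.elim) ⊥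
    (fun i => i.elim) bot_le x y (fun i => i.elim)

theorem affine_loc_aux {A : CommRingCat.{u}} {M : X.Modules} (hM : qcoh X M) (j : Spec A ⟶ X)
    [IsOpenImmersion j] {r : Γ(X, j ''ᵁ ⊤)} {D : X.Opens} (hD : D = X.basicOpen r)
    (hDU : D ≤ j ''ᵁ ⊤) :
    (∀ x : Γ(M, j ''ᵁ ⊤), res M hDU x = 0 → ∃ n : ℕ, r ^ n • x = 0) ∧
    (∀ x : Γ(M, D), ∃ (n : ℕ) (y : Γ(M, j ''ᵁ ⊤)), ores hDU r ^ n • x = res M hDU y) := by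
  obtain ⟨a, ha⟩ : ∃ a : A, r = (j.appIso ⊤).inv ((Scheme.ΓSpecIso A).inv a) :=
    ⟨(Scheme.ΓSpecIso A).hom ((j.appIso ⊤).hom r), by simp⟩
  have hD' : D = j ''ᵁ (PrimeSpectrum.basicOpen a : (Spec A).Opens) := by
    rw [hD, ha, ← Scheme.image_basicOpen, ← basicOpen_eq_of_affine]
  subst hD'
  have key := (qcoh_Spec_iff _).1 (qcoh_restrict j hM) a
  let N : (Spec A).Modules := (Scheme.Modules.restrictFunctor j).obj M
  have smul_N (V : (Spec A).Opens) (b : A) (x : Γ(N, V)) :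
      HSMul.hSMul (β := Γ(N, V)) b x = HSMul.hSMul (β := Γ(M, j ''ᵁ V)) (ores (j.image_mono (le_top : V ≤ ⊤))
        ((j.appIso ⊤).inv ((Scheme.ΓSpecIso A).inv b))) x := by
    have e := ConcreteCategory.congr_hom (j.appIso_inv_naturality V.leTop.op)
      ((Scheme.ΓSpecIso A).inv b)
    exact congrArg (fun t => HSMul.hSMul (β := Γ(M, j ''ᵁ V)) t x) e
  constructor
  · intro x hx
    obtain ⟨⟨_, n, rfl⟩, hn⟩ := (key.eq_zero_iff _ _).1 (show _ from hx)
    refine ⟨n, Eq.trans ?_ hn⟩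
    refine Eq.trans ?_ (smul_N ⊤ (a ^ n) x).symm
    have : ores (j.image_mono (le_top : (⊤ : (Spec A).Opens) ≤ ⊤)) = RingHom.id _ := by
      ext x
      exact ConcreteCategory.congr_hom (X.presheaf.map_id _) x
    rw [this, ha, map_pow, map_pow]
    rfl
  · intro x
    obtain ⟨⟨y, ⟨_, n, rfl⟩⟩, h⟩ := key.surj x
    refine ⟨n, y, Eq.trans ?_ h⟩
    refine Eq.trans ?_ (smul_N _ (a ^ n) x).symm
    rw [ha, map_pow, map_pow, map_pow]
    rfl

theorem affine_loc {M : X.Modules} (hM : qcoh X M) {U : X.Opens} (hU : IsAffineOpen U)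
    {r : Γ(X, U)} {D : X.Opens} (hD : D = X.basicOpen r) (hDU : D ≤ U) :
    (∀ x : Γ(M, U), res M hDU x = 0 → ∃ n : ℕ, r ^ n • x = 0) ∧
    (∀ x : Γ(M, D), ∃ (n : ℕ) (y : Γ(M, U)), ores hDU r ^ n • x = res M hDU y) := by
  obtain ⟨A, j, hj, rfl⟩ : ∃ (A : CommRingCat.{u}) (j : Spec A ⟶ X) (_ : IsOpenImmersion j),
      U = j ''ᵁ ⊤ := ⟨_, hU.fromSpec, inferInstance, by
        rw [Scheme.Hom.image_top_eq_opensRange, hU.opensRange_fromSpec]⟩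
  exact affine_loc_aux hM j hD hDU

theorem qc_inj {M : X.Modules} (hM : qcoh X M) {U : X.Opens} (hU : IsCompact (U : Set X)) :
    ∀ (r : Γ(X, U)) (D : X.Opens) (_ : D = X.basicOpen r) (hDU : D ≤ U) (x : Γ(M, U))
    (_ : res M hDU x = 0), ∃ n : ℕ, r ^ n • x = 0 := by
  refine compact_open_induction_on U hU ?_ ?_
  · intro r D _ _ x _
    exact ⟨0, res_bot _ _ _⟩
  · intro S hS V ih r D hD hDU x hx
    obtain ⟨n, hn⟩ := ih _ _ (basicOpen_ores le_sup_left hD) inf_le_left (res M le_sup_left x) (by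
      rw [res_res, ← res_res M hDU inf_le_right, hx, map_zero])
    obtain ⟨m, hm⟩ := (affine_loc hM V.2 (basicOpen_ores le_sup_right hD) inf_le_left).1
      (res M le_sup_right x) (by rw [res_res, ← res_res M hDU inf_le_right, hx, map_zero])
    refine ⟨n + m, res_ext M le_sup_left le_sup_right le_rfl ?_ ?_⟩
    · rw [pow_add, mul_comm, mul_smul, res_smul, res_smul, map_pow _ _ n, hn, smul_zero, map_zero]
    · rw [pow_add, mul_smul, res_smul, res_smul, map_pow _ _ m, hm, smul_zero, map_zero]

theorem ores_ores {U V W : X.Opens} (h : V ≤ U) (h' : W ≤ V) (x : Γ(X, U)) :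
    ores h' (ores h x) = ores (h'.trans h) x :=
  (ConcreteCategory.congr_hom (X.presheaf.map_comp (homOfLE h).op (homOfLE h').op) x).symm

theorem qcqs_surj {M : X.Modules} (hM : qcoh X M) {U : X.Opens} (hU : IsCompact (U : Set X)) :
    ∀ (_ : IsQuasiSeparated (U : Set X)) {r : Γ(X, U)} {D : X.Opens} (_ : D = X.basicOpen r)
    (hDU : D ≤ U) (x : Γ(M, D)), ∃ (n : ℕ) (y : Γ(M, U)), ores hDU r ^ n • x = res M hDU y := by
  refine compact_open_induction_on U hU ?_ ?_
  · intro _ r D hD hDU x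
    obtain rfl := le_bot_iff.1 hDU
    exact ⟨0, x, res_bot _ _ _⟩
  · intro S hS V ih hSV r D hD hDU x
    obtain ⟨n, y, hy⟩ := ih (hSV.of_subset (le_sup_left (a := S) (b := V.1)))
      (basicOpen_ores le_sup_left hD) inf_le_left (res M inf_le_right x)
    obtain ⟨m, z, hz⟩ := (affine_loc hM V.2 (basicOpen_ores le_sup_right hD) inf_le_left).2
      (res M inf_le_right x)
    have hc : IsCompact ((S ⊓ V.1 : X.Opens) : Set X) :=
      hSV _ _ (le_sup_left (a := S) (b := V.1)) S.2 hS (le_sup_right (a := S) (b := V.1)) V.1.2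
        V.2.isCompact
    rw [ores_ores, ← ores_ores hDU inf_le_right, ← map_pow, ← res_smul] at hy hz
    obtain ⟨k, hk⟩ := qc_inj hM hc
      (ores (inf_le_left.trans le_sup_left : S ⊓ V.1 ≤ S ⊔ V.1) r) _
      (basicOpen_ores _ hD) inf_le_left
      (res M inf_le_left (ores le_sup_left r ^ m • y) -
        res M inf_le_right (ores le_sup_right r ^ n • z)) (by
      have h1 : S ⊓ V.1 ⊓ D ≤ S ⊓ D := inf_le_inf_right _ inf_le_left
      have h2 : S ⊓ V.1 ⊓ D ≤ V.1 ⊓ D := inf_le_inf_right _ inf_le_right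
      have hy' := congrArg (res M h1) hy
      have hz' := congrArg (res M h2) hz
      simp only [res_res, res_smul, ores_ores, map_pow, map_sub] at hy' hz' ⊢
      rw [← hy', ← hz', ← mul_smul, ← mul_smul, ← pow_add, ← pow_add, add_comm, sub_self])
    obtain ⟨w, hw1, hw2⟩ := res_glue M (le_sup_left (a := S) (b := V.1)) le_sup_right le_rfl
      (ores le_sup_left r ^ (k + m) • y) (ores le_sup_right r ^ (k + n) • z) (by
        simp only [smul_sub, sub_eq_zero] at hk
        simp only [res_smul, map_pow, ores_ores, pow_add, mul_smul] at hk ⊢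
        exact hk)
    refine ⟨k + m + n, w, res_ext M (inf_le_right : S ⊓ D ≤ D) (inf_le_right : V.1 ⊓ D ≤ D)
      (inf_sup_right S V.1 D ▸ le_inf hDU le_rfl) ?_ ?_⟩
    · have := congrArg (fun t => ores (inf_le_left : S ⊓ D ≤ S) (ores le_sup_left r) ^ (k + m) • t) hy
      have hw := congrArg (res M (inf_le_left : S ⊓ D ≤ S)) hw1
      simp only [res_smul, map_pow, ores_ores, res_res] at this hw ⊢
      rw [hw, ← this, ← mul_smul, ← pow_add]
    · have := congrArg (fun t => ores (inf_le_left : V.1 ⊓ D ≤ V.1) (ores le_sup_right r) ^ (k + n) • t) hz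
      have hw := congrArg (res M (inf_le_left : V.1 ⊓ D ≤ V.1)) hw2
      simp only [res_smul, map_pow, ores_ores, res_res] at this hw ⊢
      rw [hw, ← this, ← mul_smul, ← pow_add, add_right_comm]

end

section
variable {X Y : Scheme.{u}}

theorem qcoh_restrict_pushforward (f : X ⟶ Y) [QuasiCompact f] [QuasiSeparated f] {M : X.Modules}
    (hM : qcoh X M) {A : CommRingCat.{u}} (j : Spec A ⟶ Y) [IsOpenImmersion j] :
    qcoh (Spec A) ((Scheme.Modules.restrictFunctor j).obj
      ((Scheme.Modules.pushforward f).obj M)) := by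
  rw [qcoh_Spec_iff]
  intro a
  let N : (Spec A).Modules := (Scheme.Modules.restrictFunctor j).obj
      ((Scheme.Modules.pushforward f).obj M)
  let U : X.Opens := f ⁻¹ᵁ (j ''ᵁ ⊤)
  let D : X.Opens := f ⁻¹ᵁ (j ''ᵁ (PrimeSpectrum.basicOpen a : (Spec A).Opens))
  let r : Γ(X, U) := f.app _ ((j.appIso ⊤).inv ((Scheme.ΓSpecIso A).inv a))
  have hD : D = X.basicOpen r := by
    rw [← Scheme.preimage_basicOpen, ← Scheme.image_basicOpen]
    exact congrArg (fun V : (Spec A).Opens => f ⁻¹ᵁ (j ''ᵁ V)) (basicOpen_eq_of_affine a).symm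
  have hDU : D ≤ U := f.preimage_mono (j.image_mono le_top)
  have hj : IsAffineOpen (j ''ᵁ ⊤) := (isAffineOpen_top (Spec A)).image_of_isOpenImmersion j
  have hU : IsCompact (U : Set X) := f.isCompact_preimage hj.isCompact
  have hU' : IsQuasiSeparated (U : Set X) := f.isQuasiSeparated_preimage hj.isQuasiSeparated
  have smul_N (V : (Spec A).Opens) (b : A) (x : Γ(N, V)) :
      HSMul.hSMul (β := Γ(N, V)) b x = HSMul.hSMul (β := Γ(M, f ⁻¹ᵁ (j ''ᵁ V)))
        (ores (f.preimage_mono (j.image_mono (le_top : V ≤ ⊤)))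
        (f.app _ ((j.appIso ⊤).inv ((Scheme.ΓSpecIso A).inv b)))) x := by
    have e := ConcreteCategory.congr_hom (j.appIso_inv_naturality V.leTop.op)
      ((Scheme.ΓSpecIso A).inv b)
    have e' := ConcreteCategory.congr_hom (f.naturality (homOfLE (j.image_mono (le_top : V ≤ ⊤))).op)
      ((j.appIso ⊤).inv ((Scheme.ΓSpecIso A).inv b))
    exact congrArg (fun t => HSMul.hSMul (β := Γ(M, f ⁻¹ᵁ (j ''ᵁ V))) t x)
      ((congrArg (f.app (j ''ᵁ V)) e).trans e')
  refine IsLocalizedModule.Away.mk_of_addCommGroup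
    (Scheme.Modules.isUnit_algebraMap_end_of_le_basicOpen (M := N) a le_rfl) ?_ ?_
  · intro x
    obtain ⟨n, y, hy⟩ := qcqs_surj hM hU hU' hD hDU x
    refine ⟨n, y, Eq.trans ?_ hy⟩
    refine (smul_N _ (a ^ n) x).trans ?_
    rw [map_pow, map_pow, map_pow, map_pow]
  · intro x hx
    obtain ⟨n, hn⟩ := qc_inj hM hU r D hD hDU x hx
    refine ⟨n, Eq.trans ?_ hn⟩
    refine (smul_N ⊤ (a ^ n) x).trans ?_
    have : ores (f.preimage_mono (j.image_mono (le_top : (⊤ : (Spec A).Opens) ≤ ⊤))) =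
        RingHom.id _ := by
      ext x
      exact ConcreteCategory.congr_hom (X.presheaf.map_id _) x
    rw [this, map_pow, map_pow, map_pow]
    rfl

theorem qcoh_pushforward (f : X ⟶ Y) [QuasiCompact f] [QuasiSeparated f] {M : X.Modules}
    (hM : qcoh X M) : qcoh Y ((Scheme.Modules.pushforward f).obj M) :=
  qcoh_of_openCover Y.affineOpenCover fun _ => qcoh_restrict_pushforward f hM _

end

section
variable {X Y : Scheme.{u}}

/-- Sections of a pushforward between affine schemes: restriction of scalars. -/
noncomputable def pushforwardΓIso {R B : CommRingCat.{u}} (φ : R ⟶ B) :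
    Scheme.Modules.pushforward (Spec.map φ) ⋙ moduleSpecΓFunctor (R := R) ≅
      moduleSpecΓFunctor (R := B) ⋙ ModuleCat.restrictScalars φ.hom :=
  Functor.isoWhiskerRight (pushforwardCompModulesSpecToSheafIso φ)
    (TopCat.Sheaf.forget _ _ ⋙ (evaluation _ _).obj (.op ⊤))

/-- The pullback of the sheaf of a module between affine schemes: extension of scalars. -/
noncomputable def tildePullbackIso {R B : CommRingCat.{u}} (φ : R ⟶ B) :
    tilde.functor R ⋙ Scheme.Modules.pullback (Spec.map φ) ≅
      ModuleCat.extendScalars φ.hom ⋙ tilde.functor B :=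
  (conjugateIsoEquiv (tilde.adjunction.comp
    (Scheme.Modules.pullbackPushforwardAdjunction (Spec.map φ)))
    ((ModuleCat.extendRestrictScalarsAdj φ.hom).comp tilde.adjunction)).symm
    (pushforwardΓIso φ) |>.symm

theorem qcoh_pullback_Spec {R B : CommRingCat.{u}} (φ : R ⟶ B) {M : (Spec R).Modules}
    (hM : qcoh _ M) : qcoh _ ((Scheme.Modules.pullback (Spec.map φ)).obj M) := by
  obtain ⟨M', ⟨e⟩⟩ := (qcoh_Spec_iff_essImage M).1 hM
  exact (qcoh_Spec_iff_essImage _).2 ⟨_, ⟨((tildePullbackIso φ).app M').symm ≪≫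
    (Scheme.Modules.pullback (Spec.map φ)).mapIso e⟩⟩

theorem exists_affine_factor (f : X ⟶ Y) : ∃ 𝒰 : Scheme.AffineOpenCover.{u} X, ∀ i,
    ∃ (A : CommRingCat.{u}) (k : Spec A ⟶ Y) (_ : IsOpenImmersion k) (φ : A ⟶ 𝒰.X i),
      𝒰.f i ≫ f = Spec.map φ ≫ k ∧ (Flat f → φ.hom.Flat) := by
  let 𝒱 : X.OpenCover := Y.affineOpenCover.openCover.pullback₁ f
  have key (a : Y.affineOpenCover.I₀) (b : (pullback f (Y.affineOpenCover.f a)).affineCover.I₀)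
      (ψ : (pullback f (Y.affineOpenCover.f a)).affineCover.X b ⟶ Spec (Y.affineOpenCover.X a))
      (hψ : ψ = (pullback f (Y.affineOpenCover.f a)).affineCover.f b ≫
        pullback.snd f (Y.affineOpenCover.f a)) :
      (((pullback f (Y.affineOpenCover.f a)).affineCover.f b ≫ pullback.fst _ _) ≫ f =
        ψ ≫ Y.affineOpenCover.f a) ∧ (Flat f → Flat ψ) := by
    have : IsOpenImmersion ((pullback f (Y.affineOpenCover.f a)).affineCover.f b) :=
      (pullback f (Y.affineOpenCover.f a)).affineCover.map_prop b
    subst hψ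
    exact ⟨by rw [Category.assoc, Category.assoc, pullback.condition], fun _ => inferInstance⟩
  refine ⟨Scheme.OpenCover.affineRefinement 𝒱, fun ⟨a, b⟩ => ?_⟩
  let ψ := (pullback f (Y.affineOpenCover.f a)).affineCover.f b ≫
    pullback.snd f (Y.affineOpenCover.f a)
  obtain ⟨φ, hφ⟩ := Spec.map_surjective ψ
  obtain ⟨h1, h2⟩ := key a b (Spec.map φ) hφ
  exact ⟨_, Y.affineOpenCover.f a, Y.affineOpenCover.map_prop a, φ, h1,
    fun hf => Flat.SpecMap_iff.1 (h2 hf)⟩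

/-- Compatibility of pullback with restriction to affine open subschemes. -/
noncomputable def pullbackRestrictIso (f : X ⟶ Y) {A B : CommRingCat.{u}} (j : Spec B ⟶ X)
    (k : Spec A ⟶ Y) [IsOpenImmersion j] [IsOpenImmersion k] (φ : A ⟶ B)
    (h : j ≫ f = Spec.map φ ≫ k) :
    Scheme.Modules.pullback f ⋙ Scheme.Modules.restrictFunctor j ≅
      Scheme.Modules.restrictFunctor k ⋙ Scheme.Modules.pullback (Spec.map φ) :=
  Functor.isoWhiskerLeft _ (Scheme.Modules.restrictFunctorIsoPullback j) ≪≫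
    Scheme.Modules.pullbackComp j f ≪≫ Scheme.Modules.pullbackCongr h ≪≫
    (Scheme.Modules.pullbackComp _ k).symm ≪≫
    Functor.isoWhiskerRight (Scheme.Modules.restrictFunctorIsoPullback k).symm _

theorem qcoh_pullback (f : X ⟶ Y) {M : Y.Modules} (hM : qcoh Y M) :
    qcoh X ((Scheme.Modules.pullback f).obj M) := by
  obtain ⟨𝒰, h𝒰⟩ := exists_affine_factor f
  refine qcoh_of_openCover 𝒰 fun i => ?_
  obtain ⟨A, k, hk, φ, h, -⟩ := h𝒰 i
  exact (qcoh _).prop_of_iso ((pullbackRestrictIso f _ k φ h).app M).symm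
    (qcoh_pullback_Spec φ (qcoh_restrict k hM))

theorem mono_of_natIso {C D : Type*} [Category* C] [Category* D] {F G : C ⥤ D} (e : F ≅ G)
    {M N : C} (u : M ⟶ N) (h : Mono (G.map u)) : Mono (F.map u) := by
  have h' : F.map u = e.hom.app M ≫ G.map u ≫ e.inv.app N := by simp
  rw [h']
  exact mono_comp _ _

theorem mono_of_restrict (𝒰 : Scheme.AffineOpenCover.{u} X) {M N : X.Modules} (u : M ⟶ N)
    (h : ∀ i, Mono ((Scheme.Modules.restrictFunctor (𝒰.f i)).map u)) : Mono u := by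
  have h0 (i) : (Scheme.Modules.restrictFunctor (𝒰.f i)).map (kernel.ι u) = 0 := by
    have := h i
    rw [← cancel_mono ((Scheme.Modules.restrictFunctor (𝒰.f i)).map u), zero_comp,
      ← Functor.map_comp, kernel.condition, Functor.map_zero]
  refine Preadditive.mono_of_kernel_zero (Scheme.Modules.hom_ext _ _ fun U => ?_)
  ext x
  refine TopCat.Sheaf.eq_of_locally_eq' ⟨M.presheaf, M.isSheaf⟩
    (fun i => 𝒰.f i ''ᵁ (𝒰.f i ⁻¹ᵁ U)) U (fun i => homOfLE ((𝒰.f i).image_preimage_le U))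
    (fun y hy => ?_) _ _ fun i => ?_
  · obtain ⟨z, hz⟩ := 𝒰.covers y
    exact Opens.mem_iSup.2 ⟨_, z, show (𝒰.f _) z ∈ U from hz.symm ▸ hy, hz⟩
  · have e1 := ConcreteCategory.congr_hom ((kernel.ι u).mapPresheaf.naturality
      (homOfLE ((𝒰.f i).image_preimage_le U)).op) x
    have e2 := congrArg (fun φ => Scheme.Modules.Hom.app φ (𝒰.f i ⁻¹ᵁ U)
      ((kernel u).presheaf.map (homOfLE ((𝒰.f i).image_preimage_le U)).op x)) (h0 i)
    exact e1.symm.trans (e2.trans (map_zero (M.presheaf.map _).hom).symm)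

theorem mono_tilde {R : CommRingCat.{u}} {M N : ModuleCat.{u} R} (g : M ⟶ N) [Mono g] :
    Mono ((tilde.functor R).map g) := by
  refine Preadditive.mono_of_kernel_zero ?_
  have hq (M : ModuleCat.{u} R) : qcoh _ ((tilde.functor R).obj M) :=
    (qcoh_Spec_iff_essImage _).2 ⟨M, ⟨Iso.refl _⟩⟩
  obtain ⟨K, ⟨e⟩⟩ := (qcoh_Spec_iff_essImage _).1
    (qcoh_Spec_kernel ((tilde.functor R).map g) (hq _) (hq _))
  have hk : (tilde.functor R).preimage (e.hom ≫ kernel.ι _) = 0 := by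
    rw [← cancel_mono g, zero_comp]
    apply (tilde.functor R).map_injective
    rw [Functor.map_comp, (tilde.functor R).map_preimage, Category.assoc, kernel.condition,
      comp_zero, Functor.map_zero]
  have hk' := congrArg (tilde.functor R).map hk
  rw [(tilde.functor R).map_preimage, Functor.map_zero] at hk'
  rw [← cancel_epi e.hom, hk', comp_zero]

theorem mono_pullback_Spec {R B : CommRingCat.{u}} (φ : R ⟶ B) (hφ : φ.hom.Flat)
    {M N : (Spec R).Modules} (hM : qcoh _ M) (hN : qcoh _ N) (u : M ⟶ N) [Mono u] :
    Mono ((Scheme.Modules.pullback (Spec.map φ)).map u) := by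
  obtain ⟨M', ⟨eM⟩⟩ := (qcoh_Spec_iff_essImage M).1 hM
  obtain ⟨N', ⟨eN⟩⟩ := (qcoh_Spec_iff_essImage N).1 hN
  let g := (tilde.functor R).preimage (eM.hom ≫ u ≫ eN.inv)
  have hg : (tilde.functor R).map g = eM.hom ≫ u ≫ eN.inv := (tilde.functor R).map_preimage _
  have : Mono ((tilde.functor R).map g) := by
    rw [hg]
    exact mono_comp _ _
  have : Mono g := (tilde.functor R).mono_of_mono_map this
  have := ModuleCat.preservesFiniteLimits_extendScalars_of_flat hφ
  have h1 : Mono ((tilde.functor R ⋙ Scheme.Modules.pullback (Spec.map φ)).map g) :=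
    mono_of_natIso (tildePullbackIso φ) g (mono_tilde ((ModuleCat.extendScalars φ.hom).map g))
  have h2 : Mono ((Scheme.Modules.pullback (Spec.map φ)).map ((tilde.functor R).map g)) := h1
  have e : u = eM.inv ≫ (tilde.functor R).map g ≫ eN.hom := by
    rw [hg, Category.assoc, Category.assoc, eN.inv_hom_id, Category.comp_id, eM.inv_hom_id_assoc]
  rw [e, Functor.map_comp, Functor.map_comp]
  have : IsIso ((Scheme.Modules.pullback (Spec.map φ)).map eM.inv) := inferInstance
  exact mono_comp' inferInstance (mono_comp' h2 inferInstance)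

theorem mono_pullback (f : X ⟶ Y) [hf : Flat f] {M N : Y.Modules} (hM : qcoh _ M) (hN : qcoh _ N)
    (u : M ⟶ N) [Mono u] : Mono ((Scheme.Modules.pullback f).map u) := by
  obtain ⟨𝒰, h𝒰⟩ := exists_affine_factor f
  refine mono_of_restrict 𝒰 _ fun i => ?_
  obtain ⟨A, k, hk, φ, h, hφ⟩ := h𝒰 i
  have := mono_pullback_Spec φ (hφ hf) (qcoh_restrict k hM) (qcoh_restrict k hN)
    ((Scheme.Modules.restrictFunctor k).map u)
  exact mono_of_natIso (pullbackRestrictIso f _ k φ h) u this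

end

section
variable {X Y : Scheme.{u}}

namespace QCoh

/-- The direct image of quasi-coherent modules along a quasi-compact quasi-separated morphism. -/
noncomputable def pushforward (f : X ⟶ Y) [QuasiCompact f] [QuasiSeparated f] : QCoh X ⥤ QCoh Y :=
  (qcoh Y).lift ((qcoh X).ι ⋙ Scheme.Modules.pushforward f) fun M => qcoh_pushforward f M.property

/-- The inverse image of quasi-coherent modules. -/
noncomputable def pullback (f : X ⟶ Y) : QCoh Y ⥤ QCoh X :=
  (qcoh X).lift ((qcoh Y).ι ⋙ Scheme.Modules.pullback f) fun M => qcoh_pullback f M.property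

/-- The inverse image is left adjoint to the direct image. -/
noncomputable def adjunction (f : X ⟶ Y) [QuasiCompact f] [QuasiSeparated f] :
    pullback f ⊣ pushforward f :=
  (Scheme.Modules.pullbackPushforwardAdjunction f).restrictFullyFaithful
    (qcoh Y).fullyFaithfulι (qcoh X).fullyFaithfulι (Iso.refl _) (Iso.refl _)

instance (f : X ⟶ Y) [QuasiCompact f] [QuasiSeparated f] : (pushforward f).Additive where
  map_add {_ _ a b} := (qcoh Y).hom_ext ((Scheme.Modules.pushforward f).map_add (f := a.hom) (g := b.hom))

instance (f : X ⟶ Y) : (pullback f).Additive where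
  map_add {_ _ a b} := (qcoh X).hom_ext ((Scheme.Modules.pullback f).map_add (f := a.hom) (g := b.hom))

/-- If `f ≫ g = h ≫ k` then `g_* f_* ≅ k_* h_*`. -/
noncomputable def pushforwardSq {Z W : Scheme.{u}} {f : X ⟶ Y} {g : Y ⟶ Z} {h : X ⟶ W} {k : W ⟶ Z}
    [QuasiCompact f] [QuasiSeparated f] [QuasiCompact g] [QuasiSeparated g]
    [QuasiCompact h] [QuasiSeparated h] [QuasiCompact k] [QuasiSeparated k] (e : f ≫ g = h ≫ k) :
    pushforward f ⋙ pushforward g ≅ pushforward h ⋙ pushforward k :=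
  ((qcoh Z).fullyFaithfulι.whiskeringRight _).preimageIso
    (Functor.isoWhiskerLeft (qcoh X).ι (Scheme.Modules.pushforwardComp f g ≪≫
      Scheme.Modules.pushforwardCongr e ≪≫ (Scheme.Modules.pushforwardComp h k).symm))

theorem pullback_preservesMono (f : X ⟶ Y) [Flat f] : (pullback f).PreservesMonomorphisms where
  preserves {M N} u hu := by
    have := (qcoh Y).preservesMonomorphisms_ι_of_isNormalEpiCategory
    have h : Mono u.hom := inferInstanceAs (Mono ((qcoh Y).ι.map u))
    have := mono_pullback f M.property N.property u.hom
    exact (qcoh X).ι.mono_of_mono_map this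

end QCoh

end

namespace Coalg
open Endofunctor

section Abelian
variable {A : Type*} [Category* A] [Abelian A] {F : A ⥤ A} [F.Additive]

theorem zero_f (M N : Coalgebra F) : (0 : M ⟶ N).f = 0 := rfl

instance : (Coalgebra.forget F).PreservesZeroMorphisms := ⟨fun _ _ => rfl⟩

instance : HasZeroObject (Coalgebra F) :=
  ⟨⟨HasZeroObject.zero' A |>.zero, 0⟩, (IsZero.iff_id_eq_zero _).2 (Coalgebra.ext ((isZero_zero A).eq_of_src _ _))⟩

/-- The structure map of the cokernel of a morphism of coalgebras. -/
noncomputable def cokerStr {M N : Coalgebra F} (f : M ⟶ N) :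
    cokernel f.f ⟶ F.obj (cokernel f.f) :=
  cokernel.desc f.f (N.str ≫ F.map (cokernel.π f.f)) (by
    rw [← Coalgebra.Hom.h_assoc, ← F.map_comp, cokernel.condition, F.map_zero, comp_zero])

theorem π_cokerStr {M N : Coalgebra F} (f : M ⟶ N) :
    cokernel.π f.f ≫ cokerStr f = N.str ≫ F.map (cokernel.π f.f) := cokernel.π_desc _ _ _

theorem cokerStr_desc {M N W : Coalgebra F} (f : M ⟶ N) (g : N ⟶ W) (k : cokernel f.f ⟶ W.V)
    (hk : cokernel.π f.f ≫ k = g.f) : cokerStr f ≫ F.map k = k ≫ W.str := by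
  rw [← cancel_epi (cokernel.π f.f), reassoc_of% π_cokerStr f, ← F.map_comp, hk, g.h,
    reassoc_of% hk]

/-- The cokernel of a morphism of coalgebras. -/
noncomputable def coker {M N : Coalgebra F} (f : M ⟶ N) : Coalgebra F where
  V := cokernel f.f
  str := cokerStr f

/-- The projection to the cokernel. -/
noncomputable def cokerπ {M N : Coalgebra F} (f : M ⟶ N) : N ⟶ coker f where
  f := cokernel.π f.f
  h := (π_cokerStr f).symm

theorem coker_condition {M N : Coalgebra F} (f : M ⟶ N) : f ≫ cokerπ f = 0 :=
  Coalgebra.ext (cokernel.condition f.f)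

/-- The cokernel of underlying objects is a cokernel of coalgebras. -/
noncomputable def cokerIsColimit {M N : Coalgebra F} (f : M ⟶ N) :
    IsColimit (CokernelCofork.ofπ (cokerπ f) (coker_condition f)) :=
  CokernelCofork.IsColimit.ofπ _ _
    (fun {_} g w => {
      f := cokernel.desc f.f g.f (congrArg Coalgebra.Hom.f w)
      h := cokerStr_desc f g _ (cokernel.π_desc _ _ _) })
    (fun {_} _ _ => Coalgebra.ext (cokernel.π_desc _ _ _))
    (fun {_} _ _ _ hm => Coalgebra.ext ((cancel_epi (cokernel.π f.f)).1
      ((congrArg Coalgebra.Hom.f hm).trans (cokernel.π_desc _ _ _).symm)))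

instance : HasCokernels (Coalgebra F) := ⟨fun f => ⟨⟨⟨_, cokerIsColimit f⟩⟩⟩⟩

theorem epi_f {M N : Coalgebra F} (f : M ⟶ N) [Epi f] : Epi f.f := by
  refine Preadditive.epi_of_cokernel_zero ?_
  have : cokerπ f = 0 := by rw [← cancel_epi f, coker_condition, comp_zero]
  exact congrArg Coalgebra.Hom.f this

instance : HasBinaryBiproducts (Coalgebra F) where
  has_binary_biproduct M N := by
    let P : Coalgebra F :=
      { V := M.V ⊞ N.V
        str := biprod.desc (M.str ≫ F.map biprod.inl) (N.str ≫ F.map biprod.inr) }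
    let b : BinaryBicone M N :=
      { pt := P
        fst :=
          { f := biprod.fst
            h := by
              apply biprod.hom_ext' <;> simp [P, ← F.map_comp] }
        snd :=
          { f := biprod.snd
            h := by
              apply biprod.hom_ext' <;> simp [P, ← F.map_comp] }
        inl :=
          { f := biprod.inl
            h := by simp [P] }
        inr :=
          { f := biprod.inr
            h := by simp [P] }
        inl_fst := Coalgebra.ext biprod.inl_fst
        inl_snd := Coalgebra.ext biprod.inl_snd
        inr_fst := Coalgebra.ext biprod.inr_fst
        inr_snd := Coalgebra.ext biprod.inr_snd }
    exact ⟨⟨⟨b, isBinaryBilimitOfTotal b (Coalgebra.ext biprod.total)⟩⟩⟩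

instance : HasFiniteProducts (Coalgebra F) := by
  have : HasTerminal (Coalgebra F) := inferInstance
  have : HasBinaryProducts (Coalgebra F) := inferInstance
  exact hasFiniteProducts_of_has_binary_and_terminal

variable [PreservesFiniteLimits F]

/-- The structure map of the kernel of a morphism of coalgebras. -/
noncomputable def kerStr {M N : Coalgebra F} (f : M ⟶ N) : kernel f.f ⟶ F.obj (kernel f.f) :=
  kernel.lift (F.map f.f) (kernel.ι f.f ≫ M.str) (by
    rw [Category.assoc, Coalgebra.Hom.h, kernel.condition_assoc, zero_comp]) ≫
      (PreservesKernel.iso F f.f).inv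

theorem kerStr_ι {M N : Coalgebra F} (f : M ⟶ N) :
    kerStr f ≫ F.map (kernel.ι f.f) = kernel.ι f.f ≫ M.str := by
  rw [kerStr, Category.assoc, PreservesKernel.iso_inv_ι, kernel.lift_ι]

theorem lift_kerStr {M N W : Coalgebra F} (f : M ⟶ N) (g : W ⟶ M) (k : W.V ⟶ kernel f.f)
    (hk : k ≫ kernel.ι f.f = g.f) : W.str ≫ F.map k = k ≫ kerStr f := by
  rw [← cancel_mono (F.map (kernel.ι f.f)), Category.assoc, Category.assoc, kerStr_ι,
    ← F.map_comp, hk, g.h, reassoc_of% hk]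

/-- The kernel of a morphism of coalgebras. -/
noncomputable def ker {M N : Coalgebra F} (f : M ⟶ N) : Coalgebra F where
  V := kernel f.f
  str := kerStr f

/-- The inclusion of the kernel. -/
noncomputable def kerι {M N : Coalgebra F} (f : M ⟶ N) : ker f ⟶ M where
  f := kernel.ι f.f
  h := kerStr_ι f

theorem ker_condition {M N : Coalgebra F} (f : M ⟶ N) : kerι f ≫ f = 0 :=
  Coalgebra.ext (kernel.condition f.f)

/-- The kernel of underlying objects is a kernel of coalgebras. -/
noncomputable def kerIsLimit {M N : Coalgebra F} (f : M ⟶ N) :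
    IsLimit (KernelFork.ofι (kerι f) (ker_condition f)) :=
  KernelFork.IsLimit.ofι _ _
    (fun {_} g w => {
      f := kernel.lift f.f g.f (congrArg Coalgebra.Hom.f w)
      h := lift_kerStr f g _ (kernel.lift_ι _ _ _) })
    (fun {_} _ _ => Coalgebra.ext (kernel.lift_ι _ _ _))
    (fun {_} _ _ _ hm => Coalgebra.ext ((cancel_mono (kernel.ι f.f)).1
      ((congrArg Coalgebra.Hom.f hm).trans (kernel.lift_ι _ _ _).symm)))

instance : HasKernels (Coalgebra F) := ⟨fun f => ⟨⟨⟨_, kerIsLimit f⟩⟩⟩⟩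

theorem mono_f {M N : Coalgebra F} (f : M ⟶ N) [Mono f] : Mono f.f := by
  refine Preadditive.mono_of_kernel_zero ?_
  have : kerι f = 0 := by rw [← cancel_mono f, ker_condition, zero_comp]
  exact congrArg Coalgebra.Hom.f this

instance : IsNormalMonoCategory (Coalgebra F) where
  normalMonoOfMono {M N} f hf := by
    have := mono_f f
    refine ⟨{ Z := coker f, g := cokerπ f, w := coker_condition f, isLimit := ?_ }⟩
    have w {W : Coalgebra F} (g : W ⟶ N) (hg : g ≫ cokerπ f = 0) : g.f ≫ cokernel.π f.f = 0 :=
      congrArg Coalgebra.Hom.f hg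
    exact KernelFork.IsLimit.ofι _ _
      (fun {W} g hg => {
        f := Abelian.monoLift f.f g.f (w g hg)
        h := by
          rw [← cancel_mono (F.map f.f), Category.assoc, ← F.map_comp, Abelian.monoLift_comp, g.h,
            Category.assoc, f.h, ← Category.assoc, Abelian.monoLift_comp] })
      (fun {_} g hg => Coalgebra.ext (Abelian.monoLift_comp _ _ _))
      (fun {_} g hg m hm => Coalgebra.ext ((cancel_mono f.f).1
        ((congrArg Coalgebra.Hom.f hm).trans (Abelian.monoLift_comp _ _ (w g hg)).symm)))

instance : IsNormalEpiCategory (Coalgebra F) where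
  normalEpiOfEpi {M N} f hf := by
    have := epi_f f
    refine ⟨{ W := ker f, g := kerι f, w := ker_condition f, isColimit := ?_ }⟩
    have w {W : Coalgebra F} (g : M ⟶ W) (hg : kerι f ≫ g = 0) : kernel.ι f.f ≫ g.f = 0 :=
      congrArg Coalgebra.Hom.f hg
    exact CokernelCofork.IsColimit.ofπ _ _
      (fun {W} g hg => {
        f := Abelian.epiDesc f.f g.f (w g hg)
        h := by
          rw [← cancel_epi f.f, ← f.h_assoc, ← F.map_comp, Abelian.comp_epiDesc, g.h,
            Abelian.comp_epiDesc_assoc] })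
      (fun {_} g hg => Coalgebra.ext (Abelian.comp_epiDesc _ _ _))
      (fun {_} g hg m hm => Coalgebra.ext ((cancel_epi f.f).1
        ((congrArg Coalgebra.Hom.f hm).trans (Abelian.comp_epiDesc _ _ (w g hg)).symm)))

/-- Coalgebras over a left exact additive endofunctor of an abelian category form an abelian
category. -/
noncomputable instance : Abelian (Coalgebra F) where

end Abelian

section Functors
variable {A B : Type*} [Category* A] [Category* B] {F : A ⥤ A} {F' : B ⥤ B}

/-- The functor between coalgebras `(M, τ) ↦ (G M, θ ∘ G τ)`. -/
@[simps]
def map (G : A ⥤ B) (θ : F ⋙ G ⟶ G ⋙ F') : Coalgebra F ⥤ Coalgebra F' where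
  obj M := { V := G.obj M.V, str := G.map M.str ≫ θ.app M.V }
  map f :=
    { f := G.map f.f
      h := by
        have := θ.naturality f.f
        dsimp at this ⊢
        rw [Category.assoc, ← this, ← G.map_comp_assoc, f.h, G.map_comp_assoc] }

instance map_additive [Preadditive A] [Preadditive B] [F.Additive] [F'.Additive] (G : A ⥤ B)
    [G.Additive] (θ : F ⋙ G ⟶ G ⋙ F') : (map G θ).Additive where
  map_add {_ _ f g} := Coalgebra.ext (G.map_add (f := f.f) (g := g.f))

/-- For `L ⊣ G`, the transformation `L F' ⟶ F L` corresponding to the inverse of `θ`. -/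
def mate {L : B ⥤ A} {G : A ⥤ B} (adj : L ⊣ G) (θ : F ⋙ G ≅ G ⋙ F') : F' ⋙ L ⟶ L ⋙ F :=
  (mateEquiv adj adj).symm (TwoSquare.mk _ _ _ _ θ.inv)

theorem unit_mate {L : B ⥤ A} {G : A ⥤ B} (adj : L ⊣ G) (θ : F ⋙ G ≅ G ⋙ F') (M : B)
    (s : M ⟶ F'.obj M) : s ≫ F'.map (adj.unit.app M) =
      adj.unit.app M ≫ G.map (L.map s ≫ (mate adj θ).app M) ≫ θ.hom.app (L.obj M) := by
  have h : F'.map (adj.unit.app M) ≫ θ.inv.app (L.obj M) =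
      adj.unit.app (F'.obj M) ≫ G.map ((mate adj θ).app M) :=
    unit_mateEquiv_symm adj adj (TwoSquare.mk _ _ _ _ θ.inv) M
  have h2 : s ≫ adj.unit.app (F'.obj M) = adj.unit.app M ≫ G.map (L.map s) :=
    adj.unit.naturality s
  have h3 : θ.inv.app (L.obj M) ≫ θ.hom.app (L.obj M) = 𝟙 (F'.obj (G.obj (L.obj M))) :=
    θ.inv_hom_id_app (L.obj M)
  rw [G.map_comp, Category.assoc, ← reassoc_of% h2, ← reassoc_of% h, h3]
  exact (congrArg (s ≫ ·) (Category.comp_id _)).symm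

theorem mate_counit {L : B ⥤ A} {G : A ⥤ B} (adj : L ⊣ G) (θ : F ⋙ G ≅ G ⋙ F') (M : A)
    (s : M ⟶ F.obj M) : (L.map (G.map s ≫ θ.hom.app M) ≫ (mate adj θ).app (G.obj M)) ≫
      F.map (adj.counit.app M) = adj.counit.app M ≫ s := by
  have h : L.map (θ.inv.app M) ≫ adj.counit.app (F.obj M) =
      (mate adj θ).app (G.obj M) ≫ F.map (adj.counit.app M) :=
    mateEquiv_counit_symm adj adj (TwoSquare.mk _ _ _ _ θ.inv) M
  have h2 : L.map (G.map s) ≫ adj.counit.app (F.obj M) = adj.counit.app M ≫ s :=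
    adj.counit.naturality s
  have h3 : θ.hom.app M ≫ θ.inv.app M = 𝟙 (G.obj (F.obj M)) := θ.hom_inv_id_app M
  have h4 : L.map (G.map s ≫ θ.hom.app M) ≫ L.map (θ.inv.app M) = L.map (G.map s) := by
    rw [← L.map_comp]
    exact congrArg L.map ((Category.assoc _ _ _).trans
      ((congrArg (G.map s ≫ ·) h3).trans (Category.comp_id _)))
  rw [Category.assoc, ← h, reassoc_of% h4, h2]

/-- If `L ⊣ G`, then the induced functors between coalgebras are adjoint. -/
def adjunction {L : B ⥤ A} {G : A ⥤ B} (adj : L ⊣ G) (θ : F ⋙ G ≅ G ⋙ F') :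
    map L (mate adj θ) ⊣ map G θ.hom :=
  Adjunction.mkOfUnitCounit
    { unit :=
        { app M := { f := adj.unit.app M.V, h := unit_mate adj θ M.V M.str }
          naturality _ _ f := Coalgebra.ext (adj.unit.naturality f.f) }
      counit :=
        { app M := { f := adj.counit.app M.V, h := mate_counit adj θ M.V M.str }
          naturality _ _ f := Coalgebra.ext (adj.counit.naturality f.f) }
      left_triangle := NatTrans.ext (funext fun M => Coalgebra.ext
        ((congrArg (L.map (adj.unit.app M.V) ≫ ·) (Category.id_comp _)).trans
          (adj.left_triangle_components M.V)))
      right_triangle := NatTrans.ext (funext fun M => Coalgebra.ext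
        ((congrArg (adj.unit.app (G.obj M.V) ≫ ·) (Category.id_comp _)).trans
          (adj.right_triangle_components M.V))) }

end Functors

end Coalg

/-- A scheme is geometric if it is quasi-compact and has affine diagonal. -/
class IsGeometric (X : Scheme.{u}) : Prop where
  compactSpace : CompactSpace X
  affine_diagonal : IsAffineHom (pullback.diagonal (terminal.from X))

/-- A scheme is an `𝔽_p`-scheme if it admits a (necessarily unique) morphism to `Spec 𝔽_p`. -/
class IsFpScheme (p : ℕ) (X : Scheme.{u}) : Prop where
  exists_hom : Nonempty (X ⟶ Spec (CommRingCat.of (ULift.{u} (ZMod p))))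

instance (X : Scheme.{u}) [h : IsGeometric X] : CompactSpace X := h.compactSpace

instance (X : Scheme.{u}) [h : IsGeometric X] : QuasiSeparatedSpace X := by
  have := h.affine_diagonal
  have : QuasiSeparated (terminal.from X) := ⟨inferInstance⟩
  exact (quasiSeparatedSpace_iff_quasiSeparated X).2 this

instance (R : CommRingCat.{u}) : IsGeometric (Spec R) where
  compactSpace := inferInstance
  affine_diagonal := by
    have : IsSeparated (terminal.from (Spec R)) := inferInstance
    infer_instance

theorem IsFpScheme.of_hom (p : ℕ) {X Y : Scheme.{u}} (f : X ⟶ Y) [h : IsFpScheme p Y] :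
    IsFpScheme p X := ⟨⟨f ≫ h.exists_hom.some⟩⟩

section Frobenius
variable (p : ℕ) [hp : Fact p.Prime]

theorem natCast_eq_zero (X : Scheme.{u}) [h : IsFpScheme p X] (U : X.Opens) : (p : Γ(X, U)) = 0 := by
  let f := h.exists_hom.some
  let φ : ULift.{u} (ZMod p) →+* Γ(X, U) :=
    (f.appTop ≫ X.presheaf.map (homOfLE (le_top : U ≤ ⊤)).op).hom.comp
      (Scheme.ΓSpecIso (CommRingCat.of (ULift.{u} (ZMod p)))).inv.hom
  have : (p : ULift.{u} (ZMod p)) = 0 := by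
    apply ULift.ext
    simp
  exact (map_natCast φ p).symm.trans ((congrArg φ this).trans (map_zero φ))

/-- The `p`-th power endomorphism of a ring in which `p = 0`. -/
def powHom {R : Type*} [CommRing R] (hR : (p : R) = 0) : R →+* R where
  toFun x := x ^ p
  map_one' := one_pow _
  map_mul' _ _ := mul_pow _ _ _
  map_zero' := zero_pow hp.1.ne_zero
  map_add' x y := by
    rcases subsingleton_or_nontrivial R with h | h
    · exact Subsingleton.elim _ _
    · have : CharP R p := (CharP.charP_iff_prime_eq_zero hp.1).2 hR
      exact add_pow_char x y p

/-- The absolute Frobenius as a morphism of ringed spaces. -/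
noncomputable def frobeniusRinged (X : Scheme.{u}) [IsFpScheme p X] :
    X.toPresheafedSpace ⟶ X.toPresheafedSpace where
  base := 𝟙 _
  c := { app U := CommRingCat.ofHom (powHom p (natCast_eq_zero p X U.unop))
         naturality U V i := by
          ext x
          exact (map_pow (X.presheaf.map i).hom x p).symm }

/-- The absolute Frobenius of an `𝔽_p`-scheme: the identity on the underlying space, and the
`p`-th power map on functions. -/
noncomputable def frobenius (X : Scheme.{u}) [IsFpScheme p X] : X ⟶ X where
  toHom := frobeniusRinged p X
  prop x := by
    refine ⟨fun a ha => ?_⟩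
    obtain ⟨U, hx, s, rfl⟩ := X.presheaf.exists_germ_eq (x := x) a
    have h : (frobeniusRinged p X).stalkMap x (X.presheaf.germ U x hx s) =
        X.presheaf.germ U x hx (s ^ p) :=
      PresheafedSpace.stalkMap_germ_apply (frobeniusRinged p X) U x hx s
    have h' : IsUnit (X.presheaf.germ U x hx (s ^ p)) := h ▸ ha
    rw [map_pow] at h'
    exact (isUnit_pow_iff hp.1.ne_zero).1 h'

theorem frobenius_app (X : Scheme.{u}) [IsFpScheme p X] (U : X.Opens) (s : Γ(X, U)) :
    (frobenius p X).app U s = s ^ p := rfl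

theorem frobenius_comp {X Y : Scheme.{u}} [IsFpScheme p X] [IsFpScheme p Y] (f : X ⟶ Y) :
    frobenius p X ≫ f = f ≫ frobenius p Y := by
  refine Scheme.Hom.ext (by rfl) fun U => ?_
  ext s
  change X.presheaf.map (eqToHom rfl).op (f.app U s ^ p) = f.app U (s ^ p)
  rw [map_pow (f.app U).hom]
  exact ConcreteCategory.congr_hom (X.presheaf.map_id _) _
end Frobenius

theorem QCoh.pushforwardSq_app {X Y Z W : Scheme.{u}} {f : X ⟶ Y} {g : Y ⟶ Z} {h : X ⟶ W}
    {k : W ⟶ Z} [QuasiCompact f] [QuasiSeparated f] [QuasiCompact g] [QuasiSeparated g]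
    [QuasiCompact h] [QuasiSeparated h] [QuasiCompact k] [QuasiSeparated k] (e : f ≫ g = h ≫ k)
    (M : QCoh X) (U : Z.Opens) (i : h ⁻¹ᵁ (k ⁻¹ᵁ U) ≤ f ⁻¹ᵁ (g ⁻¹ᵁ U)) :
    ((QCoh.pushforwardSq e).hom.app M).hom.app U = M.obj.presheaf.map (homOfLE i).op := by
  refine Eq.trans (b := 𝟙 _ ≫ M.obj.presheaf.map _ ≫ 𝟙 _) rfl ?_
  exact (Category.id_comp _).trans (Category.comp_id _)

theorem QCoh.pushforward_res {X Y : Scheme.{u}} (f : X ⟶ Y) [QuasiCompact f] [QuasiSeparated f]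
    (M : QCoh X) {U V : Y.Opens} (i : U ≤ V) (i' : f ⁻¹ᵁ U ≤ f ⁻¹ᵁ V) :
    ((QCoh.pushforward f).obj M).obj.presheaf.map (homOfLE i).op =
      M.obj.presheaf.map (homOfLE i').op := rfl

section Frob
variable (p : ℕ) [hp : Fact p.Prime]

/-- The direct image of quasi-coherent modules along the absolute Frobenius. -/
noncomputable abbrev frobeniusPushforward (X : Scheme.{u}) [IsFpScheme p X] [IsGeometric X] :
    QCoh X ⥤ QCoh X := QCoh.pushforward (frobenius p X)

/-- Frobenius modules on `X`: quasi-coherent modules `M` with a map `M ⟶ F_* M`, where `F` is the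
absolute Frobenius. -/
abbrev Frob (X : Scheme.{u}) [IsFpScheme p X] [IsGeometric X] : Type (u + 1) :=
  Endofunctor.Coalgebra (frobeniusPushforward p X)

variable {X Y Z W : Scheme.{u}} [IsFpScheme p X] [IsGeometric X] [IsFpScheme p Y] [IsGeometric Y]
  [IsFpScheme p Z] [IsGeometric Z] [IsFpScheme p W] [IsGeometric W]

instance : PreservesLimits (frobeniusPushforward p X) :=
  (QCoh.adjunction (frobenius p X)).rightAdjoint_preservesLimits

noncomputable instance : Abelian (Frob p X) :=
  have : PreservesFiniteLimits (frobeniusPushforward p X) :=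
    PreservesLimits.preservesFiniteLimits _
  inferInstance

namespace Frob

/-- The canonical isomorphism `f_* F_* ≅ F_* f_*`. -/
noncomputable def comm (f : X ⟶ Y) : frobeniusPushforward p X ⋙ QCoh.pushforward f ≅
    QCoh.pushforward f ⋙ frobeniusPushforward p Y :=
  QCoh.pushforwardSq (frobenius_comp p f)

/-- The direct image of Frobenius modules. -/
noncomputable def pushforward (f : X ⟶ Y) : Frob p X ⥤ Frob p Y :=
  Coalg.map (QCoh.pushforward f) (comm p f).hom

/-- The inverse image of Frobenius modules: on underlying modules it is the usual inverse image
`f^*`, and its structure map is adjoint to `F^* f^* M ≅ f^* F^* M ⟶ f^* M`. -/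
noncomputable def pullback (f : X ⟶ Y) : Frob p Y ⥤ Frob p X :=
  Coalg.map (QCoh.pullback f) (Coalg.mate (QCoh.adjunction f) (comm p f))

/-- The inverse image of Frobenius modules is left adjoint to the direct image. -/
noncomputable def adjunction (f : X ⟶ Y) : pullback p f ⊣ pushforward p f :=
  Coalg.adjunction (QCoh.adjunction f) (comm p f)

noncomputable instance (f : X ⟶ Y) : (pushforward p f).Additive :=
  inferInstanceAs (Coalg.map _ _).Additive

noncomputable instance (f : X ⟶ Y) : (pullback p f).Additive :=
  inferInstanceAs (Coalg.map _ _).Additive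

instance (f : X ⟶ Y) : PreservesFiniteColimits (pullback p f) :=
  have := (adjunction p f).leftAdjoint_preservesColimits
  PreservesColimits.preservesFiniteColimits _

instance pullback_preservesMono (f : X ⟶ Y) [Flat f] :
    (pullback p f).PreservesMonomorphisms where
  preserves {M N} u hu := by
    have : PreservesFiniteLimits (frobeniusPushforward p Y) :=
      PreservesLimits.preservesFiniteLimits _
    have := Coalg.mono_f u
    have := QCoh.pullback_preservesMono f
    have h : Mono ((QCoh.pullback f).map u.f) := inferInstance
    exact Endofunctor.Coalgebra.mono_of_mono (h := h) ((pullback p f).map u)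

instance pullback_leftExact (f : X ⟶ Y) [Flat f] : PreservesFiniteLimits (pullback p f) := by
  rw [Functor.preservesFiniteLimits_iff_forall_exact_map_and_mono]
  intro S hS
  have := hS.mono_f
  have := hS.epi_g
  exact ⟨hS.exact.map_of_epi_of_preservesCokernel (pullback p f) inferInstance inferInstance,
    inferInstance⟩

set_option maxHeartbeats 2000000 in
theorem comm_comm {f : X ⟶ Y} {g : Y ⟶ Z} {h : X ⟶ W} {k : W ⟶ Z} (e : f ≫ g = h ≫ k)
    (M : QCoh X) : ((QCoh.pushforward g).map ((comm p f).hom.app M) ≫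
      (comm p g).hom.app ((QCoh.pushforward f).obj M)) ≫
      (frobeniusPushforward p Z).map ((QCoh.pushforwardSq e).hom.app M) =
    (QCoh.pushforwardSq e).hom.app ((frobeniusPushforward p X).obj M) ≫
      (QCoh.pushforward k).map ((comm p h).hom.app M) ≫
      (comm p k).hom.app ((QCoh.pushforward h).obj M) := by
  refine (qcoh Z).hom_ext (Scheme.Modules.hom_ext _ _ fun U => ?_)
  have i2 : g ⁻¹ᵁ (frobenius p Z ⁻¹ᵁ U) ≤ frobenius p Y ⁻¹ᵁ (g ⁻¹ᵁ U) := le_rfl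
  have i3 : h ⁻¹ᵁ (k ⁻¹ᵁ (frobenius p Z ⁻¹ᵁ U)) ≤ f ⁻¹ᵁ (g ⁻¹ᵁ (frobenius p Z ⁻¹ᵁ U)) :=
    (congrArg (fun q : X ⟶ Z => q ⁻¹ᵁ (frobenius p Z ⁻¹ᵁ U)) e.symm).le
  have i4 : h ⁻¹ᵁ (k ⁻¹ᵁ U) ≤ f ⁻¹ᵁ (g ⁻¹ᵁ U) := i3
  have i6 : k ⁻¹ᵁ (frobenius p Z ⁻¹ᵁ U) ≤ frobenius p W ⁻¹ᵁ (k ⁻¹ᵁ U) := le_rfl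
  have h1 := QCoh.pushforwardSq_app (frobenius_comp p f) M (g ⁻¹ᵁ U) le_rfl
  have h2 := (QCoh.pushforwardSq_app (frobenius_comp p g) ((QCoh.pushforward f).obj M) U i2).trans
    (QCoh.pushforward_res f M i2 le_rfl)
  have h3 := QCoh.pushforwardSq_app e M ((frobenius p Z) ⁻¹ᵁ U) i3
  have h4 := (QCoh.pushforwardSq_app e ((frobeniusPushforward p X).obj M) U i4).trans
    (QCoh.pushforward_res (frobenius p X) M i4 i3)
  have h5 := QCoh.pushforwardSq_app (frobenius_comp p h) M (k ⁻¹ᵁ U) le_rfl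
  have h6 := (QCoh.pushforwardSq_app (frobenius_comp p k) ((QCoh.pushforward h).obj M) U i6).trans
    (QCoh.pushforward_res h M i6 le_rfl)
  have key {U₁ U₂ U₃ U₄ V₂ V₃ : X.Opens} (i₁ : U₂ ≤ U₁) (i₂ : U₃ ≤ U₂) (i₃ : U₄ ≤ U₃)
      (j₁ : V₂ ≤ U₁) (j₂ : V₃ ≤ V₂) (j₃ : U₄ ≤ V₃) :
    (M.obj.presheaf.map (homOfLE i₁).op ≫ M.obj.presheaf.map (homOfLE i₂).op) ≫
      M.obj.presheaf.map (homOfLE i₃).op = M.obj.presheaf.map (homOfLE j₁).op ≫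
      M.obj.presheaf.map (homOfLE j₂).op ≫ M.obj.presheaf.map (homOfLE j₃).op := by
    simp only [← Functor.map_comp]
    rfl
  have e1 := (congrArg₂ (· ≫ ·) (congrArg₂ (· ≫ ·) h1 h2) h3)
  have e2 := (congrArg₂ (· ≫ ·) h4 (congrArg₂ (· ≫ ·) h5 h6)).symm
  refine e1.trans (Eq.trans ?_ e2)
  exact key _ _ i3 _ _ _

theorem pushforwardSq_str {f : X ⟶ Y} {g : Y ⟶ Z} {h : X ⟶ W} {k : W ⟶ Z}
    (e : f ≫ g = h ≫ k) (M : QCoh X) (s : M ⟶ (frobeniusPushforward p X).obj M) :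
    ((QCoh.pushforward g).map ((QCoh.pushforward f).map s ≫ (comm p f).hom.app M) ≫
      (comm p g).hom.app ((QCoh.pushforward f).obj M)) ≫
      (frobeniusPushforward p Z).map ((QCoh.pushforwardSq e).hom.app M) =
    (QCoh.pushforwardSq e).hom.app M ≫
      (QCoh.pushforward k).map ((QCoh.pushforward h).map s ≫ (comm p h).hom.app M) ≫
      (comm p k).hom.app ((QCoh.pushforward h).obj M) := by
  have nat : (QCoh.pushforward g).map ((QCoh.pushforward f).map s) ≫
      (QCoh.pushforwardSq e).hom.app ((frobeniusPushforward p X).obj M) =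
      (QCoh.pushforwardSq e).hom.app M ≫ (QCoh.pushforward k).map ((QCoh.pushforward h).map s) :=
    (QCoh.pushforwardSq e).hom.naturality s
  rw [Functor.map_comp, Functor.map_comp, Category.assoc, Category.assoc, Category.assoc,
    ← reassoc_of% nat, ← comm_comm, Category.assoc]

/-- If `f ≫ g = h ≫ k` then `g_* f_* ≅ k_* h_*`. -/
noncomputable def pushforwardSq {f : X ⟶ Y} {g : Y ⟶ Z} {h : X ⟶ W} {k : W ⟶ Z}
    (e : f ≫ g = h ≫ k) :
    pushforward p f ⋙ pushforward p g ≅ pushforward p h ⋙ pushforward p k :=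
  NatIso.ofComponents (fun M => Endofunctor.Coalgebra.isoMk ((QCoh.pushforwardSq e).app M.V)
    (pushforwardSq_str p e M.V M.str))
    (fun φ => Endofunctor.Coalgebra.ext ((QCoh.pushforwardSq e).hom.naturality φ.f))

end Frob
end Frob

namespace Coalg
open Endofunctor

section Cofree
variable {A : Type*} [Category* A] (F : A ⥤ A) [HasLimitsOfShape (Discrete ℕ) A]
  [PreservesLimitsOfShape (Discrete ℕ) F]

/-- The iterates of an endofunctor on an object. -/
def iter (I : A) : ℕ → A
  | 0 => I
  | n + 1 => F.obj (iter I n)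

/-- The cofree coalgebra on an object: the product of all its iterated images, with the shift. -/
noncomputable def cofree (I : A) : Coalgebra F where
  V := ∏ᶜ iter F I
  str := (Pi.lift (fun n => Pi.π (iter F I) (n + 1)) : ∏ᶜ iter F I ⟶ ∏ᶜ fun n => F.obj (iter F I n)) ≫
    (PreservesProduct.iso F (iter F I)).inv

/-- The projections from the cofree coalgebra. -/
noncomputable def cofreeπ (I : A) (n : ℕ) : (cofree F I).V ⟶ iter F I n := Pi.π (iter F I) n

/-- The projection from the cofree coalgebra to the object. -/
noncomputable def cofreeε (I : A) : (cofree F I).V ⟶ I := Pi.π (iter F I) 0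

theorem cofree_str (I : A) (n : ℕ) :
    (cofree F I).str ≫ F.map (cofreeπ F I n) = cofreeπ F I (n + 1) := by
  have h : (PreservesProduct.iso F (iter F I)).inv ≫ F.map (Pi.π (iter F I) n) =
      Pi.π (fun n => F.obj (iter F I n)) n := by
    rw [Iso.inv_comp_eq, PreservesProduct.iso_hom, piComparison_comp_π]
  refine (Category.assoc _ _ _).trans ((congrArg (Pi.lift _ ≫ ·) h).trans ?_)
  exact Pi.lift_π _ _

theorem cofree_ext {W : A} {I : A} {a b : W ⟶ (cofree F I).V}
    (h : ∀ n, a ≫ cofreeπ F I n = b ≫ cofreeπ F I n) : a = b := Pi.hom_ext _ _ h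

theorem map_cofree_ext {W : A} {I : A} {a b : W ⟶ F.obj (cofree F I).V}
    (h : ∀ n, a ≫ F.map (cofreeπ F I n) = b ≫ F.map (cofreeπ F I n)) : a = b :=
  (isLimitOfPreserves F (limit.isLimit (Discrete.functor (iter F I)))).hom_ext fun ⟨n⟩ => h n

/-- The components of the morphism to the cofree coalgebra. -/
def liftAux {I : A} (V : Coalgebra F) (φ : V.V ⟶ I) : ∀ n, V.V ⟶ iter F I n
  | 0 => φ
  | n + 1 => V.str ≫ F.map (liftAux V φ n)

theorem cofree_hom_π {I : A} {V : Coalgebra F} (Φ : V ⟶ cofree F I) (n : ℕ) :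
    Φ.f ≫ cofreeπ F I n = liftAux F V (Φ.f ≫ cofreeε F I) n := by
  induction n with
  | zero => rfl
  | succ n ih =>
    have h2 : V.str ≫ F.map (Φ.f ≫ cofreeπ F I n) = Φ.f ≫ cofreeπ F I (n + 1) := by
      rw [F.map_comp, Φ.h_assoc, cofree_str]
      rfl
    rw [ih] at h2
    exact h2.symm

/-- The underlying morphism of `cofreeLift`. -/
noncomputable def cofreeLiftf {I : A} (V : Coalgebra F) (φ : V.V ⟶ I) : V.V ⟶ (cofree F I).V :=
  Pi.lift (liftAux F V φ)

theorem cofreeLiftf_π {I : A} (V : Coalgebra F) (φ : V.V ⟶ I) (n : ℕ) :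
    cofreeLiftf F V φ ≫ cofreeπ F I n = liftAux F V φ n := Pi.lift_π _ _

/-- A morphism from the underlying object extends to the cofree coalgebra. -/
noncomputable def cofreeLift {I : A} (V : Coalgebra F) (φ : V.V ⟶ I) : V ⟶ cofree F I where
  f := cofreeLiftf F V φ
  h := map_cofree_ext F fun n => by
    rw [Category.assoc, Category.assoc, cofree_str, ← F.map_comp, cofreeLiftf_π]
    exact (cofreeLiftf_π F V φ (n + 1)).symm

theorem cofreeLift_ε {I : A} (V : Coalgebra F) (φ : V.V ⟶ I) :
    (cofreeLift F V φ).f ≫ cofreeε F I = φ := cofreeLiftf_π F V φ 0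

theorem cofree_hom_ext {I : A} {V : Coalgebra F} {Φ Ψ : V ⟶ cofree F I}
    (h : Φ.f ≫ cofreeε F I = Ψ.f ≫ cofreeε F I) : Φ = Ψ :=
  Coalgebra.ext (cofree_ext F fun n => by rw [cofree_hom_π F Φ n, h, ← cofree_hom_π F Ψ n])

end Cofree

theorem enoughInjectives {A : Type*} [Category* A] [Abelian A] (F : A ⥤ A) [F.Additive]
    [PreservesFiniteLimits F] [HasLimitsOfShape (Discrete ℕ) A]
    [PreservesLimitsOfShape (Discrete ℕ) F] [EnoughInjectives A] :
    EnoughInjectives (Coalgebra F) where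
  presentation V := ⟨
    { J := cofree F (Injective.under V.V)
      injective := ⟨fun {X Y} g u hu => by
        have := mono_f u
        refine ⟨cofreeLift F _ (Injective.factorThru (g.f ≫ cofreeε F _) u.f), ?_⟩
        apply cofree_hom_ext
        rw [Coalgebra.comp_f, Category.assoc, cofreeLift_ε, Injective.comp_factorThru]⟩
      f := cofreeLift F V (Injective.ι V.V)
      mono := by
        have h : Mono ((cofreeLift F V (Injective.ι V.V)).f ≫ cofreeε F _) := by
          rw [cofreeLift_ε]
          exact Injective.ι_mono V.V
        have := mono_of_mono (cofreeLift F V (Injective.ι V.V)).f (cofreeε F _)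
        exact Coalgebra.mono_of_mono _ }⟩

end Coalg

namespace Frob
variable (p : ℕ) [hp : Fact p.Prime]

theorem enoughInjectives_Spec (R : CommRingCat.{u}) [IsFpScheme p (Spec R)] :
    EnoughInjectives (Frob p (Spec R)) := by
  let E : ModuleCat.{u} R ≌ QCoh (Spec R) := tildeEquiv
  have : EnoughInjectives (QCoh (Spec R)) := EnoughInjectives.of_equivalence E.inverse
  have : HasLimitsOfShape (Discrete ℕ) (QCoh (Spec R)) :=
    Adjunction.hasLimitsOfShape_of_equivalence E.inverse
  have : PreservesLimitsOfShape (Discrete ℕ) (frobeniusPushforward p (Spec R)) :=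
    (QCoh.adjunction (frobenius p _)).rightAdjoint_preservesLimits.preservesLimitsOfShape
  have : PreservesFiniteLimits (frobeniusPushforward p (Spec R)) :=
    PreservesLimits.preservesFiniteLimits _
  exact Coalg.enoughInjectives _

end Frob

section
variable (p : ℕ) [hp : Fact p.Prime]

/-- A finite affine open cover of a quasi-compact scheme. -/
theorem exists_finite_affineOpenCover (X : Scheme.{u}) [CompactSpace X] :
    ∃ 𝒰 : Scheme.AffineOpenCover.{u} X, Finite 𝒰.I₀ := by
  let 𝒱 := Scheme.OpenCover.finiteSubcover X.affineOpenCover.openCover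
  refine ⟨{ I₀ := 𝒱.I₀
            X := fun i => X.affineOpenCover.X (X.affineOpenCover.openCover.idx i.1)
            f := fun i => X.affineOpenCover.f (X.affineOpenCover.openCover.idx i.1)
            idx := 𝒱.idx
            covers := 𝒱.covers
            map_prop := 𝒱.map_prop }, inferInstanceAs (Finite 𝒱.I₀)⟩

theorem hom_zero_of_restrict {X : Scheme.{u}} (𝒰 : Scheme.AffineOpenCover.{u} X) {M N : X.Modules}
    (u : M ⟶ N) (h : ∀ i, (Scheme.Modules.restrictFunctor (𝒰.f i)).map u = 0) : u = 0 := by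
  refine Scheme.Modules.hom_ext _ _ fun U => ?_
  ext x
  refine TopCat.Sheaf.eq_of_locally_eq' ⟨N.presheaf, N.isSheaf⟩
    (fun i => 𝒰.f i ''ᵁ (𝒰.f i ⁻¹ᵁ U)) U (fun i => homOfLE ((𝒰.f i).image_preimage_le U))
    (fun y hy => ?_) _ _ fun i => ?_
  · obtain ⟨z, hz⟩ := 𝒰.covers y
    exact Opens.mem_iSup.2 ⟨_, z, show (𝒰.f _) z ∈ U from hz.symm ▸ hy, hz⟩
  · have e1 := ConcreteCategory.congr_hom (u.mapPresheaf.naturality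
      (homOfLE ((𝒰.f i).image_preimage_le U)).op) x
    have e2 := congrArg (fun φ => Scheme.Modules.Hom.app φ (𝒰.f i ⁻¹ᵁ U)
      (M.presheaf.map (homOfLE ((𝒰.f i).image_preimage_le U)).op x)) (h i)
    exact e1.symm.trans (e2.trans (map_zero (N.presheaf.map _).hom).symm)

namespace Frob
variable (X : Scheme.{u}) [IsFpScheme p X] [IsGeometric X]

variable {X} in
theorem hom_zero_of_pullback (𝒰 : Scheme.AffineOpenCover.{u} X)
    [∀ i, IsFpScheme p (Spec (𝒰.X i))] {M N : Frob p X}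
    (u : M ⟶ N) (h : ∀ i, (pullback p (𝒰.f i)).map u = 0) : u = 0 := by
  refine Endofunctor.Coalgebra.ext ((qcoh X).hom_ext (hom_zero_of_restrict 𝒰 u.f.hom fun i => ?_))
  have h1 : (Scheme.Modules.pullback (𝒰.f i)).map u.f.hom = 0 :=
    congrArg (fun w => w.f.hom) (h i)
  let e := Scheme.Modules.restrictFunctorIsoPullback (𝒰.f i)
  rw [← cancel_mono (e.hom.app _), e.hom.naturality, h1, comp_zero, zero_comp]

instance : EnoughInjectives (Frob p X) where
  presentation M := by
    obtain ⟨𝒰, hf⟩ := exists_finite_affineOpenCover X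
    have hF (i) : IsFpScheme p (Spec (𝒰.X i)) := .of_hom p (𝒰.f i)
    have hI (i) := enoughInjectives_Spec p (𝒰.X i)
    let N (i) := (pullback p (𝒰.f i)).obj M
    let J (i) := (pushforward p (𝒰.f i)).obj (Injective.under (N i))
    have hJ (i) : Injective (J i) :=
      Injective.injective_of_adjoint (adjunction p (𝒰.f i)) _
    let f (i) : M ⟶ J i := (adjunction p (𝒰.f i)).homEquiv _ _ (Injective.ι (N i))
    have hL : HasFiniteProducts (Frob p X) := inferInstance
    have hP : HasProduct J := inferInstance
    refine ⟨{ J := ∏ᶜ J, f := Pi.lift f, mono := ?_ }⟩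
    refine Preadditive.mono_of_cancel_zero _ fun {T} k hk => ?_
    refine hom_zero_of_pullback p 𝒰 k fun i => ?_
    have h1 : k ≫ f i = 0 := by
      rw [← Pi.lift_π f i, ← Category.assoc, hk, zero_comp]
    rw [← cancel_mono (Injective.ι (N i)), zero_comp]
    apply ((adjunction p (𝒰.f i)).homEquiv _ _).injective
    rw [Adjunction.homEquiv_naturality_left, h1, Adjunction.homEquiv_unit, Functor.map_zero,
      comp_zero]

end Frob
end

namespace Derived
open DerivedCategory.Plus

section Adj
variable {A B : Type*} [Category* A] [Category* B] [Preadditive A] [Preadditive B]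
  {G : A ⥤ B} {F : B ⥤ A} [G.Additive] [F.Additive] (adj : G ⊣ F)

/-- The unit of the adjunction between categories of complexes. -/
def complexUnit (K : CochainComplex A ℤ) :
    K ⟶ (F.mapHomologicalComplex _).obj ((G.mapHomologicalComplex _).obj K) where
  f n := adj.unit.app (K.X n)
  comm' i j _ := (adj.unit.naturality (K.d i j)).symm

/-- The counit of the adjunction between categories of complexes. -/
def complexCounit (K : CochainComplex B ℤ) :
    (G.mapHomologicalComplex _).obj ((F.mapHomologicalComplex _).obj K) ⟶ K where
  f n := adj.counit.app (K.X n)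
  comm' i j _ := (adj.counit.naturality (K.d i j)).symm

/-- Adjoint functors induce adjoint functors between homotopy categories of complexes. -/
def homotopyAdjunction : G.mapHomotopyCategoryPlus ⊣ F.mapHomotopyCategoryPlus where
  unit :=
    { app K := ObjectProperty.homMk ((HomotopyCategory.quotient _ _).map (complexUnit adj K.obj.as))
      naturality K L φ := by
        obtain ⟨f, hf⟩ := (HomotopyCategory.quotient _ _).map_surjective φ.hom
        refine ObjectProperty.hom_ext _ ?_
        change φ.hom ≫ _ = _ ≫ (F.mapHomotopyCategory _).map ((G.mapHomotopyCategory _).map φ.hom)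
        rw [← hf]
        refine congrArg (HomotopyCategory.quotient _ _).map (a₁ := f ≫ complexUnit adj L.obj.as)
          (a₂ := complexUnit adj K.obj.as ≫ (F.mapHomologicalComplex _).map
            ((G.mapHomologicalComplex _).map f)) ?_
        ext n
        exact adj.unit.naturality (f.f n) }
  counit :=
    { app K := ObjectProperty.homMk
        ((HomotopyCategory.quotient _ _).map (complexCounit adj K.obj.as))
      naturality K L φ := by
        obtain ⟨f, hf⟩ := (HomotopyCategory.quotient _ _).map_surjective φ.hom
        refine ObjectProperty.hom_ext _ ?_
        change (G.mapHomotopyCategory _).map ((F.mapHomotopyCategory _).map φ.hom) ≫ _ = _ ≫ φ.hom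
        rw [← hf]
        refine congrArg (HomotopyCategory.quotient _ _).map
          (a₁ := (G.mapHomologicalComplex _).map
            ((F.mapHomologicalComplex _).map f) ≫ complexCounit adj L.obj.as)
          (a₂ := complexCounit adj K.obj.as ≫ f) ?_
        ext n
        exact adj.counit.naturality (f.f n) }
  left_triangle_components K := by
    refine ObjectProperty.hom_ext _ ?_
    refine congrArg (HomotopyCategory.quotient _ _).map
      (a₁ := (G.mapHomologicalComplex _).map (complexUnit adj K.obj.as) ≫ complexCounit adj _)
      (a₂ := 𝟙 _) ?_
    ext n
    exact adj.left_triangle_components (K.obj.as.X n)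
  right_triangle_components K := by
    refine ObjectProperty.hom_ext _ ?_
    refine congrArg (HomotopyCategory.quotient _ _).map
      (a₁ := complexUnit adj _ ≫ (F.mapHomologicalComplex _).map (complexCounit adj K.obj.as))
      (a₂ := 𝟙 _) ?_
    ext n
    exact adj.right_triangle_components (K.obj.as.X n)

end Adj

variable {A B C D : Type*} [Category* A] [Category* B] [Category* C] [Category* D]
  [Abelian A] [Abelian B] [Abelian C] [Abelian D]
  [HasDerivedCategory A] [HasDerivedCategory B] [HasDerivedCategory C] [HasDerivedCategory D]

section Exact
variable (G : A ⥤ B) [G.Additive] [PreservesFiniteLimits G] [PreservesFiniteColimits G]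

theorem inverts : (HomotopyCategory.Plus.quasiIso A).IsInvertedBy
    (G.mapHomotopyCategoryPlus ⋙ Qh) := by
  intro K L φ hφ
  refine Localization.inverts Qh (HomotopyCategory.Plus.quasiIso B) _ ?_
  obtain ⟨f, hf⟩ := (HomotopyCategory.quotient _ _).map_surjective φ.hom
  have h1 : HomotopyCategory.quasiIso A _ φ.hom := hφ
  rw [← hf] at h1
  have h2 := (HomotopyCategory.quotient_map_mem_quasiIso_iff
    ((G.mapHomologicalComplex _).map f)).2
    ((G.mapHomologicalComplexUpToQuasiIsoLocalizerMorphism _).map _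
      ((HomotopyCategory.quotient_map_mem_quasiIso_iff f).1 h1))
  change HomotopyCategory.quasiIso B _ ((G.mapHomotopyCategory _).map φ.hom)
  rw [← hf]
  exact h2

/-- The functor between bounded below derived categories induced by an exact functor. -/
noncomputable def mapPlus : DerivedCategory.Plus A ⥤ DerivedCategory.Plus B :=
  Localization.lift (G.mapHomotopyCategoryPlus ⋙ Qh) (inverts G) Qh

/-- The functor `mapPlus G` is given by applying `G` to complexes. -/
noncomputable def mapPlusFactors : Qh ⋙ mapPlus G ≅ G.mapHomotopyCategoryPlus ⋙ Qh :=
  Localization.fac _ (inverts G) Qh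

variable {G} {F : B ⥤ A} [F.Additive] [EnoughInjectives B] (adj : G ⊣ F)

/-- If the left adjoint `G` of `F` is exact, then `G` is left adjoint to the right derived functor of
`F` on bounded below derived categories. -/
noncomputable def derivedAdjunction : mapPlus G ⊣ F.rightDerivedFunctorPlus :=
  have : (mapPlus G).IsLeftDerivedFunctor (mapPlusFactors G).hom
      (HomotopyCategory.Plus.quasiIso A) := Functor.isLeftDerivedFunctor_of_inverts _ _ _
  have : (mapPlus G ⋙ F.rightDerivedFunctorPlus).IsLeftDerivedFunctor
      ((Functor.associator _ _ _).inv ≫ Functor.whiskerRight (mapPlusFactors G).hom _)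
      (HomotopyCategory.Plus.quasiIso A) :=
    Functor.isLeftDerivedFunctor_of_inverts _ _
      ((Functor.associator _ _ _).symm ≪≫ Functor.isoWhiskerRight (mapPlusFactors G) _)
  have : (F.rightDerivedFunctorPlus ⋙ mapPlus G).IsRightDerivedFunctor
      (Functor.whiskerRight F.rightDerivedFunctorPlusUnit (mapPlus G) ≫
        (Functor.associator _ _ _).hom) (HomotopyCategory.Plus.quasiIso B) :=
    (HomotopyCategory.Plus.localizerMorphism_derives _).isRightDerivedFunctor_of_isIso _
      fun K => by
        have : IsIso (F.rightDerivedFunctorPlusUnit.app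
          ((InjectiveObject.ι B).mapHomotopyCategoryPlus.obj K)) := inferInstance
        rw [NatTrans.comp_app]
        dsimp
        infer_instance
  (homotopyAdjunction adj).derived (HomotopyCategory.Plus.quasiIso A)
    (HomotopyCategory.Plus.quasiIso B) (mapPlusFactors G).hom F.rightDerivedFunctorPlusUnit

end Exact

section Comp
variable [EnoughInjectives A] [EnoughInjectives B] [EnoughInjectives C]
  (P : A ⥤ B) (Q : B ⥤ D) [P.Additive] [Q.Additive]

/-- The canonical natural transformation from the composition of two functors to the composition of
their derived functors. -/
noncomputable def compUnit : P.mapHomotopyCategoryPlus ⋙ Q.mapHomotopyCategoryPlus ⋙ Qh ⟶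
    Qh ⋙ P.rightDerivedFunctorPlus ⋙ Q.rightDerivedFunctorPlus :=
  Functor.whiskerLeft P.mapHomotopyCategoryPlus Q.rightDerivedFunctorPlusUnit ≫
    (Functor.associator _ _ _).inv ≫
    Functor.whiskerRight P.rightDerivedFunctorPlusUnit Q.rightDerivedFunctorPlus ≫
    (Functor.associator _ _ _).hom

instance isRightDerivedFunctor_comp [P.PreservesInjectiveObjects] :
    (P.rightDerivedFunctorPlus ⋙ Q.rightDerivedFunctorPlus).IsRightDerivedFunctor (compUnit P Q)
      (HomotopyCategory.Plus.quasiIso A) :=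
  (HomotopyCategory.Plus.localizerMorphism_derives _).isRightDerivedFunctor_of_isIso _
    fun K => by
      have h1 : IsIso (P.rightDerivedFunctorPlusUnit.app
        ((InjectiveObject.ι A).mapHomotopyCategoryPlus.obj K)) := inferInstance
      have h (n : ℤ) : Injective ((P.mapHomotopyCategoryPlus.obj
          ((InjectiveObject.ι A).mapHomotopyCategoryPlus.obj K)).obj.as.X n) :=
        P.injective_obj_of_injective
          (inferInstanceAs (Injective
            (((InjectiveObject.ι A).mapHomotopyCategoryPlus.obj K).obj.as.X n)))
      have h2 : IsIso (Q.rightDerivedFunctorPlusUnit.app (P.mapHomotopyCategoryPlus.obj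
        ((InjectiveObject.ι A).mapHomotopyCategoryPlus.obj K))) := inferInstance
      simp only [compUnit, NatTrans.comp_app]
      dsimp
      infer_instance

variable {P Q} {R : A ⥤ C} {S : C ⥤ D} [R.Additive] [S.Additive]

/-- An isomorphism `P ⋙ Q ≅ R ⋙ S` induces an isomorphism on homotopy categories. -/
def homotopySq (e : P ⋙ Q ≅ R ⋙ S) :
    P.mapHomotopyCategoryPlus ⋙ Q.mapHomotopyCategoryPlus ≅
      R.mapHomotopyCategoryPlus ⋙ S.mapHomotopyCategoryPlus :=
  Functor.mapHomotopyCategoryPlusCompIso e ≪≫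
    (Functor.mapHomotopyCategoryPlusCompIso (Iso.refl (R ⋙ S))).symm

/-- The canonical map `RQ ∘ RP ≅ R(Q ∘ P) ≅ R(S ∘ R) ⟶ RS ∘ RR` for an isomorphism `Q ∘ P ≅ S ∘ R`,
where `P` preserves injective objects. -/
noncomputable def derivedSq [P.PreservesInjectiveObjects] (e : P ⋙ Q ≅ R ⋙ S) :
    P.rightDerivedFunctorPlus ⋙ Q.rightDerivedFunctorPlus ⟶
      R.rightDerivedFunctorPlus ⋙ S.rightDerivedFunctorPlus :=
  Functor.rightDerivedNatTrans _ _ (compUnit P Q) (compUnit R S)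
    (HomotopyCategory.Plus.quasiIso A)
    ((Functor.associator _ _ _).inv ≫ Functor.whiskerRight (homotopySq e).hom Qh ≫
      (Functor.associator _ _ _).hom)

end Comp
end Derived

namespace Frob
section Derived
variable (p : ℕ) [hp : Fact p.Prime] {X Y Z W : Scheme.{u}}
  [IsFpScheme p X] [IsGeometric X] [IsFpScheme p Y] [IsGeometric Y]
  [IsFpScheme p Z] [IsGeometric Z] [IsFpScheme p W] [IsGeometric W]
  [HasDerivedCategory (Frob p X)] [HasDerivedCategory (Frob p Y)]
  [HasDerivedCategory (Frob p Z)] [HasDerivedCategory (Frob p W)]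

/-- The right derived direct image `D⁺(Frob X) ⥤ D⁺(Frob Y)`. -/
noncomputable def derivedPushforward (f : X ⟶ Y) :
    DerivedCategory.Plus (Frob p X) ⥤ DerivedCategory.Plus (Frob p Y) :=
  (pushforward p f).rightDerivedFunctorPlus

/-- The inverse image `D⁺(Frob Y) ⥤ D⁺(Frob X)` along a flat morphism. -/
noncomputable def flatPullback (f : X ⟶ Y) [Flat f] :
    DerivedCategory.Plus (Frob p Y) ⥤ DerivedCategory.Plus (Frob p X) :=
  Derived.mapPlus (pullback p f)

/-- For a flat morphism, the inverse image is left adjoint to the derived direct image. -/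
noncomputable def derivedAdjunction (f : X ⟶ Y) [Flat f] :
    flatPullback p f ⊣ derivedPushforward p f :=
  Derived.derivedAdjunction (adjunction p f)

instance pushforward_preservesInjectiveObjects (f : X ⟶ Y) [Flat f] :
    (pushforward p f).PreservesInjectiveObjects where
  injective_obj _ := Injective.injective_of_adjoint (adjunction p f) _

/-- The canonical map `Rf_* Rg'_* ⟶ Rg_* Rf'_*` for a commutative square with `g'` flat. -/
noncomputable def derivedPushforwardSq {g' : X ⟶ Y} {f : Y ⟶ Z} {f' : X ⟶ W} {g : W ⟶ Z}
    (e : g' ≫ f = f' ≫ g) [Flat g'] :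
    derivedPushforward p g' ⋙ derivedPushforward p f ⟶
      derivedPushforward p f' ⋙ derivedPushforward p g :=
  Derived.derivedSq (pushforwardSq p e)

/-- The base change map `g^* Rf_* M ⟶ Rf'_* g'^* M` for a commutative square with `g` and `g'`
flat: it is adjoint to `Rf_* M ⟶ Rf_* Rg'_* g'^* M ⟶ Rg_* Rf'_* g'^* M`. -/
noncomputable def baseChangeMap {g' : X ⟶ Y} {f : Y ⟶ Z} {f' : X ⟶ W} {g : W ⟶ Z}
    (e : g' ≫ f = f' ≫ g) [Flat g'] [Flat g] (M : DerivedCategory.Plus (Frob p Y)) :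
    (flatPullback p g).obj ((derivedPushforward p f).obj M) ⟶
      (derivedPushforward p f').obj ((flatPullback p g').obj M) :=
  ((derivedAdjunction p g).homEquiv _ _).symm
    ((derivedPushforward p f).map ((derivedAdjunction p g').unit.app M) ≫
      (derivedPushforwardSq p e).app ((flatPullback p g').obj M))

end Derived
end Frob

theorem flat_of_isPullback {X Y Z W : Scheme.{u}} {g' : X ⟶ Y} {f : Y ⟶ Z} {f' : X ⟶ W} {g : W ⟶ Z}
    (sq : IsPullback g' f' f g) [Flat g] : Flat g' :=
  MorphismProperty.of_isPullback sq.flip inferInstance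

end FrobeniusModules

open FrobeniusModules

/-! Injective Frobenius modules on `X` are controlled by an affine scheme. Since `X` is
quasi-compact, a finite affine cover gives a flat `π : U ⟶ X` with `U` affine that has sections over
the members of the cover. For an injective `I` the unit `I ⟶ π_* π^* I` is a monomorphism, because
local sections make `π^*` faithful, and hence it splits. So `I` is a retract of some `π_* E`, and by
naturality of base change it is enough to understand modules of that form.

Let `U' = U ×_X X'`, with projections `γ` to `U` and `π'` to `X'`. The affine diagonals of `X` and
`S` make `π` and `π ≫ f` affine, hence also `π'` and `π' ≫ f'`. For affine morphisms, underived base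
change is the identity `M ⊗_S (S ⊗_R R') = M ⊗_R R'` on sections over affine opens
(`isBC_of_isPullback`). It gives `g'^* π_* E ≅ π'_* γ^* E`, and, for the pasted square, that the
underived base change map of `f` is an isomorphism at `π_* E` (`Frob.isIso_baseChange_pushforward`).
The Frobenius structures play no part here, since isomorphisms can be tested on underlying modules.

To pass to `D⁺`, represent an object by a bounded below complex `K` of injectives. The derived base
change map is then the termwise one followed by the comparison of `f'_* g'^* K` with `Rf'_* g'^* K`
(`Derived.baseChange_fac`). The termwise map is an isomorphism by the above. For the comparison it
must be shown that the terms of `g'^* K` are good enough to compute `Rf'_*`, although they need not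
be injective. They are retracts of objects `π'_* N`, so their units for `π'^* ⊣ π'_*` split. As
`π'^*`, `π'_*` and `f'_* π'_*` are exact, a dimension shift shows that `f'_*` preserves acyclicity
of bounded below complexes of such objects (`exactAt_map_of_unitSplit`), hence quasi-isomorphisms
between them. Comparison with an injective resolution finishes the argument
(`isIso_rightDerivedFunctorPlusUnit_of_unitSplit`). -/

namespace FrobeniusModules

/-! ### Base change transformations for abstract adjunctions -/

/-- The base change transformation of a square of right adjoint functors. -/
@[simps]
def baseChange {A A' B B' : Type*} [Category* A] [Category* A'] [Category* B] [Category* B']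
    {G' : A ⥤ A'} {F' : A' ⥤ A} (adj' : G' ⊣ F') {P : A ⥤ B} {P' : A' ⥤ B'}
    {G : B ⥤ B'} {F : B' ⥤ B} (adj : G ⊣ F) (e : F' ⋙ P ⟶ P' ⋙ F) : P ⋙ G ⟶ G' ⋙ P' where
  app N := (adj.homEquiv _ _).symm (P.map (adj'.unit.app N) ≫ e.app (G'.obj N))
  naturality M N u := by
    have h1 := adj'.unit.naturality u
    have h2 := e.naturality (G'.map u)
    dsimp at h1 h2 ⊢
    rw [← adj.homEquiv_naturality_left_symm, ← adj.homEquiv_naturality_right_symm,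
      ← P.map_comp_assoc, h1, P.map_comp, Category.assoc, Category.assoc, h2]

theorem unit_baseChange {A A' B B' : Type*} [Category* A] [Category* A'] [Category* B]
    [Category* B'] {G' : A ⥤ A'} {F' : A' ⥤ A} (adj' : G' ⊣ F') {P : A ⥤ B} {P' : A' ⥤ B'}
    {G : B ⥤ B'} {F : B' ⥤ B} (adj : G ⊣ F) (e : F' ⋙ P ⟶ P' ⋙ F) (N : A) :
    dsimp% adj.unit.app (P.obj N) ≫ F.map ((baseChange adj' adj e).app N) =
      P.map (adj'.unit.app N) ≫ e.app (G'.obj N) :=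
  (adj.homEquiv_unit ..).symm.trans ((adj.homEquiv _ _).apply_symm_apply _)

/-! ### Derived base change in terms of complexes of injectives -/

namespace Derived
open DerivedCategory.Plus

section
variable {A A' B B' : Type*} [Category* A] [Category* A'] [Category* B] [Category* B']
  [Abelian A] [Abelian A'] [Abelian B] [Abelian B']
  [HasDerivedCategory A] [HasDerivedCategory A'] [HasDerivedCategory B] [HasDerivedCategory B']
  [EnoughInjectives A] [EnoughInjectives A'] [EnoughInjectives B']
  {G' : A ⥤ A'} {F' : A' ⥤ A} (adj' : G' ⊣ F') {P : A ⥤ B} {P' : A' ⥤ B'}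
  {G : B ⥤ B'} {F : B' ⥤ B} (adj : G ⊣ F) (e : F' ⋙ P ≅ P' ⋙ F)
  [G'.Additive] [F'.Additive] [P.Additive] [P'.Additive] [G.Additive] [F.Additive]
  [PreservesFiniteLimits G'] [PreservesFiniteColimits G']
  [PreservesFiniteLimits G] [PreservesFiniteColimits G]

/-- This is the property that characterizes the unit of a derived adjunction. The two local
instances repeat those used to build `derivedAdjunction`, so that the general formula for derived
adjunctions applies to it. -/
theorem derivedAdjunction_unit_fac (K : HomotopyCategory.Plus B) :
    (derivedAdjunction adj).unit.app (Qh.obj K) ≫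
      F.rightDerivedFunctorPlus.map ((mapPlusFactors G).hom.app K) =
    Qh.map ((homotopyAdjunction adj).unit.app K) ≫
      F.rightDerivedFunctorPlusUnit.app (G.mapHomotopyCategoryPlus.obj K) := by
  have : (mapPlus G).IsLeftDerivedFunctor (mapPlusFactors G).hom
      (HomotopyCategory.Plus.quasiIso B) := Functor.isLeftDerivedFunctor_of_inverts _ _ _
  have : (mapPlus G ⋙ F.rightDerivedFunctorPlus).IsLeftDerivedFunctor
      ((Functor.associator _ _ _).inv ≫ Functor.whiskerRight (mapPlusFactors G).hom _)
      (HomotopyCategory.Plus.quasiIso B) :=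
    Functor.isLeftDerivedFunctor_of_inverts _ _
      ((Functor.associator _ _ _).symm ≪≫ Functor.isoWhiskerRight (mapPlusFactors G) _)
  exact Adjunction.derivedη_fac_app (homotopyAdjunction adj) (HomotopyCategory.Plus.quasiIso B)
    (mapPlusFactors G).hom F.rightDerivedFunctorPlusUnit K

theorem derivedSq_fac [F'.PreservesInjectiveObjects] (K : HomotopyCategory.Plus A') :
    (compUnit F' P).app K ≫ (derivedSq e).app (Qh.obj K) =
      Qh.map ((homotopySq e).hom.app K) ≫ (compUnit P' F).app K :=
  Functor.rightDerivedNatTrans_app (L := Qh) _ _ (compUnit F' P) (compUnit P' F)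
    (HomotopyCategory.Plus.quasiIso A') _ K |>.trans (by simp)

theorem compUnit_app (K : HomotopyCategory.Plus A') :
    (compUnit F' P).app K = P.rightDerivedFunctorPlusUnit.app (F'.mapHomotopyCategoryPlus.obj K) ≫
      P.rightDerivedFunctorPlus.map (F'.rightDerivedFunctorPlusUnit.app K) := by
  simp [compUnit]

/-- This reduces the derived base change map to the one on complexes: the two differ only by the
comparison maps from `P` and `P'` to their derived functors and by the localization isomorphisms for
`G` and `G'`. -/
theorem baseChange_fac [F'.PreservesInjectiveObjects] (K : HomotopyCategory.Plus A) :
    (mapPlus G).map (P.rightDerivedFunctorPlusUnit.app K) ≫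
      (baseChange (derivedAdjunction adj') (derivedAdjunction adj) (derivedSq e)).app (Qh.obj K) =
    (mapPlusFactors G).hom.app (P.mapHomotopyCategoryPlus.obj K) ≫
      Qh.map ((baseChange (homotopyAdjunction adj') (homotopyAdjunction adj)
        (homotopySq e).hom).app K) ≫
      P'.rightDerivedFunctorPlusUnit.app (G'.mapHomotopyCategoryPlus.obj K) ≫
      P'.rightDerivedFunctorPlus.map ((mapPlusFactors G').inv.app K) := by
  -- After transposing along the derived adjunction, both sides are maps from `Qh (P K)` to an
  -- iterated derived direct image. They agree by a diagram chase through the characterizing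
  -- equations of the two units and of `derivedSq`, together with naturality.
  apply ((derivedAdjunction adj).homEquiv _ _).injective
  have h1 := derivedAdjunction_unit_fac adj (P.mapHomotopyCategoryPlus.obj K)
  have h2 := derivedAdjunction_unit_fac adj' K
  have h3 := derivedSq_fac e (G'.mapHomotopyCategoryPlus.obj K)
  have h4 := (derivedSq e).naturality ((mapPlusFactors G').hom.app K)
  have h5 := P.rightDerivedFunctorPlusUnit.naturality ((homotopyAdjunction adj').unit.app K)
  have h6 := F.rightDerivedFunctorPlusUnit.naturality
    ((baseChange (homotopyAdjunction adj') (homotopyAdjunction adj) (homotopySq e).hom).app K)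
  have h7 := unit_baseChange (homotopyAdjunction adj') (homotopyAdjunction adj)
    (homotopySq e).hom K
  have h8 := unit_baseChange (derivedAdjunction adj') (derivedAdjunction adj) (derivedSq e)
    (Qh.obj K)
  have h9 : F.rightDerivedFunctorPlus.map
      (P'.rightDerivedFunctorPlus.map ((mapPlusFactors G').hom.app K)) ≫
      F.rightDerivedFunctorPlus.map
      (P'.rightDerivedFunctorPlus.map ((mapPlusFactors G').inv.app K)) = 𝟙 _ := by
    rw [← Functor.map_comp, ← Functor.map_comp, Iso.hom_inv_id_app, CategoryTheory.Functor.map_id,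
      CategoryTheory.Functor.map_id]
  have h10 := (derivedAdjunction adj).unit.naturality (P.rightDerivedFunctorPlusUnit.app K)
  rw [compUnit_app, compUnit_app] at h3
  dsimp only [Functor.comp_obj, Functor.comp_map, Functor.id_obj, Functor.id_map] at *
  rw [Adjunction.homEquiv_unit, Adjunction.homEquiv_unit, Functor.map_comp, Functor.map_comp,
    Functor.map_comp, Functor.map_comp, ← reassoc_of% h10, h8,
    reassoc_of% h1, ← reassoc_of% h6, ← Functor.map_comp_assoc, h7, Functor.map_comp,
    Category.assoc]
  rw [Category.assoc] at h3
  rw [← reassoc_of% h3, reassoc_of% h5, ← Functor.map_comp_assoc, ← h2,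
    Functor.map_comp, Category.assoc, reassoc_of% h4, h9, Category.comp_id]

omit [HasDerivedCategory A] [HasDerivedCategory A'] [HasDerivedCategory B]
  [HasDerivedCategory B'] [EnoughInjectives A] [EnoughInjectives A'] [EnoughInjectives B'] in
theorem homotopySq_hom_app (K : HomotopyCategory.Plus A') (ε : (P.mapHomologicalComplex _).obj
    ((F'.mapHomologicalComplex (.up ℤ)).obj K.obj.as) ⟶ (F.mapHomologicalComplex _).obj
      ((P'.mapHomologicalComplex _).obj K.obj.as)) (hε : ∀ n, ε.f n = e.hom.app (K.obj.as.X n)) :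
    ((homotopySq e).hom.app K).hom = (HomotopyCategory.quotient _ _).map ε := by
  -- The second isomorphism in `homotopySq` is induced by the identity of `P' ⋙ F`. It contributes a
  -- factor `ι` with identity components, which has to be absorbed.
  let ι := (NatTrans.mapHomologicalComplex (𝟙 (P' ⋙ F)) (.up ℤ)).app K.obj.as
  refine congrArg (HomotopyCategory.quotient _ _).map
    (a₁ := (NatTrans.mapHomologicalComplex e.hom _).app K.obj.as ≫ ι) (a₂ := ε) ?_
  ext n
  exact (Category.comp_id _).trans (hε n).symm

/-- Unit, counit and square isomorphism on the homotopy category are all represented by termwise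
maps of complexes. The base change map is therefore the class of the chain map `c` made of the base
change maps of the terms. -/
theorem isIso_baseChange_homotopy (K : HomotopyCategory.Plus A)
    (h : ∀ n, IsIso ((baseChange adj' adj e.hom).app (K.obj.as.X n))) :
    IsIso ((baseChange (homotopyAdjunction adj') (homotopyAdjunction adj)
      (homotopySq e).hom).app K) := by
  let c : ((P ⋙ G).mapHomologicalComplex (.up ℤ)).obj K.obj.as ⟶
      ((G' ⋙ P').mapHomologicalComplex (.up ℤ)).obj K.obj.as :=
    { f n := (baseChange adj' adj e.hom).app (K.obj.as.X n)
      comm' i j _ := ((baseChange adj' adj e.hom).naturality (K.obj.as.d i j)).symm }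
  have (n : ℤ) : IsIso (c.f n) := h n
  have hc : IsIso c := HomologicalComplex.Hom.isIso_of_components _
  have hι : ((baseChange (homotopyAdjunction adj') (homotopyAdjunction adj)
      (homotopySq e).hom).app K).hom = (HomotopyCategory.quotient _ _).map c := by
    rw [baseChange_app, Adjunction.homEquiv_counit]
    let ε : (P.mapHomologicalComplex _).obj ((F'.mapHomologicalComplex (.up ℤ)).obj
        ((G'.mapHomologicalComplex _).obj K.obj.as)) ⟶ (F.mapHomologicalComplex _).obj
        ((P'.mapHomologicalComplex _).obj ((G'.mapHomologicalComplex _).obj K.obj.as)) :=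
      (NatTrans.mapHomologicalComplex e.hom _).app ((G'.mapHomologicalComplex _).obj K.obj.as)
    have hε := homotopySq_hom_app e (G'.mapHomotopyCategoryPlus.obj K) ε fun n => rfl
    have : ((P.mapHomotopyCategoryPlus.map ((homotopyAdjunction adj').unit.app K) ≫
        (homotopySq e).hom.app (G'.mapHomotopyCategoryPlus.obj K))).hom =
      (HomotopyCategory.quotient _ _).map
        ((P.mapHomologicalComplex _).map (complexUnit adj' K.obj.as) ≫ ε) :=
      (congrArg (((P.mapHomotopyCategoryPlus.map ((homotopyAdjunction adj').unit.app K))).hom ≫ ·)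
        hε).trans ((HomotopyCategory.quotient _ _).map_comp _ _).symm
    have := congrArg (fun t => (G.mapHomotopyCategory _).map t ≫
      ((homotopyAdjunction adj).counit.app
        ((G'.mapHomotopyCategoryPlus ⋙ P'.mapHomotopyCategoryPlus).obj K)).hom) this
    refine Eq.trans this ?_
    refine congrArg (HomotopyCategory.quotient _ _).map
      (a₁ := (G.mapHomologicalComplex _).map
        ((P.mapHomologicalComplex _).map (complexUnit adj' K.obj.as) ≫ ε) ≫
        complexCounit adj ((P'.mapHomologicalComplex _).obj
          ((G'.mapHomologicalComplex _).obj K.obj.as))) ?_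
    ext n
    exact (adj.homEquiv_counit ..).symm
  have : IsIso ((HomotopyCategory.Plus.ι _).map ((baseChange (homotopyAdjunction adj')
      (homotopyAdjunction adj) (homotopySq e).hom).app K)) := by
    change IsIso ((baseChange (homotopyAdjunction adj') (homotopyAdjunction adj)
      (homotopySq e).hom).app K).hom
    rw [hι]
    exact (HomotopyCategory.quotient _ _).map_isIso c
  exact isIso_of_fully_faithful (HomotopyCategory.Plus.ι _) _

/-- The formal criterion behind the theorem: underived base change has to hold on injectives, and
`G'` has to send complexes of injectives to complexes that compute the derived functor of `P'`. -/
theorem isIso_derived_baseChange [F'.PreservesInjectiveObjects]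
    (h : ∀ I : A, Injective I → IsIso ((baseChange adj' adj e.hom).app I))
    (h' : ∀ K : HomotopyCategory.Plus A, (∀ n, Injective (K.obj.as.X n)) →
      IsIso (P'.rightDerivedFunctorPlusUnit.app (G'.mapHomotopyCategoryPlus.obj K)))
    (M : DerivedCategory.Plus A) :
    IsIso ((baseChange (derivedAdjunction adj') (derivedAdjunction adj) (derivedSq e)).app M) := by
  -- With enough injectives, every object of `D⁺` is represented by a bounded below complex of
  -- injectives. Being an isomorphism at an object is invariant under isomorphism of that object.
  obtain ⟨L, ⟨i⟩⟩ := Functor.EssSurj.mem_essImage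
    (F := (InjectiveObject.ι A).mapHomotopyCategoryPlus ⋙ Qh) M
  rw [← NatTrans.isIso_app_iff_of_iso _ i]
  let K := (InjectiveObject.ι A).mapHomotopyCategoryPlus.obj L
  have hK (n) : Injective (K.obj.as.X n) :=
    inferInstanceAs (Injective (((InjectiveObject.ι A).mapHomotopyCategoryPlus.obj L).obj.as.X n))
  have := h' K hK
  have := isIso_baseChange_homotopy adj' adj e K fun n => h _ (hK n)
  -- A complex of injectives computes the derived functor of `P`, so the map precomposed in
  -- `baseChange_fac` can be cancelled.
  have : IsIso ((mapPlus G).map (P.rightDerivedFunctorPlusUnit.app K)) := inferInstance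
  refine (isIso_comp_left_iff ((mapPlus G).map (P.rightDerivedFunctorPlusUnit.app K)) _).1 ?_
  refine (congrArg (fun t => IsIso t) (baseChange_fac adj' adj e K)).mpr ?_
  infer_instance

end
end Derived

/-! ### Objects with split unit and the computation of derived functors -/

theorem mappingCone_acyclic_iff {A : Type*} [Category* A] [Abelian A] {K L : CochainComplex A ℤ}
    (φ : K ⟶ L) : (CochainComplex.mappingCone φ).Acyclic ↔ QuasiIso φ := by
  rw [← HomotopyCategory.quotient_obj_mem_subcategoryAcyclic_iff_acyclic,
    ← HomologicalComplex.mem_quasiIso_iff, ← HomotopyCategory.quotient_map_mem_quasiIso_iff,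
    HomotopyCategory.quasiIso_eq_trW_subcategoryAcyclic]
  exact ((HomotopyCategory.subcategoryAcyclic A).trW_iff_of_distinguished _
    (HomotopyCategory.mappingCone_triangleh_distinguished φ)).symm

theorem acyclic_map {A B : Type*} [Category* A] [Category* B] [Abelian A] [Abelian B] (F : A ⥤ B)
    [F.Additive] [PreservesFiniteLimits F] [PreservesFiniteColimits F] {K : CochainComplex A ℤ}
    (hK : K.Acyclic) : ((F.mapHomologicalComplex _).obj K).Acyclic := fun i =>
  ShortComplex.Exact.map (hK i) F

section
variable {A E B : Type*} [Category* A] [Category* E] [Category* B] [Abelian A] [Abelian E]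
  [Abelian B] {G : A ⥤ E} {P : E ⥤ A} (adj : G ⊣ P) (F : A ⥤ B)

/-- Objects for which the unit of an adjunction is a split monomorphism. -/
def unitSplit : ObjectProperty A := fun N => IsSplitMono (adj.unit.app N)

/-- Used in two ways: it keeps the class stable under the cokernels in the dimension shift, and it
transfers the property from modules of the form `π'_* N` to inverse images of injectives. -/
theorem unitSplit_of_retract {N N' : A} (r : Retract N N') (h : unitSplit adj N') :
    unitSplit adj N := by
  have : IsSplitMono (adj.unit.app N') := h
  refine ⟨⟨⟨P.map (G.map r.i) ≫ retraction (adj.unit.app N') ≫ r.r, ?_⟩⟩⟩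
  have := adj.unit.naturality r.i
  dsimp at this ⊢
  rw [← reassoc_of% this, IsSplitMono.id_assoc, r.retract]

theorem unitSplit_right (N : E) : unitSplit adj (P.obj N) :=
  ⟨⟨⟨P.map (adj.counit.app N), adj.right_triangle_components N⟩⟩⟩

theorem unitSplit_biprod [G.Additive] [P.Additive] {M N : A} (hM : unitSplit adj M)
    (hN : unitSplit adj N) : unitSplit adj (M ⊞ N) := by
  have : IsSplitMono (adj.unit.app M) := hM
  have : IsSplitMono (adj.unit.app N) := hN
  have h1 := adj.unit.naturality (biprod.fst : M ⊞ N ⟶ M)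
  have h2 := adj.unit.naturality (biprod.snd : M ⊞ N ⟶ N)
  dsimp at h1 h2
  refine ⟨⟨⟨biprod.lift (P.map (G.map biprod.fst) ≫ retraction (adj.unit.app M))
    (P.map (G.map biprod.snd) ≫ retraction (adj.unit.app N)), ?_⟩⟩⟩
  dsimp
  apply biprod.hom_ext <;> simp [← reassoc_of% h1, ← reassoc_of% h2]

theorem unitSplit_mappingCone [G.Additive] [P.Additive] {K L : CochainComplex A ℤ} (φ : K ⟶ L)
    (hK : ∀ n, unitSplit adj (K.X n)) (hL : ∀ n, unitSplit adj (L.X n)) (n : ℤ) :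
    unitSplit adj ((CochainComplex.mappingCone φ).X n) :=
  unitSplit_of_retract adj
    (Retract.ofIso (HomologicalComplex.homotopyCofiber.XIsoBiprod φ n (n + 1) rfl))
    (unitSplit_biprod adj (hK _) (hL _))

variable [G.Additive] [P.Additive] [F.Additive]
  [PreservesFiniteLimits G] [PreservesFiniteColimits G]
  [PreservesFiniteLimits P] [PreservesFiniteColimits P]
  [PreservesFiniteLimits (P ⋙ F)] [PreservesFiniteColimits (P ⋙ F)]

/-- Dimension shift. The unit embeds `C` into `P G C` with a degreewise split cokernel of the same
kind as `C`. Since `F` carries `P G C` to an acyclic complex, cohomology of `F C` in one degree is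
bounded by that of the cokernel one degree lower. The induction therefore has to run over all
complexes at once. It starts at `n₀ - 1`, where every such complex vanishes, so no finite resolution
is needed. -/
theorem exactAt_map_of_unitSplit (n₀ : ℤ) (k : ℕ) : ∀ (C : CochainComplex A ℤ),
    C.IsStrictlyGE n₀ → (∀ n, unitSplit adj (C.X n)) → C.Acyclic →
    ((F.mapHomologicalComplex _).obj C).ExactAt (n₀ - 1 + k) := by
  induction k with
  | zero =>
    intro C _ _ _
    exact HomologicalComplex.ExactAt.of_isZero
      (F.map_isZero (C.isZero_of_isStrictlyGE n₀ _))
  | succ k ih =>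
    intro C hC hs ha
    let TC := (P.mapHomologicalComplex _).obj ((G.mapHomologicalComplex _).obj C)
    let η : C ⟶ TC := Derived.complexUnit adj C
    let S : ShortComplex (CochainComplex A ℤ) := ShortComplex.mk η (cokernel.π η) (by simp)
    have hη (n : ℤ) : IsSplitMono (η.f n) := hs n
    have hm : Mono η := HomologicalComplex.mono_of_mono_f _ fun n => (hη n).mono
    have hS : S.ShortExact := { exact := S.exact_of_g_is_cokernel (cokernelIsCokernel η) }
    have hSn (n : ℤ) := hS.map_of_exact (HomologicalComplex.eval A (.up ℤ) n)
    -- The splittings are only degreewise and need not commute with the differentials. That is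
    -- enough for an additive `F` to keep the sequence of complexes short exact.
    let σ (n : ℤ) : (S.map (HomologicalComplex.eval A (.up ℤ) n)).Splitting :=
      ShortComplex.Splitting.ofExactOfRetraction _ (hSn n).exact (hη n).exists_splitMono.some.retraction
        (hη n).exists_splitMono.some.id (hSn n).epi_g
    have hT : TC.Acyclic := acyclic_map P (acyclic_map G ha)
    have hC' : (cokernel η).IsStrictlyGE n₀ := by
      rw [CochainComplex.isStrictlyGE_iff]
      intro i hi
      have : Epi ((cokernel.π η).f i) := (hSn i).epi_g
      have h0 : IsZero (TC.X i) := P.map_isZero (G.map_isZero (C.isZero_of_isStrictlyGE n₀ i))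
      exact IsZero.of_epi ((cokernel.π η).f i) h0
    -- By the splitting, each term of the cokernel is a direct summand of an object in the image of
    -- `P`, whose unit splits by the triangle identity.
    have hs' (n : ℤ) : unitSplit adj ((cokernel η).X n) :=
      unitSplit_of_retract adj ⟨(σ n).s, (cokernel.π η).f n, (σ n).s_g⟩ (unitSplit_right adj _)
    have ha' : (cokernel η).Acyclic := by
      intro i
      rw [HomologicalComplex.exactAt_iff_isZero_homology]
      exact (hS.homology_exact₃ i (i + 1) rfl).isZero_of_both_zeros
        ((hT i).isZero_homology.eq_of_src _ _) ((ha (i + 1)).isZero_homology.eq_of_tgt _ _)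
    let FS := S.map (F.mapHomologicalComplex (.up ℤ))
    have hFS : FS.ShortExact := HomologicalComplex.shortExact_of_degreewise_shortExact _
      fun n => ((σ n).map F).shortExact
    -- Only the exactness of the composite `P ⋙ F` enters; `F` itself need not be exact.
    have hFT : FS.X₂.Acyclic := acyclic_map (P ⋙ F) (acyclic_map G ha)
    have hi : (ComplexShape.up ℤ).Rel (n₀ - 1 + k) (n₀ - 1 + (k + 1 : ℕ)) := by
      simp only [ComplexShape.up_Rel]
      push_cast
      ring
    change FS.X₁.ExactAt _
    rw [HomologicalComplex.exactAt_iff_isZero_homology]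
    exact (hFS.homology_exact₁ _ _ hi).isZero_of_both_zeros
      (((ih _ hC' hs' ha').isZero_homology).eq_of_src _ _)
      ((hFT _).isZero_homology.eq_of_tgt _ _)

theorem acyclic_map_of_unitSplit (n₀ : ℤ) (C : CochainComplex A ℤ) [hC : C.IsStrictlyGE n₀]
    (hs : ∀ n, unitSplit adj (C.X n)) (ha : C.Acyclic) :
    ((F.mapHomologicalComplex _).obj C).Acyclic := by
  intro i
  obtain ⟨k, hk⟩ | hi : (∃ k : ℕ, i = n₀ - 1 + k) ∨ i < n₀ := by
    by_cases hi : i < n₀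
    · exact .inr hi
    · exact .inl ⟨(i - n₀ + 1).toNat, by lia⟩
  · exact hk ▸ exactAt_map_of_unitSplit adj F n₀ k C hC hs ha
  · exact HomologicalComplex.ExactAt.of_isZero (F.map_isZero (C.isZero_of_isStrictlyGE n₀ _))

theorem quasiIso_map_of_unitSplit (n₀ : ℤ) {K L : CochainComplex A ℤ} [K.IsStrictlyGE n₀]
    [L.IsStrictlyGE n₀] (φ : K ⟶ L) (hK : ∀ n, unitSplit adj (K.X n))
    (hL : ∀ n, unitSplit adj (L.X n)) (hφ : QuasiIso φ) :
    QuasiIso ((F.mapHomologicalComplex _).map φ) := by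
  -- In degree `n` the cone is `K^(n+1) ⊕ L^n`, so it may begin one degree earlier than `K` and `L`.
  have := CochainComplex.isStrictlyGE_mappingCone φ n₀ n₀ (n₀ - 1)
  have h := acyclic_map_of_unitSplit adj F (n₀ - 1) _ (unitSplit_mappingCone adj φ hK hL)
    ((mappingCone_acyclic_iff φ).2 hφ)
  rw [← mappingCone_acyclic_iff]
  exact fun i => (h i).of_iso (CochainComplex.mappingCone.mapHomologicalComplexIso φ F)

open DerivedCategory.Plus in
-- Compare `K` with an injective resolution. Injectives have split units too, so `F` preserves the
-- quasi-isomorphism between them. Since the comparison map is an isomorphism at the resolution,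
-- naturality carries this back to `K`.
theorem isIso_rightDerivedFunctorPlusUnit_of_unitSplit [HasDerivedCategory A]
    [HasDerivedCategory B] [EnoughInjectives A] (hI : ∀ I : A, Injective I → unitSplit adj I)
    (K : HomotopyCategory.Plus A) (hK : ∀ n, unitSplit adj (K.obj.as.X n)) :
    IsIso (F.rightDerivedFunctorPlusUnit.app K) := by
  obtain ⟨K, rfl⟩ := HomotopyCategory.Plus.quotient_obj_surjective K
  obtain ⟨n₀, hn₀⟩ := K.property
  obtain ⟨L, hL, i, hi⟩ := CochainComplex.Plus.exists_quasiIso_injective K n₀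
  let I := (InjectiveObject.ι A).mapCochainComplexPlus.obj L
  have hI' : I.obj.IsStrictlyGE n₀ := by
    rw [CochainComplex.isStrictlyGE_iff]
    intro j hj
    exact (InjectiveObject.ι A).map_isZero (L.obj.isZero_of_isStrictlyGE n₀ j)
  have hq := quasiIso_map_of_unitSplit adj F n₀ (K := K.obj) (L := I.obj) i.hom hK
    (fun n => hI _ (L.obj.X n).property) hi
  let φ := (HomotopyCategory.Plus.quotient A).map i
  have h1 : IsIso (Qh.map φ) := Localization.inverts Qh (HomotopyCategory.Plus.quasiIso A) _
    ((HomotopyCategory.quotient_map_mem_quasiIso_iff i.hom).2 hi)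
  have h2 : IsIso (Qh.map (F.mapHomotopyCategoryPlus.map φ)) :=
    Localization.inverts Qh (HomotopyCategory.Plus.quasiIso B) _
      ((HomotopyCategory.quotient_map_mem_quasiIso_iff _).2 hq)
  have h3 : IsIso (F.rightDerivedFunctorPlusUnit.app ((HomotopyCategory.Plus.quotient A).obj I)) :=
    inferInstance
  have h4 := F.rightDerivedFunctorPlusUnit.naturality φ
  dsimp only [Functor.comp_map] at h4
  have h5 : IsIso (F.rightDerivedFunctorPlus.map (Qh.map φ)) := inferInstance
  have h6 : IsIso (Qh.map (F.mapHomotopyCategoryPlus.map φ) ≫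
    F.rightDerivedFunctorPlusUnit.app ((HomotopyCategory.Plus.quotient A).obj I)) := inferInstance
  have h7 := (congrArg (fun t => IsIso t) h4).mp h6
  exact (isIso_comp_right_iff _ (F.rightDerivedFunctorPlus.map (Qh.map φ))).1 h7

end

/-! ### Base change of modules as a universal semilinear map -/

section BaseChange
variable {R R' : Type u} [CommRing R] [CommRing R'] {M M' : Type u} [AddCommGroup M]
  [AddCommGroup M'] [Module R M] [Module R' M']

/-- A semilinear map `l : M → M'` along a ring homomorphism `σ : R → R'` which is universal among
semilinear maps to `R'`-modules, i.e. which exhibits `M'` as the base change of `M`. -/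
structure IsBC (σ : R →+* R') (l : M →+ M') : Prop where
  map_smul : ∀ r x, l (r • x) = σ r • l x
  lift : ∀ (N : Type u) [AddCommGroup N] [Module R' N] (k : M →+ N),
    (∀ r x, k (r • x) = σ r • k x) → ∃ k' : M' →ₗ[R'] N, ∀ x, k' (l x) = k x
  hom_ext : ∀ (N : Type u) [AddCommGroup N] [Module R' N] (k k' : M' →ₗ[R'] N),
    (∀ x, k (l x) = k' (l x)) → k = k'

theorem IsBC.bijective {σ : R →+* R'} {l : M →+ M'} (h : IsBC σ l) {M'' : Type u}
    [AddCommGroup M''] [Module R' M''] {l' : M →+ M''} (h' : IsBC σ l') (ψ : M' →+ M'')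
    (hψ : ∀ (r : R') x, ψ (r • x) = r • ψ x) (hl : ∀ x, ψ (l x) = l' x) :
    Function.Bijective ψ := by
  obtain ⟨φ, hφ⟩ := h'.lift M' l h.map_smul
  let Ψ : M' →ₗ[R'] M'' := { ψ with map_smul' := hψ }
  have h1 : φ.comp Ψ = LinearMap.id := h.hom_ext _ _ _ fun x => by
    simp [Ψ, hl, hφ]
  have h2 : Ψ.comp φ = LinearMap.id := h'.hom_ext _ _ _ fun x => by
    simp [Ψ, hl, hφ]
  exact ⟨Function.LeftInverse.injective (g := φ) fun x => LinearMap.congr_fun h1 x,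
    Function.RightInverse.surjective (g := φ) fun x => LinearMap.congr_fun h2 x⟩

/-- Semilinear maps into an `R'`-module are linear maps for the `R`-action obtained by restriction
of scalars. This gives access to tensor products, while the semilinear form avoids choosing algebra
structures on rings of sections. -/
theorem isBC_iff_isBaseChange [Algebra R R'] [Module R M'] [IsScalarTower R R' M']
    (l : M →ₗ[R] M') : IsBC (algebraMap R R') l.toAddMonoidHom ↔ IsBaseChange R' l := by
  constructor
  · intro h
    refine IsBaseChange.of_lift_unique _ fun Q _ _ _ _ k => ?_
    let : AddCommGroup Q := Module.addCommMonoidToAddCommGroup R'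
    obtain ⟨k', hk'⟩ := h.lift Q k.toAddMonoidHom fun r x => by simp
    refine ⟨k', LinearMap.ext hk', fun k'' hk'' => h.hom_ext _ _ _ fun x => ?_⟩
    exact (LinearMap.congr_fun hk'' x).trans (hk' x).symm
  · intro h
    refine ⟨fun r x => by simp, fun N _ _ k hk => ?_, fun N _ _ k k' hk => ?_⟩
    · let : Module R N := Module.compHom N (algebraMap R R')
      have : IsScalarTower R R' N := ⟨fun r s x => by
        rw [Algebra.smul_def, mul_smul]
        rfl⟩
      exact ⟨h.lift { k with map_smul' := hk }, fun x => h.lift_eq _ x⟩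
    · let : Module R N := Module.compHom N (algebraMap R R')
      have : IsScalarTower R R' N := ⟨fun r s x => by
        rw [Algebra.smul_def, mul_smul]
        rfl⟩
      exact h.algHom_ext' _ _ (LinearMap.ext hk)

/-- This is the identity `(S ⊗_R R') ⊗_S M = R' ⊗_R M`. The actions of `R` and `R'` are separate
data tied to the others by `hM` and `hM'`, because sections of a direct image carry their own module
structure. -/
theorem IsBC.of_isPushout {R R' S S' : CommRingCat.{u}} {a : R ⟶ S} {b : R ⟶ R'} {c : S ⟶ S'}
    {d : R' ⟶ S'} (sq : IsPushout a b c d) {M M' : Type u} [AddCommGroup M] [AddCommGroup M']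
    [Module S M] [Module S' M'] [Module R M] [Module R' M'] {l : M →+ M'} (h : IsBC c.hom l)
    (hM : ∀ (r : R) (x : M), r • x = a.hom r • x) (hM' : ∀ (r : R') (x : M'), r • x = d.hom r • x) :
    IsBC b.hom l := by
  algebraize [a.hom, b.hom, c.hom, d.hom, c.hom.comp a.hom]
  have : IsScalarTower R R' S' := .of_algebraMap_eq' (congrArg CommRingCat.Hom.hom sq.w)
  have : Algebra.IsPushout R S R' S' := CommRingCat.isPushout_iff_isPushout.1 sq
  have : Algebra.IsPushout R R' S S' := this.symm
  have : IsScalarTower R S M := ⟨fun r s x => by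
    rw [hM, Algebra.smul_def, mul_smul]
    rfl⟩
  have : IsScalarTower R' S' M' := ⟨fun r s x => by
    rw [hM', Algebra.smul_def, mul_smul]
    rfl⟩
  -- The remaining actions on `M'` are restricted from `S'` and from `R'`. The commutativity of the
  -- square makes all the scalar towers compatible.
  let : Module S M' := Module.compHom M' c.hom
  have : IsScalarTower S S' M' := ⟨fun r s x => by
    rw [Algebra.smul_def, mul_smul]
    rfl⟩
  let : Module R M' := Module.compHom M' b.hom
  have : IsScalarTower R R' M' := ⟨fun r s x => by
    rw [Algebra.smul_def, mul_smul]
    rfl⟩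
  have : IsScalarTower R S M' := ⟨fun r s x => by
    rw [Algebra.smul_def, mul_smul]
    refine Eq.trans ?_ (hM' (b.hom r) (s • x)).symm
    rw [← CommRingCat.comp_apply, ← sq.w]
    rfl⟩
  let lS : M →ₗ[S] M' := { l with map_smul' := h.map_smul }
  have h1 : IsBaseChange S' lS := (isBC_iff_isBaseChange lS).1 h
  refine (isBC_iff_isBaseChange (R := R) (R' := R') (lS.restrictScalars R)).2 ?_
  refine IsBaseChange.of_equiv ((Algebra.IsPushout.cancelBaseChange R R' S S' M).symm ≪≫ₗ
    h1.equiv.restrictScalars R') fun x => ?_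
  simp [h1.equiv_tmul]
end BaseChange

/-! ### Sections of quasi-coherent modules and inverse images on affine opens -/

section Sections
variable {X Y : Scheme.{u}}

/-- As `Q` is quasi-coherent, it is the sheaf associated with its global sections, and the
adjunction between `tilde` and global sections applies. Nothing is needed of `K`. -/
theorem existsUnique_hom_Spec {A : CommRingCat.{u}} {Q : (Spec A).Modules} (hQ : qcoh _ Q)
    (K : (Spec A).Modules) (k : Γ(Q, ⊤) →+ Γ(K, ⊤))
    (hk : ∀ (r : Γ(Spec A, ⊤)) x, k (r • x) = r • k x) :
    ∃! b : Q ⟶ K, ∀ x, b.app ⊤ x = k x := by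
  have : IsIso Q.fromTildeΓ := @Scheme.Modules.isIso_fromTildeΓ_of_isQuasicoherent A Q hQ
  have : IsIso (tilde.adjunction.counit.app Q) := this
  have hbij : Function.Bijective (fun b : Q ⟶ K => (moduleSpecΓFunctor (R := A)).map b) := by
    have h := ((tilde.adjunction (R := A)).homEquiv (moduleSpecΓFunctor.obj Q) K).bijective.comp
      ((asIso (tilde.adjunction.counit.app Q)).homCongr (Iso.refl K)).symm.bijective
    refine (congrArg Function.Bijective (funext fun b => ?_)).mp h
    simp [Adjunction.homEquiv_unit]
  let k0 : Γ(Q, ⊤) →ₗ[A] Γ(K, ⊤) := { k with map_smul' := fun a x => hk _ x }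
  let k' : (moduleSpecΓFunctor (R := A)).obj Q ⟶ (moduleSpecΓFunctor (R := A)).obj K :=
    ModuleCat.ofHom (R := A) (X := Γ(Q, ⊤)) (Y := Γ(K, ⊤)) k0
  obtain ⟨b, hb⟩ := hbij.2 k'
  have e (b : Q ⟶ K) : moduleSpecΓFunctor.map b = k' ↔ ∀ x, b.app ⊤ x = k x :=
    ⟨fun h x => congrArg (fun t : (moduleSpecΓFunctor (R := A)).obj Q ⟶
        (moduleSpecΓFunctor (R := A)).obj K => ModuleCat.Hom.hom t x) h,
      fun h => ModuleCat.hom_ext (LinearMap.ext h)⟩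
  exact ⟨b, (e b).1 hb, fun b' hb' => hbij.1 (((e b').2 hb').trans hb.symm)⟩

/-- Restriction to an open subscheme is left adjoint to the direct image, which reduces this to the
affine case. The rings of functions are matched through `i.appIso`. -/
theorem existsUnique_hom_pushforward {A : CommRingCat.{u}} (i : Spec A ⟶ Y) [IsOpenImmersion i]
    {P : Y.Modules} (hP : qcoh _ P) (K : (Spec A).Modules) (k : Γ(P, i ''ᵁ ⊤) →+ Γ(K, ⊤))
    (hk : ∀ (r : Γ(Y, i ''ᵁ ⊤)) x, k (r • x) = (i.appIso ⊤).hom r • k x) :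
    ∃! a : P ⟶ (Scheme.Modules.pushforward i).obj K,
      ∀ x, res K (i.preimage_image_eq ⊤).ge (a.app (i ''ᵁ ⊤) x) = k x := by
  let E := (Scheme.Modules.restrictAdjunction i).homEquiv P K
  have e (a : P ⟶ (Scheme.Modules.pushforward i).obj K) (x) :
      (E.symm a).app ⊤ x = res K (i.preimage_image_eq ⊤).ge (a.app (i ''ᵁ ⊤) x) := by
    simp only [E, Adjunction.homEquiv_counit]
    rfl
  obtain ⟨b, hb, hb'⟩ := existsUnique_hom_Spec (qcoh_restrict i hP) K k fun r x => by
    refine (hk ((i.appIso ⊤).inv r) x).trans ?_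
    rw [← CommRingCat.comp_apply, Iso.inv_hom_id]
    rfl
  refine ⟨E b, fun x => ?_, fun a ha => ?_⟩
  · refine (e _ x).symm.trans ?_
    rw [Equiv.symm_apply_apply]
    exact hb x
  · exact (E.symm_apply_eq).1 (hb' _ fun x => (e a x).trans (ha x))

/-- The universal property in `IsBC` tests against arbitrary modules. Realizing each of them as
sections of a sheaf lets the adjunctions for sheaves be applied. -/
theorem exists_module_of_sections {B : CommRingCat.{u}} (j : Spec B ⟶ X) [IsOpenImmersion j]
    (N : Type u) [AddCommGroup N] [Module Γ(X, j ''ᵁ ⊤) N] :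
    ∃ (K : (Spec B).Modules) (e : N ≃+ Γ(K, ⊤)),
      ∀ (s : Γ(X, j ''ᵁ ⊤)) n, e (s • n) = (j.appIso ⊤).hom s • e n := by
  let σ : B →+* Γ(X, j ''ᵁ ⊤) := ((Scheme.ΓSpecIso B).inv ≫ (j.appIso ⊤).inv).hom
  let : Module B N := Module.compHom N σ
  let e0 : N ≃ₗ[B] Γ(tilde (ModuleCat.of B N), ⊤) := (tilde.isoTop (ModuleCat.of B N)).toLinearEquiv
  refine ⟨tilde (ModuleCat.of B N), e0.toAddEquiv, fun s n => ?_⟩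
  obtain ⟨b, rfl⟩ : ∃ b : B, s = σ b := ⟨(Scheme.ΓSpecIso B).hom ((j.appIso ⊤).hom s), by simp [σ]⟩
  refine (e0.map_smul b n).trans ?_
  change _ = (j.appIso ⊤).hom ((j.appIso ⊤).inv ((Scheme.ΓSpecIso B).inv b)) • e0 n
  rw [← CommRingCat.comp_apply, Iso.inv_hom_id, Scheme.Modules.smul_Spec_def]
  congr 1

/-- The map on sections over opens `V' ≤ g⁻¹ V` induced by a map `P ⟶ g_* Q`. -/
noncomputable def sec {g : X ⟶ Y} {P : Y.Modules} {Q : X.Modules}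
    (φ : P ⟶ (Scheme.Modules.pushforward g).obj Q) {V : Y.Opens} {V' : X.Opens}
    (h : V' ≤ g ⁻¹ᵁ V) : Γ(P, V) →+ Γ(Q, V') :=
  (res Q h).comp (φ.app V).hom

theorem sec_smul {g : X ⟶ Y} {P : Y.Modules} {Q : X.Modules}
    (φ : P ⟶ (Scheme.Modules.pushforward g).obj Q) {V : Y.Opens} {V' : X.Opens}
    (h : V' ≤ g ⁻¹ᵁ V) (r : Γ(Y, V)) (x : Γ(P, V)) :
    sec φ h (r • x) = (g.appLE V V' h).hom r • sec φ h x :=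
  (congrArg (res Q h) (φ.app_smul r x)).trans (res_smul Q h _ _)

theorem sec_comp_map {g : X ⟶ Y} {P : Y.Modules} {Q Q' : X.Modules}
    (φ : P ⟶ (Scheme.Modules.pushforward g).obj Q) (ψ : Q ⟶ Q') {V : Y.Opens} {V' : X.Opens}
    (h : V' ≤ g ⁻¹ᵁ V) (x : Γ(P, V)) :
    sec (φ ≫ (Scheme.Modules.pushforward g).map ψ) h x = ψ.app V' (sec φ h x) :=
  (ConcreteCategory.congr_hom (ψ.mapPresheaf.naturality (homOfLE h).op) _).symm

theorem exists_SpecMap_comp_eq (g : X ⟶ Y) {A B : CommRingCat.{u}} (i : Spec A ⟶ Y)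
    [IsOpenImmersion i] (j : Spec B ⟶ X) [IsOpenImmersion j] (h : j ''ᵁ ⊤ ≤ g ⁻¹ᵁ i ''ᵁ ⊤) :
    ∃ φ : A ⟶ B, j ≫ g = Spec.map φ ≫ i := by
  have hr : Set.range (j ≫ g) ⊆ Set.range i := by
    rintro _ ⟨x, rfl⟩
    obtain ⟨y, -, hy⟩ := h ⟨x, trivial, rfl⟩
    exact ⟨y, hy⟩
  obtain ⟨φ, hφ⟩ := Spec.map_surjective (IsOpenImmersion.lift i (j ≫ g) hr)
  exact ⟨φ, by rw [hφ, IsOpenImmersion.lift_fac]⟩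

/-- The unit `P ⟶ g_* g^* P`. -/
noncomputable def pullbackUnit (g : X ⟶ Y) (P : Y.Modules) :
    P ⟶ (Scheme.Modules.pushforward g).obj ((Scheme.Modules.pullback g).obj P) :=
  (Scheme.Modules.pullbackPushforwardAdjunction g).unit.app P

/-- The inverse image of quasi-coherent modules is given by base change on affine opens. -/
theorem isBC_pullback_aux (g : X ⟶ Y) {P : Y.Modules} (hP : qcoh Y P) {A B : CommRingCat.{u}}
    (i : Spec A ⟶ Y) [IsOpenImmersion i] (j : Spec B ⟶ X) [IsOpenImmersion j]
    (h : j ''ᵁ ⊤ ≤ g ⁻¹ᵁ i ''ᵁ ⊤) :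
    IsBC (g.appLE _ _ h).hom
      (sec (pullbackUnit g P) h) := by
  obtain ⟨φ, hφ⟩ := exists_SpecMap_comp_eq g i j h
  let adj := Scheme.Modules.pullbackPushforwardAdjunction g
  -- The proof compares `Hom(g^* P, j_* K) = Hom(P, g_* j_* K)` with `Hom(P, i_* (Spec φ)_* K)`
  -- through `θ`. Both ends are spaces of linear maps on sections, and this yields the universal
  -- property.
  let θ (K : (Spec B).Modules) : (Scheme.Modules.pushforward g).obj
      ((Scheme.Modules.pushforward j).obj K) ≅ (Scheme.Modules.pushforward i).obj
        ((Scheme.Modules.pushforward (Spec.map φ)).obj K) :=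
    (Scheme.Modules.pushforwardComp j g ≪≫ Scheme.Modules.pushforwardCongr hφ ≪≫
      (Scheme.Modules.pushforwardComp _ i).symm).app K
  have hring : i.appLE (i ''ᵁ ⊤) ⊤ (i.preimage_image_eq ⊤).ge ≫ (Spec.map φ).app ⊤ =
      g.appLE _ _ h ≫ j.appLE (j ''ᵁ ⊤) ⊤ (j.preimage_image_eq ⊤).ge := by
    rw [← (Spec.map φ).appLE_eq_app, Scheme.Hom.appLE_comp_appLE, Scheme.Hom.appLE_comp_appLE]
    simp only [hφ]
    rfl
  have hθ (K : (Spec B).Modules) (U : Y.Opens)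
      (hU : Spec.map φ ⁻¹ᵁ i ⁻¹ᵁ U ≤ j ⁻¹ᵁ g ⁻¹ᵁ U) :
      (θ K).hom.app U = K.presheaf.map (homOfLE hU).op := by
    refine Eq.trans (b := 𝟙 _ ≫ K.presheaf.map _ ≫ 𝟙 _) rfl ?_
    exact (Category.id_comp _).trans (Category.comp_id _)
  -- In terms of sections, the adjoint of `a`, transported by `θ`, is `a` composed with the unit:
  -- both sides restrict the same section of `j_* K`.
  have key (K : (Spec B).Modules) (a : (Scheme.Modules.pullback g).obj P ⟶
      (Scheme.Modules.pushforward j).obj K) (x : Γ(P, i ''ᵁ ⊤)) :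
      res ((Scheme.Modules.pushforward (Spec.map φ)).obj K) (i.preimage_image_eq ⊤).ge
        (((pullbackUnit g P ≫ (Scheme.Modules.pushforward g).map a) ≫ (θ K).hom).app (i ''ᵁ ⊤) x) =
      res K (j.preimage_image_eq ⊤).ge (a.app (j ''ᵁ ⊤) (sec (pullbackUnit g P) h x)) := by
    have hU : Spec.map φ ⁻¹ᵁ i ⁻¹ᵁ i ''ᵁ ⊤ ≤ j ⁻¹ᵁ g ⁻¹ᵁ i ''ᵁ ⊤ :=
      (congrArg (fun q : Spec B ⟶ Y => q ⁻¹ᵁ i ''ᵁ ⊤) hφ.symm).le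
    have e1 : (θ K).hom.app (i ''ᵁ ⊤) ((pullbackUnit g P ≫
        (Scheme.Modules.pushforward g).map a).app (i ''ᵁ ⊤) x) =
        res K hU (a.app (g ⁻¹ᵁ i ''ᵁ ⊤) ((pullbackUnit g P).app (i ''ᵁ ⊤) x)) :=
      congrArg (fun t => t.hom ((pullbackUnit g P ≫
        (Scheme.Modules.pushforward g).map a).app (i ''ᵁ ⊤) x)) (hθ K _ hU)
    have e2 : a.app (j ''ᵁ ⊤) (sec (pullbackUnit g P) h x) =
        res K (j.preimage_mono h) (a.app (g ⁻¹ᵁ i ''ᵁ ⊤) ((pullbackUnit g P).app (i ''ᵁ ⊤) x)) :=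
      ConcreteCategory.congr_hom (a.mapPresheaf.naturality (homOfLE h).op) _
    refine (congrArg (res ((Scheme.Modules.pushforward (Spec.map φ)).obj K)
      (i.preimage_image_eq ⊤).ge) e1).trans
      (Eq.trans ?_ (congrArg (res K (j.preimage_image_eq ⊤).ge) e2).symm)
    exact (res_res K hU (V := Spec.map φ ⁻¹ᵁ i ⁻¹ᵁ i ''ᵁ ⊤) (W := Spec.map φ ⁻¹ᵁ ⊤)
      ((Spec.map φ).preimage_mono (i.preimage_image_eq ⊤).ge) _).trans
      (res_res K (j.preimage_mono h) _ _).symm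
  have hj : (j.appIso ⊤).hom = j.appLE (j ''ᵁ ⊤) ⊤ (j.preimage_image_eq ⊤).ge :=
    j.appIso_hom' ⊤
  have hi : (i.appIso ⊤).hom = i.appLE (i ''ᵁ ⊤) ⊤ (i.preimage_image_eq ⊤).ge :=
    i.appIso_hom' ⊤
  have huniq {K : (Spec B).Modules} (k : Γ(P, i ''ᵁ ⊤) →+ Γ(K, ⊤))
      (hk : ∀ (r : Γ(Y, i ''ᵁ ⊤)) x, k (r • x) = (j.appIso ⊤).hom (g.appLE _ _ h r) • k x) :=
    existsUnique_hom_pushforward i hP ((Scheme.Modules.pushforward (Spec.map φ)).obj K) k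
      fun r x => (hk r x).trans (by
        rw [hj, hi]
        exact congrArg (fun t => HSMul.hSMul (β := Γ(K, ⊤)) t (k x))
          (ConcreteCategory.congr_hom hring r).symm)
  refine ⟨sec_smul _ h, fun N _ _ k hk => ?_, fun N _ _ k k' hkk' => ?_⟩
  -- Existence: a semilinear map on sections of `P` gives a morphism from `P`, whose adjoint on `g^*
  -- P` has the required effect on sections.
  · obtain ⟨K, e, he⟩ := exists_module_of_sections j N
    obtain ⟨b, hb, -⟩ := huniq (e.toAddMonoidHom.comp k) fun r x =>
      (congrArg e (hk r x)).trans (he _ _)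
    let a := (adj.homEquiv P _).symm (b ≫ (θ K).inv)
    have ha : (pullbackUnit g P ≫ (Scheme.Modules.pushforward g).map a) ≫ (θ K).hom = b := by
      rw [← (Iso.eq_comp_inv (θ K))]
      exact (adj.homEquiv_unit P _ a).symm.trans ((adj.homEquiv P _).apply_symm_apply _)
    let ψ : Γ((Scheme.Modules.pullback g).obj P, j ''ᵁ ⊤) →+ N :=
      e.symm.toAddMonoidHom.comp (sec a (j.preimage_image_eq ⊤).ge)
    refine ⟨{ ψ with map_smul' := fun s x => ?_ }, fun x => ?_⟩
    · refine (e.symm_apply_eq).2 ((sec_smul a _ s x).trans (Eq.trans ?_ (he _ _).symm))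
      rw [hj]
      exact congrArg _ (e.apply_symm_apply _).symm
    · refine (e.symm_apply_eq).2 ((key K a x).symm.trans (Eq.trans ?_ (hb x)))
      rw [ha]
  -- Uniqueness: since `g^* P` is quasi-coherent, both linear maps come from morphisms `g^* P ⟶ j_*
  -- K`. Their adjoints agree on sections of `P`, hence are equal.
  · obtain ⟨K, e, he⟩ := exists_module_of_sections j N
    have hex (k : Γ((Scheme.Modules.pullback g).obj P, j ''ᵁ ⊤) →ₗ[Γ(X, j ''ᵁ ⊤)] N) :=
      (existsUnique_hom_pushforward j (qcoh_pullback g hP) K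
        (e.toAddMonoidHom.comp k.toAddMonoidHom) fun r x =>
          (congrArg e (k.map_smul r x)).trans (he _ _)).exists
    obtain ⟨a, ha⟩ := hex k
    obtain ⟨a', ha'⟩ := hex k'
    have h1 := (huniq (e.toAddMonoidHom.comp (k.toAddMonoidHom.comp (sec (pullbackUnit g P) h)))
      fun r x => by
        have := congrArg (fun t => e (k t)) (sec_smul (pullbackUnit g P) h r x)
        refine this.trans ((congrArg e (k.map_smul _ _)).trans (he _ _))).unique
      (fun x => (key K a x).trans (ha _))
      (fun x => (key K a' x).trans ((ha' _).trans (congrArg e (hkk' x).symm)))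
    have h2 : a = a' := by
      apply (adj.homEquiv P _).injective
      rw [cancel_mono] at h1
      exact (adj.homEquiv_unit P _ a).trans (h1.trans (adj.homEquiv_unit P _ a').symm)
    subst h2
    exact LinearMap.ext fun x => e.injective ((ha x).symm.trans (ha' x))

theorem exists_Spec_of_isAffineOpen {V : X.Opens} (hV : IsAffineOpen V) :
    ∃ (A : CommRingCat.{u}) (i : Spec A ⟶ X) (_ : IsOpenImmersion i), V = i ''ᵁ ⊤ :=
  ⟨_, hV.fromSpec, inferInstance, by
    rw [Scheme.Hom.image_top_eq_opensRange, hV.opensRange_fromSpec]⟩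

theorem isBC_pullback (g : X ⟶ Y) {P : Y.Modules} (hP : qcoh Y P) {V : Y.Opens} {V' : X.Opens}
    (hV : IsAffineOpen V) (hV' : IsAffineOpen V') (h : V' ≤ g ⁻¹ᵁ V) :
    IsBC (g.appLE V V' h).hom (sec (pullbackUnit g P) h) := by
  obtain ⟨A, i, hi, rfl⟩ := exists_Spec_of_isAffineOpen hV
  obtain ⟨B, j, hj, rfl⟩ := exists_Spec_of_isAffineOpen hV'
  exact isBC_pullback_aux g hP i j h

/-- A morphism of quasi-coherent modules on an affine scheme is determined by global sections. -/
noncomputable def tildeΓArrowIso {A : CommRingCat.{u}} {P Q : (Spec A).Modules} (hP : qcoh _ P)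
    (hQ : qcoh _ Q) (u : P ⟶ Q) :
    Arrow.mk ((tilde.functor A).map (moduleSpecΓFunctor.map u)) ≅ Arrow.mk u :=
  have : IsIso (tilde.adjunction.counit.app P) :=
    @Scheme.Modules.isIso_fromTildeΓ_of_isQuasicoherent A P hP
  have : IsIso (tilde.adjunction.counit.app Q) :=
    @Scheme.Modules.isIso_fromTildeΓ_of_isQuasicoherent A Q hQ
  Arrow.isoMk (asIso (tilde.adjunction.counit.app P)) (asIso (tilde.adjunction.counit.app Q))
    (tilde.adjunction.counit.naturality u).symm

theorem isIso_of_bijective_Spec {A : CommRingCat.{u}} {P Q : (Spec A).Modules} (hP : qcoh _ P)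
    (hQ : qcoh _ Q) (u : P ⟶ Q) (h : Function.Bijective (u.app ⊤)) : IsIso u := by
  have h1 : IsIso ((moduleSpecΓFunctor (R := A)).map u) :=
    (ConcreteCategory.isIso_iff_bijective _).2 h
  exact ((MorphismProperty.isomorphisms _).arrow_mk_iso_iff (tildeΓArrowIso hP hQ u)).1
    (inferInstanceAs (IsIso ((tilde.functor A).map (moduleSpecΓFunctor.map u))))

/-- Up to isomorphism `u` is the image under `tilde` of its map on global sections, and `tilde`,
being faithful, reflects epimorphisms. -/
theorem surjective_of_epi_Spec {A : CommRingCat.{u}} {P Q : (Spec A).Modules} (hP : qcoh _ P)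
    (hQ : qcoh _ Q) (u : P ⟶ Q) [hu : Epi u] : Function.Surjective (u.app ⊤) := by
  have h1 : Epi ((tilde.functor A).map (moduleSpecΓFunctor.map u)) :=
    ((MorphismProperty.epimorphisms _).arrow_mk_iso_iff (tildeΓArrowIso hP hQ u)).2 hu
  have h2 := (tilde.functor A).epi_of_epi_map h1
  exact (ModuleCat.epi_iff_surjective (moduleSpecΓFunctor.map u)).1 h2

theorem surjective_of_epi {P Q : X.Modules} (hP : qcoh X P) (hQ : qcoh X Q) (u : P ⟶ Q) [Epi u]
    {V : X.Opens} (hV : IsAffineOpen V) : Function.Surjective (u.app V) := by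
  obtain ⟨A, i, hi, rfl⟩ := exists_Spec_of_isAffineOpen hV
  exact surjective_of_epi_Spec (qcoh_restrict i hP) (qcoh_restrict i hQ)
    ((Scheme.Modules.restrictFunctor i).map u)

theorem hom_app_res {P Q : X.Modules} (u : P ⟶ Q) {U V : X.Opens} (h : V ≤ U) (x : Γ(P, U)) :
    u.app V (res P h x) = res Q h (u.app U x) :=
  ConcreteCategory.congr_hom (u.mapPresheaf.naturality (homOfLE h).op) x

theorem epi_of_surjective {P Q : X.Modules} (u : P ⟶ Q)
    (h : ∀ V : X.Opens, IsAffineOpen V → Function.Surjective (u.app V)) : Epi u := by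
  refine Preadditive.epi_of_cancel_zero _ fun {Z} k hk => Scheme.Modules.hom_ext _ _ fun U => ?_
  ext y
  refine TopCat.Sheaf.eq_of_locally_eq' ⟨Z.presheaf, Z.isSheaf⟩
    (fun V : { V : X.affineOpens // V.1 ≤ U } => V.1.1) U (fun V => homOfLE V.2)
    (fun x hx => ?_) _ _ fun V => ?_
  · obtain ⟨_, ⟨V, hV, rfl⟩, hx, hVU⟩ := X.isBasis_affineOpens.exists_subset_of_mem_open hx U.2
    exact Opens.mem_iSup.2 ⟨⟨⟨V, hV⟩, hVU⟩, hx⟩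
  · obtain ⟨x, hx⟩ := h V.1.1 V.1.2 (res Q V.2 y)
    refine (hom_app_res k V.2 y).symm.trans ((congrArg (k.app _) hx).symm.trans ?_)
    exact (congrArg (fun t => t.app V.1.1 x) hk).trans (map_zero (res Z V.2)).symm

/-- Morphisms of quasi-coherent modules which are bijective on sections over the members of an affine
cover are isomorphisms. -/
theorem isIso_of_bijective_affine {P Q : X.Modules} (hP : qcoh X P) (hQ : qcoh X Q) (u : P ⟶ Q)
    (h : ∀ x : X, ∃ V : X.Opens, x ∈ V ∧ IsAffineOpen V ∧ Function.Bijective (u.app V)) :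
    IsIso u := by
  choose V hxV hV hb using h
  have hb' (x) (U : X.Opens) (hU : U ≤ V x) : Function.Bijective (u.app U) := by
    obtain ⟨A, i, hi, e⟩ := exists_Spec_of_isAffineOpen (hV x)
    have h1 : Function.Bijective (u.app (i ''ᵁ ⊤)) := e ▸ hb x
    have h2 : IsIso ((Scheme.Modules.restrictFunctor i).map u) :=
      isIso_of_bijective_Spec (qcoh_restrict i hP) (qcoh_restrict i hQ) _ h1
    have h3 : i ''ᵁ i ⁻¹ᵁ U = U := by
      rw [Scheme.Hom.image_preimage_eq_opensRange_inf, ← Scheme.Hom.image_top_eq_opensRange, ← e]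
      exact inf_eq_right.2 hU
    have h4 : Function.Bijective (u.app (i ''ᵁ i ⁻¹ᵁ U)) :=
      (ConcreteCategory.isIso_iff_bijective _).1
        (inferInstanceAs (IsIso (((Scheme.Modules.restrictFunctor i).map u).app (i ⁻¹ᵁ U))))
    exact h3 ▸ h4
  rw [Scheme.Modules.Hom.isIso_iff_isIso_app]
  intro U
  refine (ConcreteCategory.isIso_iff_bijective _).2 ?_
  have hcov : U ≤ ⨆ x, U ⊓ V x := fun x hx => Opens.mem_iSup.2 ⟨x, hx, hxV x⟩
  -- Injectivity on every open has to come first: it is what makes the local preimages agree on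
  -- overlaps, so that they glue.
  have hinj (U : X.Opens) : Function.Injective (u.app U) := fun a b hab =>
    TopCat.Sheaf.eq_of_locally_eq' ⟨P.presheaf, P.isSheaf⟩ (fun x => U ⊓ V x) U
      (fun x => homOfLE inf_le_left) (fun x hx => Opens.mem_iSup.2 ⟨x, hx, hxV x⟩) _ _ fun x =>
        (hb' x _ inf_le_right).1 ((hom_app_res u inf_le_left a).trans
          ((congrArg (res Q _) hab).trans (hom_app_res u inf_le_left b).symm))
  refine ⟨hinj U, fun y => ?_⟩
  choose a ha using fun x => (hb' x (U ⊓ V x) inf_le_right).2 (res Q inf_le_left y)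
  obtain ⟨z, hz, -⟩ := TopCat.Sheaf.existsUnique_gluing' ⟨P.presheaf, P.isSheaf⟩
    (fun x => U ⊓ V x) U (fun x => homOfLE inf_le_left) hcov a fun x x' => by
      change res P inf_le_left (a x) = res P inf_le_right (a x')
      apply hinj
      rw [hom_app_res, hom_app_res, ha, ha, res_res, res_res]
  refine ⟨z, TopCat.Sheaf.eq_of_locally_eq' ⟨Q.presheaf, Q.isSheaf⟩ (fun x => U ⊓ V x) U
      (fun x => homOfLE inf_le_left) hcov _ _ fun x => ?_⟩
  exact (hom_app_res u inf_le_left z).symm.trans ((congrArg (u.app _) (hz x)).trans (ha x))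

/-- If a map `P ⟶ g_* Q` is given by base change on sections over an affine cover, then it induces an
isomorphism `g^* P ≅ Q`. -/
theorem isIso_of_isBC (g : X ⟶ Y) {P : Y.Modules} {Q : X.Modules} (hP : qcoh Y P) (hQ : qcoh X Q)
    (u : (Scheme.Modules.pullback g).obj P ⟶ Q)
    (h : ∀ x : X, ∃ (V : Y.Opens) (V' : X.Opens) (i : V' ≤ g ⁻¹ᵁ V), x ∈ V' ∧ IsAffineOpen V ∧
      IsAffineOpen V' ∧ IsBC (g.appLE V V' i).hom
        (sec (pullbackUnit g P ≫ (Scheme.Modules.pushforward g).map u) i)) :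
    IsIso u := by
  refine isIso_of_bijective_affine (qcoh_pullback g hP) hQ u fun x => ?_
  obtain ⟨V, V', i, hx, hV, hV', h⟩ := h x
  -- On sections over `V'`, the source and the target of `u` are base changes of the same module and
  -- `u` is compatible with the universal maps, so it is bijective there.
  exact ⟨V', hx, hV', (isBC_pullback g hP hV hV' i).bijective h (u.app V').hom
    (u.app_smul) fun x => (sec_comp_map _ _ _ x).symm⟩

end Sections

/-! ### Direct images under affine morphisms in cartesian squares -/

section
variable {U U' T T' : Scheme.{u}} {γ : U' ⟶ U} {h' : U' ⟶ T'} {h : U ⟶ T} {g : T' ⟶ T}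

/-- Base change along a cartesian square for the direct image under an affine morphism. -/
theorem isBC_of_isPullback (sq : IsPullback γ h' h g) [IsAffineHom h] {E : U.Modules}
    (hE : qcoh U E) {V : T.Opens} {V' : T'.Opens} (hV : IsAffineOpen V) (hV' : IsAffineOpen V')
    (i : V' ≤ g ⁻¹ᵁ V) (i' : h' ⁻¹ᵁ V' ≤ γ ⁻¹ᵁ h ⁻¹ᵁ V) :
    IsBC (M := Γ((Scheme.Modules.pushforward h).obj E, V))
      (M' := Γ((Scheme.Modules.pushforward h').obj ((Scheme.Modules.pullback γ).obj E), V'))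
      (g.appLE V V' i).hom (sec (pullbackUnit γ E) i') := by
  have : IsAffineHom h' := MorphismProperty.of_isPullback sq inferInstance
  have hUY : h' ⁻¹ᵁ V' = γ ⁻¹ᵁ h ⁻¹ᵁ V ⊓ h' ⁻¹ᵁ V' := (inf_eq_right.2 i').symm
  -- As `h` is affine, all opens involved are affine, and the functions on `h'⁻¹ V'` form the
  -- pushout (tensor product) of the functions on `h⁻¹ V` and `V'` over those on `V`.
  have hp := (isIso_pushoutSection_iff sq i le_rfl hUY).1
    (isIso_pushoutSection_of_isAffineOpen sq i le_rfl hUY hV hV' (hV.preimage h))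
  rw [Scheme.Hom.appLE_eq_app, Scheme.Hom.appLE_eq_app] at hp
  -- Sections of a direct image are by definition sections over the preimage, so the larger ring
  -- acts on them as well. Its action restricts to that of functions on `V`, which is what
  -- `IsBC.of_isPushout` asks for.
  let : Module Γ(U, h ⁻¹ᵁ V) Γ((Scheme.Modules.pushforward h).obj E, V) :=
    (inferInstance : Module Γ(U, h ⁻¹ᵁ V) Γ(E, h ⁻¹ᵁ V))
  let : Module Γ(U', h' ⁻¹ᵁ V')
      Γ((Scheme.Modules.pushforward h').obj ((Scheme.Modules.pullback γ).obj E), V') :=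
    (inferInstance : Module Γ(U', h' ⁻¹ᵁ V') Γ((Scheme.Modules.pullback γ).obj E, h' ⁻¹ᵁ V'))
  exact IsBC.of_isPushout hp (isBC_pullback γ hE (hV.preimage h) (hV'.preimage h') i')
    (fun _ _ => rfl) fun _ _ => rfl

end

/-! ### Underived base change for Frobenius modules -/

namespace Frob
variable (p : ℕ) [hp : Fact p.Prime]

section
variable {X Y : Scheme.{u}} [IsFpScheme p X] [IsGeometric X] [IsFpScheme p Y] [IsGeometric Y]

/-- The adjunction for Frobenius modules is built on the one for all modules, and the
identifications in between are identities. From here on, statements about units concern the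
underlying modules only. -/
theorem adjunction_unit_hom (g : X ⟶ Y) (P : Frob p Y) :
    ((adjunction p g).unit.app P).f.hom = pullbackUnit g P.V.obj := by
  refine ((Scheme.Modules.pullbackPushforwardAdjunction g).map_restrictFullyFaithful_unit_app
    (qcoh Y).fullyFaithfulι (qcoh X).fullyFaithfulι (L := QCoh.pullback g)
    (R := QCoh.pushforward g) (Iso.refl _) (Iso.refl _) P.V).trans ?_
  refine (congrArg (pullbackUnit g P.V.obj ≫ ·) (Eq.trans (Category.comp_id _) ?_)).trans
    (Category.comp_id _)
  exact (Scheme.Modules.pushforward g).map_id _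

variable {p} in
theorem isIso_of_isIso_hom {M N : Frob p X} (u : M ⟶ N) (hu : IsIso u.f.hom) : IsIso u := by
  have : IsIso ((qcoh X).ι.map u.f) := hu
  have : IsIso u.f := isIso_of_fully_faithful (qcoh X).ι u.f
  exact Endofunctor.Coalgebra.iso_of_iso u

/-- The criterion is phrased through the adjoint map `P ⟶ g_* Q`, because that is how base change
maps are defined and its effect on sections is explicit. -/
theorem isIso_homEquiv_symm (g : X ⟶ Y) {P : Frob p Y} {Q : Frob p X}
    (ψ : P ⟶ (pushforward p g).obj Q)
    (H : ∀ (V : Y.Opens) (V' : X.Opens) (_ : IsAffineOpen V) (_ : IsAffineOpen V')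
      (i : V' ≤ g ⁻¹ᵁ V), IsBC (g.appLE V V' i).hom
        (sec (g := g) (P := P.V.obj) (Q := Q.V.obj) ψ.f.hom i)) :
    IsIso (((adjunction p g).homEquiv P Q).symm ψ) := by
  obtain ⟨u, rfl⟩ := ((adjunction p g).homEquiv P Q).surjective ψ
  rw [Equiv.symm_apply_apply]
  have hu : (((adjunction p g).homEquiv P Q) u).f.hom =
      pullbackUnit g P.V.obj ≫ (Scheme.Modules.pushforward g).map u.f.hom := by
    rw [Adjunction.homEquiv_unit, ← adjunction_unit_hom]
    rfl
  refine isIso_of_isIso_hom u (isIso_of_isBC g P.V.property Q.V.property u.f.hom fun x => ?_)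
  obtain ⟨_, ⟨V, hV, rfl⟩, hx, -⟩ :=
    Y.isBasis_affineOpens.exists_subset_of_mem_open (Set.mem_univ (g x)) isOpen_univ
  obtain ⟨_, ⟨V', hV', rfl⟩, hx', hVV⟩ :=
    X.isBasis_affineOpens.exists_subset_of_mem_open (show x ∈ g ⁻¹ᵁ V from hx) (g ⁻¹ᵁ V).2
  have := H V V' hV hV' hVV
  rw [hu] at this
  exact ⟨V, V', hVV, hx', hV, hV', this⟩

end

section
variable {U U' T T' : Scheme.{u}} [IsFpScheme p U] [IsGeometric U] [IsFpScheme p U']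
  [IsGeometric U'] [IsFpScheme p T] [IsGeometric T] [IsFpScheme p T'] [IsGeometric T']
  {γ : U' ⟶ U} {h' : U' ⟶ T'} {h : U ⟶ T} {g : T' ⟶ T}

/-- On sections, `pushforwardSq` is restriction between two preimages that coincide because the
square commutes. It therefore disappears into the further restriction to the preimage of `V'`. -/
theorem sec_map_sq (e : γ ≫ h = h' ≫ g) {E : Frob p U} {Q : Frob p U'}
    (ψ : E ⟶ (pushforward p γ).obj Q) {V : T.Opens} {V' : T'.Opens}
    (i : V' ≤ g ⁻¹ᵁ V) (i' : h' ⁻¹ᵁ V' ≤ γ ⁻¹ᵁ h ⁻¹ᵁ V)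
    (x : Γ((Scheme.Modules.pushforward h).obj E.V.obj, V)) :
    sec (g := g) (P := ((pushforward p h).obj E).V.obj) (Q := ((pushforward p h').obj Q).V.obj)
      ((pushforward p h).map ψ ≫ (pushforwardSq p e).hom.app Q).f.hom i x =
      sec (g := γ) (P := E.V.obj) (Q := Q.V.obj) ψ.f.hom i' x := by
  have hle : h' ⁻¹ᵁ g ⁻¹ᵁ V ≤ γ ⁻¹ᵁ h ⁻¹ᵁ V :=
    (congrArg (fun q : U' ⟶ T => q ⁻¹ᵁ V) e.symm).le
  have e1 : ((QCoh.pushforwardSq e).hom.app Q.V).hom.app V =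
      Q.V.obj.presheaf.map (homOfLE hle).op := QCoh.pushforwardSq_app e _ V hle
  have e3 := congrArg (fun t => t.hom x) (congrArg (ψ.f.hom.app (h ⁻¹ᵁ V) ≫ ·) e1)
  refine (congrArg (res Q.V.obj (h'.preimage_mono i)) e3).trans ?_
  exact res_res Q.V.obj hle (h'.preimage_mono i) _

theorem sec_unit_sq (e : γ ≫ h = h' ≫ g) (E : Frob p U) {V : T.Opens} {V' : T'.Opens}
    (i : V' ≤ g ⁻¹ᵁ V) (i' : h' ⁻¹ᵁ V' ≤ γ ⁻¹ᵁ h ⁻¹ᵁ V)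
    (x : Γ((Scheme.Modules.pushforward h).obj E.V.obj, V)) :
    sec (g := g) (P := ((pushforward p h).obj E).V.obj)
      (Q := ((pushforward p h').obj ((pullback p γ).obj E)).V.obj)
      ((pushforward p h).map ((adjunction p γ).unit.app E) ≫
        (pushforwardSq p e).hom.app ((pullback p γ).obj E)).f.hom i x =
      sec (pullbackUnit γ E.V.obj) i' x := by
  refine (sec_map_sq p e ((adjunction p γ).unit.app E) i i' x).trans ?_
  rw [adjunction_unit_hom]
  rfl

/-- The map adjoint to base change is, on sections over affine opens, the unit for `γ`, and
`isBC_of_isPullback` says that this is a base change of modules. No flatness is needed. -/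
theorem isIso_baseChange_of_isAffineHom (sq : IsPullback γ h' h g) [IsAffineHom h]
    (E : Frob p U) : IsIso ((baseChange (adjunction p γ) (adjunction p g)
      (pushforwardSq p sq.w).hom).app E) := by
  rw [baseChange_app]
  refine isIso_homEquiv_symm p g _ fun V V' hV hV' i => ?_
  have i' : h' ⁻¹ᵁ V' ≤ γ ⁻¹ᵁ h ⁻¹ᵁ V := (h'.preimage_mono i).trans
    (congrArg (fun q : U' ⟶ T => q ⁻¹ᵁ V) sq.w.symm).le
  have key := isBC_of_isPullback sq E.V.property hV hV' i i'
  refine (congrArg (IsBC (M := Γ((Scheme.Modules.pushforward h).obj E.V.obj, V))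
    (M' := Γ((Scheme.Modules.pushforward h').obj ((Scheme.Modules.pullback γ).obj E.V.obj), V'))
    (g.appLE V V' i).hom) (AddMonoidHom.ext fun x => ?_)).mp key
  exact (sec_unit_sq p sq.w E i i' x).symm

end

section
variable {U U' X X' S S' : Scheme.{u}} [IsFpScheme p U] [IsGeometric U] [IsFpScheme p U']
  [IsGeometric U'] [IsFpScheme p X] [IsGeometric X] [IsFpScheme p X'] [IsGeometric X']
  [IsFpScheme p S] [IsGeometric S] [IsFpScheme p S'] [IsGeometric S']
  {γ : U' ⟶ U} {π' : U' ⟶ X'} {π : U ⟶ X} {g' : X' ⟶ X} {f' : X' ⟶ S'} {f : X ⟶ S} {g : S' ⟶ S}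

theorem sec_map_unit_sq (e₁ : γ ≫ π = π' ≫ g') (e₂ : g' ≫ f = f' ≫ g) (E : Frob p U)
    {V : S.Opens} {V' : S'.Opens} (i : V' ≤ g ⁻¹ᵁ V) (i' : f' ⁻¹ᵁ V' ≤ g' ⁻¹ᵁ f ⁻¹ᵁ V)
    (i'' : π' ⁻¹ᵁ f' ⁻¹ᵁ V' ≤ γ ⁻¹ᵁ π ⁻¹ᵁ f ⁻¹ᵁ V)
    (x : Γ((Scheme.Modules.pushforward (π ≫ f)).obj E.V.obj, V)) :
    sec (g := g) (P := ((pushforward p f).obj ((pushforward p π).obj E)).V.obj)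
      (Q := ((pushforward p f').obj ((pushforward p π').obj ((pullback p γ).obj E))).V.obj)
      ((pushforward p f).map ((pushforward p π).map ((adjunction p γ).unit.app E) ≫
        (pushforwardSq p e₁).hom.app ((pullback p γ).obj E)) ≫ (pushforwardSq p e₂).hom.app
          ((pushforward p π').obj ((pullback p γ).obj E))).f.hom i x =
      sec (pullbackUnit γ E.V.obj) i'' x :=
  (sec_map_sq p e₂ (E := (pushforward p π).obj E)
    (Q := (pushforward p π').obj ((pullback p γ).obj E)) _ i i' x).trans
    (sec_unit_sq p e₁ E i' i'' x)

/-- This is affine base change for the pasted square. Sections of `f_* π_* E` and of `(π ≫ f)_* E`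
are the same by definition, so the successive direct images can stay as they are. -/
theorem isIso_homEquiv_symm_of_isPullback (sq₁ : IsPullback γ π' π g')
    (sq₂ : IsPullback g' f' f g) [IsAffineHom (π ≫ f)] (E : Frob p U) :
    IsIso (((adjunction p g).homEquiv ((pushforward p f).obj ((pushforward p π).obj E))
      ((pushforward p f').obj ((pushforward p π').obj ((pullback p γ).obj E)))).symm
      ((pushforward p f).map ((pushforward p π).map ((adjunction p γ).unit.app E) ≫
        (pushforwardSq p sq₁.w).hom.app ((pullback p γ).obj E)) ≫ (pushforwardSq p sq₂.w).hom.app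
          ((pushforward p π').obj ((pullback p γ).obj E)))) := by
  refine isIso_homEquiv_symm p g _ fun V V' hV hV' i => ?_
  have i' : f' ⁻¹ᵁ V' ≤ g' ⁻¹ᵁ f ⁻¹ᵁ V := (f'.preimage_mono i).trans
    (congrArg (fun q : X' ⟶ S => q ⁻¹ᵁ V) sq₂.w.symm).le
  have i'' : π' ⁻¹ᵁ f' ⁻¹ᵁ V' ≤ γ ⁻¹ᵁ π ⁻¹ᵁ f ⁻¹ᵁ V := (π'.preimage_mono i').trans
    (congrArg (fun q : U' ⟶ X => q ⁻¹ᵁ f ⁻¹ᵁ V) sq₁.w.symm).le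
  have key := isBC_of_isPullback (sq₁.paste_vert sq₂) E.V.property hV hV' i i''
  refine (congrArg (IsBC (M := Γ((Scheme.Modules.pushforward (π ≫ f)).obj E.V.obj, V))
    (M' := Γ((Scheme.Modules.pushforward (π' ≫ f')).obj
      ((Scheme.Modules.pullback γ).obj E.V.obj), V'))
    (g.appLE V V' i).hom) (AddMonoidHom.ext fun x => ?_)).mp key
  exact (sec_map_unit_sq p sq₁.w sq₂.w E i i' i'' x).symm

/-- Base change maps paste: following the map for `f` at `π_* E` by `f'_*` of the map for `π` gives
the base change map of the outer square. Both the second factor and the composite come from affine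
morphisms, so the first factor is an isomorphism although `f` need not be affine. -/
theorem isIso_baseChange_pushforward (sq₁ : IsPullback γ π' π g') (sq₂ : IsPullback g' f' f g)
    [IsAffineHom π] [IsAffineHom (π ≫ f)] (E : Frob p U) :
    IsIso ((baseChange (adjunction p g') (adjunction p g) (pushforwardSq p sq₂.w).hom).app
      ((pushforward p π).obj E)) := by
  let β := (baseChange (adjunction p γ) (adjunction p g') (pushforwardSq p sq₁.w).hom).app E
  have hβ : IsIso β := isIso_baseChange_of_isAffineHom p sq₁ E
  suffices h : IsIso ((baseChange (adjunction p g') (adjunction p g)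
      (pushforwardSq p sq₂.w).hom).app ((pushforward p π).obj E) ≫ (pushforward p f').map β) from
    IsIso.of_isIso_comp_right _ ((pushforward p f').map β)
  have hψ : ((pushforward p f).map ((adjunction p g').unit.app ((pushforward p π).obj E)) ≫
      (pushforwardSq p sq₂.w).hom.app _) ≫ (pushforward p g).map ((pushforward p f').map β) =
      (pushforward p f).map ((pushforward p π).map ((adjunction p γ).unit.app E) ≫
        (pushforwardSq p sq₁.w).hom.app _) ≫ (pushforwardSq p sq₂.w).hom.app _ := by
    have e1 := unit_baseChange (adjunction p γ) (adjunction p g') (pushforwardSq p sq₁.w).hom E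
    have e2 := (pushforwardSq p sq₂.w).hom.naturality β
    rw [← e1, Functor.map_comp, Category.assoc, Category.assoc]
    exact congrArg (_ ≫ ·) e2.symm
  rw [baseChange_app, ← Adjunction.homEquiv_naturality_right_symm, hψ]
  exact isIso_homEquiv_symm_of_isPullback p sq₁ sq₂ E

end

end Frob

/-! ### Exactness of affine direct images and affine atlases of geometric schemes -/

theorem QCoh.pushforward_preservesEpi {X Y : Scheme.{u}} (h : X ⟶ Y) [IsAffineHom h] :
    (QCoh.pushforward h).PreservesEpimorphisms where
  preserves {M N} u hu := by
    -- An epimorphism of quasi-coherent modules is one of all modules, because the cokernel taken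
    -- among all modules is again quasi-coherent.
    have hu' : Epi u.hom := by
      refine Preadditive.epi_of_cokernel_zero ?_
      let c : N ⟶ ⟨cokernel u.hom, qcoh_cokernel u.hom M.property N.property⟩ :=
        ObjectProperty.homMk (cokernel.π u.hom)
      have hc : c = 0 := by
        rw [← cancel_epi u, comp_zero]
        exact (qcoh X).hom_ext (cokernel.condition u.hom)
      exact congrArg (fun t => t.hom) hc
    have : Epi ((qcoh Y).ι.map ((QCoh.pushforward h).map u)) :=
      epi_of_surjective ((Scheme.Modules.pushforward h).map u.hom) fun V hV =>
        surjective_of_epi M.property N.property u.hom (hV.preimage h)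
    exact (qcoh Y).ι.epi_of_epi_map this

/-- A morphism which has a section over the members of an affine cover of the target. -/
def HasLocalSections {U X : Scheme.{u}} (π : U ⟶ X) : Prop :=
  ∃ 𝒰 : Scheme.AffineOpenCover.{u} X, ∀ i, ∃ s : Spec (𝒰.X i) ⟶ U, s ≫ π = 𝒰.f i

theorem HasLocalSections.of_isPullback {U U' X X' : Scheme.{u}} {γ : U' ⟶ U} {π' : U' ⟶ X'}
    {π : U ⟶ X} {g : X' ⟶ X} (sq : IsPullback γ π' π g) (h : HasLocalSections π) :
    HasLocalSections π' := by
  obtain ⟨𝒰, h𝒰⟩ := h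
  refine ⟨Scheme.OpenCover.affineRefinement (𝒰.openCover.pullback₁ g), fun ⟨a, b⟩ => ?_⟩
  obtain ⟨s, hs⟩ := h𝒰 a
  let t := (pullback g (𝒰.f a)).affineCover.f b
  refine ⟨sq.lift (t ≫ pullback.snd _ _ ≫ s) (t ≫ pullback.fst _ _) ?_, sq.lift_snd _ _ _⟩
  refine (Category.assoc _ _ _).trans ((congrArg (t ≫ ·) ((Category.assoc _ _ _).trans
    ((congrArg (pullback.snd g (𝒰.f a) ≫ ·) hs).trans pullback.condition.symm))).trans
    (Category.assoc _ _ _).symm)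

/-- A local section `s` of `π` factors restriction to a member of the cover as `s^* π^*`, so a map
killed by `π^*` vanishes locally. -/
theorem HasLocalSections.hom_zero {U X : Scheme.{u}} {π : U ⟶ X} (h : HasLocalSections π)
    {M N : X.Modules} (u : M ⟶ N) (hu : (Scheme.Modules.pullback π).map u = 0) : u = 0 := by
  obtain ⟨𝒰, h𝒰⟩ := h
  refine hom_zero_of_restrict 𝒰 u fun i => ?_
  obtain ⟨s, hs⟩ := h𝒰 i
  let e : Scheme.Modules.restrictFunctor (𝒰.f i) ≅
      Scheme.Modules.pullback π ⋙ Scheme.Modules.pullback s :=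
    Scheme.Modules.restrictFunctorIsoPullback (𝒰.f i) ≪≫ Scheme.Modules.pullbackCongr hs.symm ≪≫
      (Scheme.Modules.pullbackComp s π).symm
  rw [← cancel_mono (e.hom.app _), e.hom.naturality, zero_comp, Functor.comp_map, hu,
    Functor.map_zero, comp_zero]

theorem isStableUnderBaseChange_affineDiagonal :
    (MorphismProperty.diagonal (@IsAffineHom.{u})).IsStableUnderBaseChange :=
  have : MorphismProperty.RespectsIso @IsAffineHom.{u} :=
    MorphismProperty.IsStableUnderBaseChange.respectsIso
  MorphismProperty.IsStableUnderBaseChange.diagonal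

theorem isStableUnderComposition_affineDiagonal :
    (MorphismProperty.diagonal (@IsAffineHom.{u})).IsStableUnderComposition :=
  have : MorphismProperty.RespectsIso @IsAffineHom.{u} :=
    MorphismProperty.IsStableUnderBaseChange.respectsIso
  have : MorphismProperty.IsMultiplicative @IsAffineHom.{u} := inferInstance
  have : MorphismProperty.IsStableUnderComposition @IsAffineHom.{u} :=
    this.toIsStableUnderComposition
  MorphismProperty.diagonal_isStableUnderComposition

/-- The composite of `π` with the morphism from `X` to the terminal scheme is affine, and the affine
diagonal of `X` allows the second factor to be cancelled. -/
theorem isAffineHom_of_isAffine_of_isGeometric {U X : Scheme.{u}} [IsAffine U] [hX : IsGeometric X]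
    (π : U ⟶ X) : IsAffineHom π := by
  have : IsAffineHom (π ≫ terminal.from X) := inferInstance
  have h1 : MorphismProperty.diagonal @IsAffineHom (terminal.from X) := hX.affine_diagonal
  have := isStableUnderBaseChange_affineDiagonal.{u}
  have : MorphismProperty.HasOfPostcompProperty @IsAffineHom.{u}
      (MorphismProperty.diagonal @IsAffineHom) :=
    MorphismProperty.hasOfPostcompProperty_iff_le_diagonal.mpr le_rfl
  exact MorphismProperty.of_postcomp @IsAffineHom.{u} π (terminal.from X) h1 ‹_›

/-- Having affine diagonal is stable under composition, and an affine `π` has it. This is needed for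
the fibre product `U'`, which need not be affine. -/
theorem IsGeometric.of_isAffineHom {U X : Scheme.{u}} [hX : IsGeometric X] (π : U ⟶ X)
    [IsAffineHom π] : IsGeometric U where
  compactSpace := QuasiCompact.compactSpace_of_compactSpace π
  affine_diagonal := by
    have h1 : MorphismProperty.diagonal @IsAffineHom π := by
      have : IsAffineHom (pullback.diagonal π) := inferInstance
      exact this
    have h2 : MorphismProperty.diagonal @IsAffineHom (terminal.from X) := hX.affine_diagonal
    have h3 := isStableUnderComposition_affineDiagonal.comp_mem _ _ h1 h2
    rwa [terminal.comp_from] at h3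

/-- A quasi-compact scheme receives a flat morphism from an affine scheme with local sections. -/
theorem exists_flat_hasLocalSections (X : Scheme.{u}) [CompactSpace X] :
    ∃ (R : CommRingCat.{u}) (π : Spec R ⟶ X), Flat π ∧ HasLocalSections π := by
  obtain ⟨𝒰, hf⟩ := exists_finite_affineOpenCover X
  -- Finiteness of the cover makes the coproduct affine; its inclusions provide the local sections.
  let U := ∐ fun i => Spec (𝒰.X i)
  have (i : 𝒰.I₀) : IsOpenImmersion (𝒰.f i) := 𝒰.map_prop i
  have hflat : Flat (Sigma.desc 𝒰.f) := inferInstance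
  refine ⟨_, U.isoSpec.inv ≫ Sigma.desc 𝒰.f, inferInstance, 𝒰, fun i =>
    ⟨Sigma.ι (fun i => Spec (𝒰.X i)) i ≫ U.isoSpec.hom, ?_⟩⟩
  rw [Category.assoc, Iso.hom_inv_id_assoc, Sigma.ι_desc]

/-! ### Split units of injective Frobenius modules and exactness of direct images -/

namespace Frob
variable (p : ℕ) [hp : Fact p.Prime] {X Y : Scheme.{u}} [IsFpScheme p X] [IsGeometric X]
  [IsFpScheme p Y] [IsGeometric Y]

/-- If `k` composed with the unit vanishes, then by adjunction `π^* k` vanishes, and local sections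
detect this. -/
theorem unit_mono {π : Y ⟶ X} (h : HasLocalSections π) (M : Frob p X) :
    Mono ((adjunction p π).unit.app M) := by
  refine Preadditive.mono_of_cancel_zero _ fun {T} k hk => ?_
  have h1 : (pullback p π).map k = 0 := by
    apply ((adjunction p π).homEquiv _ _).injective
    rw [Adjunction.homEquiv_unit, Adjunction.homEquiv_unit, Functor.map_zero, comp_zero, ← hk]
    exact ((adjunction p π).unit.naturality k).symm
  refine Endofunctor.Coalgebra.ext ((qcoh X).hom_ext (h.hom_zero _ ?_))
  exact congrArg (fun w => w.f.hom) h1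

theorem unitSplit_of_injective {π : Y ⟶ X} (h : HasLocalSections π) (I : Frob p X) [Injective I] :
    unitSplit (adjunction p π) I := by
  have := unit_mono p h I
  exact ⟨⟨⟨Injective.factorThru (𝟙 I) ((adjunction p π).unit.app I),
    Injective.comp_factorThru _ _⟩⟩⟩

instance (f : X ⟶ Y) : PreservesFiniteLimits (pushforward p f) :=
  have := (adjunction p f).rightAdjoint_preservesLimits
  PreservesLimits.preservesFiniteLimits _

theorem pushforward_preservesFiniteColimits (f : X ⟶ Y) [IsAffineHom f] :
    PreservesFiniteColimits (pushforward p f) := by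
  rw [Functor.preservesFiniteColimits_iff_forall_exact_map_and_epi]
  intro S hS
  have := hS.mono_f
  have := hS.epi_g
  refine ⟨hS.exact.map_of_mono_of_preservesKernel (pushforward p f) inferInstance inferInstance, ?_⟩
  have := Coalg.epi_f S.g
  have := QCoh.pushforward_preservesEpi f
  have h : Epi ((QCoh.pushforward f).map S.g.f) := inferInstance
  exact Endofunctor.Coalgebra.epi_of_epi (h := h) ((pushforward p f).map S.g)

/-- Exactness is transported from the direct image under the affine composite `f ≫ g`. The extra
direct image along the identity is there to present `f_*` followed by `g_*` as one side of a
commutative square, the form in which `pushforwardSq` compares direct images. -/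
theorem comp_pushforward_preservesFiniteColimits {Z : Scheme.{u}} [IsFpScheme p Z] [IsGeometric Z]
    (f : X ⟶ Y) (g : Y ⟶ Z) [IsAffineHom (f ≫ g)] :
    PreservesFiniteColimits (pushforward p f ⋙ pushforward p g) := by
  have := pushforward_preservesFiniteColimits p (f ≫ g)
  have := pushforward_preservesFiniteColimits p (𝟙 Z)
  exact preservesFiniteColimits_of_natIso
    (pushforwardSq p (show (f ≫ g) ≫ 𝟙 Z = f ≫ g from Category.comp_id _))

end Frob

theorem isIso_app_of_retract {A B : Type*} [Category* A] [Category* B] {F G : A ⥤ B} (τ : F ⟶ G)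
    {N N' : A} (r : Retract N N') [IsIso (τ.app N')] : IsIso (τ.app N) := by
  have h1 : F.map r.i ≫ F.map r.r = 𝟙 _ := by rw [← F.map_comp, r.retract, F.map_id]
  have h2 : G.map r.i ≫ G.map r.r = 𝟙 _ := by rw [← G.map_comp, r.retract, G.map_id]
  refine ⟨G.map r.i ≫ inv (τ.app N') ≫ F.map r.r, ?_, ?_⟩
  · rw [← τ.naturality_assoc, IsIso.hom_inv_id_assoc, h1]
  · rw [Category.assoc, Category.assoc, τ.naturality, IsIso.inv_hom_id_assoc, h2]

theorem unitSplit_of_iso {A E : Type*} [Category* A] [Category* E] [Abelian A] [Abelian E] {G : A ⥤ E} {P : E ⥤ A}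
    (adj : G ⊣ P) {N N' : A} (e : N ≅ N') (h : unitSplit adj N') : unitSplit adj N :=
  unitSplit_of_retract adj ⟨e.hom, e.inv, e.hom_inv_id⟩ h

/-! ### Flat base change -/

namespace Frob
variable (p : ℕ) [hp : Fact p.Prime] {X' X S' S : Scheme.{u}}
  [IsFpScheme p X'] [IsFpScheme p X] [IsFpScheme p S'] [IsFpScheme p S]
  [IsGeometric X'] [IsGeometric X] [IsGeometric S'] [IsGeometric S]
  [HasDerivedCategory (Frob p X')] [HasDerivedCategory (Frob p X)]
  [HasDerivedCategory (Frob p S')] [HasDerivedCategory (Frob p S)]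
  {g' : X' ⟶ X} {f' : X' ⟶ S'} {f : X ⟶ S} {g : S' ⟶ S}

/-- Flat base change for the derived direct image of Frobenius modules. -/
theorem isIso_baseChangeMap (sq : IsPullback g' f' f g) [Flat g] [Flat g']
    (M : DerivedCategory.Plus (Frob p X)) : IsIso (Frob.baseChangeMap p sq.w M) := by
  obtain ⟨R, π, hflat, hπ⟩ := exists_flat_hasLocalSections X
  let U := Spec R
  let U' := Limits.pullback π g'
  let γ : U' ⟶ U := pullback.fst π g'
  let π' : U' ⟶ X' := pullback.snd π g'
  have sq₁ : IsPullback γ π' π g' := IsPullback.of_hasPullback π g'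
  have hπ' : HasLocalSections π' := hπ.of_isPullback sq₁
  have : IsAffineHom π := isAffineHom_of_isAffine_of_isGeometric π
  -- This uses the affine diagonal of `S`, whereas the affineness of `π` uses that of `X`.
  have : IsAffineHom (π ≫ f) := isAffineHom_of_isAffine_of_isGeometric (π ≫ f)
  have : IsAffineHom π' := MorphismProperty.of_isPullback sq₁ inferInstance
  have : IsAffineHom (π' ≫ f') := MorphismProperty.of_isPullback (sq₁.paste_vert sq) inferInstance
  have : Flat π' := MorphismProperty.of_isPullback sq₁ inferInstance
  have : IsFpScheme p U := .of_hom p π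
  have : IsFpScheme p U' := .of_hom p π'
  have : IsGeometric U' := .of_isAffineHom π'
  -- The splitting of the unit replaces an injective by a direct image from the affine scheme `U`.
  have hretract (I : Frob p X) (_ : Injective I) :
      Nonempty (Retract I ((pushforward p π).obj ((pullback p π).obj I))) := by
    have h := unitSplit_of_injective p hπ I
    obtain ⟨⟨s⟩⟩ := h
    exact ⟨⟨(adjunction p π).unit.app I, s.retraction, s.id⟩⟩
  have := pushforward_preservesFiniteColimits p π'
  have := comp_pushforward_preservesFiniteColimits p π' f'
  -- By definition `Frob.baseChangeMap` is the component at `M` of `baseChange` for the derived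
  -- adjunctions. What remains is base change on injectives and the acyclicity of their inverse
  -- images.
  refine Derived.isIso_derived_baseChange (adjunction p g') (adjunction p g) (pushforwardSq p sq.w)
    (fun I hI => ?_) (fun K hK => ?_) M
  · obtain ⟨r⟩ := hretract I hI
    have := isIso_baseChange_pushforward p sq₁ sq ((pullback p π).obj I)
    exact isIso_app_of_retract _ r
  · refine isIso_rightDerivedFunctorPlusUnit_of_unitSplit (adjunction p π') (pushforward p f')
      (fun I hI => unitSplit_of_injective p hπ' I) _ fun n => ?_
    obtain ⟨r⟩ := hretract _ (hK n)
    -- Applying `g'^*` to the retraction, and affine base change to `π`, exhibits each term of `g'^*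
    -- K` as a retract of a direct image under `π'`, whose unit splits.
    refine unitSplit_of_retract _ (r.map (pullback p g')) ?_
    have := isIso_baseChange_of_isAffineHom p sq₁ ((pullback p π).obj (K.obj.as.X n))
    exact unitSplit_of_iso _ (asIso ((baseChange (adjunction p γ) (adjunction p g')
      (pushforwardSq p sq₁.w).hom).app ((pullback p π).obj (K.obj.as.X n)))) (unitSplit_right _ _)

end Frob
end FrobeniusModules

theorem mainTheorem9 (p : ℕ) [Fact p.Prime] {X' X S' S : Scheme.{u}}
    [IsFpScheme p X'] [IsFpScheme p X] [IsFpScheme p S'] [IsFpScheme p S]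
    [IsGeometric X'] [IsGeometric X] [IsGeometric S'] [IsGeometric S]
    [HasDerivedCategory (Frob p X')] [HasDerivedCategory (Frob p X)]
    [HasDerivedCategory (Frob p S')] [HasDerivedCategory (Frob p S)]
    {g' : X' ⟶ X} {f' : X' ⟶ S'} {f : X ⟶ S} {g : S' ⟶ S} (sq : IsPullback g' f' f g)
    [Flat g] (M : DerivedCategory.Plus (Frob p X)) :
    have : Flat g' := flat_of_isPullback sq
    IsIso (Frob.baseChangeMap p sq.w M) := by
  have : Flat g' := flat_of_isPullback sq
  exact Frob.isIso_baseChangeMap p sq M
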